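/- Let $n\in\{2,3\}$, let $\lambda,\mu\in\mathbb R$ satisfy $\mu>0$ and $n\lambda+2\mu>0$, and let $y^{(1)},\dots,y^{(N)}\in\mathbb R^n$ be pairwise distinct. Let $L_0u=-\mu\Delta u-(\lambda+\mu)\nabla\operatorname{div}u$ be the Lamé operator in $(L^2(\mathbb R^n))^n$ with domain $(H^2(\mathbb R^n))^n$, and let $\mathcal K_z=(L_0-z)^{-1}$ for $z\in\mathbb C\setminus[0,\infty)$. Let $\gamma:(H^2(\mathbb R^n))^n\to\mathbb C^{n,N}$, $(\gamma u)_{j,k}=u_j(y^{(k)})$, and let $G_z=\mathcal K_z\gamma^*:\mathbb C^{n,N}\to(L^2(\mathbb R^n))^n$, i.e. $\langle G_zX,f\rangle=\langle X,\gamma\mathcal K_{\bar z}f\rangle$ for all $f\in(L^2(\mathbb R^n))^n$. Let $\theta$ be a selfadjoint linear operator on $\mathbb C^{n,N}$. Let $Z$ be the set of those $z\in\mathbb C\setminus[0,\infty)$ for which $\theta+\gamma(G_{-1}-G_z)$ is invertible, and put $\Lambda_z(\theta)=(\theta+\gamma(G_{-1}-G_z))^{-1}$ for $z\in Z$. Then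 $\mathbb C\setminus\mathbb R\subseteq Z$, and there is exactly one selfadjoint extension $L_{\Lambda(\theta)}$ of $L_0\upharpoonright\ker\gamma$ whose resolvent at every $z\in Z$ is $\mathcal K_z+G_z\Lambda_z(\theta)(G_{\bar z})^*$. Let $\Phi_z$ be the Green function of $-\Delta-z$, that is, with $\zeta^2=z$ and $\operatorname{Im}\zeta>0$, $\Phi_z(x)=\frac i4H^{(1)}_0(\zeta|x|)$ if $n=2$ and $\Phi_z(x)=\frac{e^{i\zeta|x|}}{4\pi|x|}$ if $n=3$. For $x\neq0$ let $$\Gamma_z(x)=\tfrac1\mu\Phi_{z/\mu}(x)\,\mathbf I_n+\tfrac1z\nabla\operatorname{div}\big((\Phi_{z/\mu}(x)-\Phi_{z/(\lambda+2\mu)}(x))\,\mathbf I_n\big)$$ be the Green tensor of $L_0-z$, and let $\Gamma_0$ be the static Green tensor, $$\Gamma_0(x)=\tfrac1{4\pi}\Big[-\tfrac{\lambda+3\mu}{\mu(\lambda+2\mu)}\ln|x|\,\mathbf I_2+\tfrac{\lambda+\mu}{\mu(\lambda+2\mu)}\tfrac{xx^T}{|x|^2}\Big]\ (n=2),\qquad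 \Gamma_0(x)=\tfrac{\lambda+3\mu}{8\pi\mu(\lambda+2\mu)}\tfrac{\mathbf I_3}{|x|}+\tfrac{\lambda+\mu}{8\pi\mu(\lambda+2\mu)}\tfrac{xx^T}{|x|^3}\ (n=3).$$ The limit $\chi_{-1}\mathbf I_n=\lim_{x\to0}(\Gamma_{-1}(x)-\Gamma_0(x))$ exists and defines a number $\chi_{-1}$. Let $\Xi_{-1}$ be the operator on $\mathbb C^{n,N}$ given by $$(\Xi_{-1}X)_{j,k}=\sum_{k'\neq k}\sum_{\ell=1}^n\big(\Gamma_{-1}(y^{(k)}-y^{(k')})\big)_{j,\ell}X_{\ell,k'}.$$ For $u\in\mathsf{dom}((L_0\upharpoonright\ker\gamma)^*)$ (represented by a function continuous off the points $y^{(k)}$) the limits $$(\tau_1u)_{j,k}=\lim_{x\to y^{(k)}}\sum_{\ell=1}^n\big(\Gamma_0^{-1}(x-y^{(k)})\big)_{j,\ell}u_\ell(x),\qquad(\tau_2u)_{j,k}=\lim_{x\to y^{(k)}}\Big(u_j(x)-\sum_{\ell=1}^n\big(\Gamma_0(x-y^{(k)})\big)_{j,\ell}(\tau_1u)_{\ell,k}\Big)$$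 exist. The domain of $L_{\Lambda(\theta)}$, which for every $z\in Z$ equals $\{u_0+G_z\Lambda_z(\theta)\gamma u_0:\ u_0\in(H^2(\mathbb R^n))^n\}$, is $$\mathsf{dom}(L_{\Lambda(\theta)})=\big\{u\in\mathsf{dom}((L_0\upharpoonright\ker\gamma)^*):\ \tau_2u=(\Xi_{-1}+\theta+\chi_{-1}\mathbf I)\,\tau_1u\big\}.$$ -/

import Mathlib

open MeasureTheory TemperedDistribution Filter Topology
open scoped SchwartzMap LineDeriv Laplacian ENNReal ComplexConjugate

noncomputable section

namespace Lame

/-! ### Spaces -/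

/-- Euclidean space `ℝⁿ`. -/
abbrev Space (n : ℕ) : Type := EuclideanSpace ℝ (Fin n)

/-- The vector space `ℂⁿ` of values of the displacement fields. -/
abbrev Val (n : ℕ) : Type := EuclideanSpace ℂ (Fin n)

/-- The Hilbert space `(L²(ℝⁿ))ⁿ`. -/
abbrev L2 (n : ℕ) : Type := Lp (Val n) 2 (volume : Measure (Space n))

/-- The space `ℂ^{n,N}` of matrices `(A_{j,k})`, with the scalar product
`⟨A, B⟩ = ∑_{j,k} conj A_{j,k} * B_{j,k}`. -/
abbrev Mat (n N : ℕ) : Type := EuclideanSpace ℂ (Fin n × Fin N)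

/-! ### The Lamé operator on `H²` -/

/-- The matrix unit `v ↦ v_j e_l` of `ℂⁿ`. -/
def matUnit (n : ℕ) (l j : Fin n) : Val n →L[ℂ] Val n :=
  ContinuousLinearMap.smulRight (EuclideanSpace.proj j : Val n →L[ℂ] ℂ)
    (EuclideanSpace.single l (1 : ℂ))

/-- `∇ div` on vector-valued tempered distributions: `(∇ div f)_l = ∑_j ∂_l ∂_j f_j`. -/
def gradDiv (n : ℕ) : 𝓢'(Space n, Val n) →ₗ[ℂ] 𝓢'(Space n, Val n) :=
  ∑ l : Fin n, ∑ j : Fin n,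
    (PointwiseConvergenceCLM.postcomp 𝓢(Space n, ℂ) (matUnit n l j)).toLinearMap ∘ₗ
      (LineDeriv.lineDerivOpCLM ℂ 𝓢'(Space n, Val n)
        (EuclideanSpace.single l (1 : ℝ) : Space n)).toLinearMap ∘ₗ
      (LineDeriv.lineDerivOpCLM ℂ 𝓢'(Space n, Val n)
        (EuclideanSpace.single j (1 : ℝ) : Space n)).toLinearMap

/-- The differential expression `-μ Δ - (λ + μ) ∇ div` on tempered distributions. -/
def lameDistr (n : ℕ) (lam mu : ℝ) : 𝓢'(Space n, Val n) →ₗ[ℂ] 𝓢'(Space n, Val n) :=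
  -((mu : ℂ) • (LineDeriv.laplacianCLM ℂ (Space n) 𝓢'(Space n, Val n)).toLinearMap)
    - ((lam : ℂ) + (mu : ℂ)) • gradDiv n

/-- `(H²(ℝⁿ))ⁿ` as a subspace of `(L²(ℝⁿ))ⁿ`. -/
def H2 (n : ℕ) : Submodule ℂ (L2 n) where
  carrier := {u | MemSobolev 2 2 (u : 𝓢'(Space n, Val n))}
  zero_mem' := by
    have h : ((0 : L2 n) : 𝓢'(Space n, Val n)) = 0 :=
      map_zero (Lp.toTemperedDistributionCLM (Val n) (volume : Measure (Space n)) 2)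
    simp only [Set.mem_ofPred_eq, h]
    exact memSobolev_fun_zero _ _ 2 2
  add_mem' := by
    intro u v hu hv
    have h : ((u + v : L2 n) : 𝓢'(Space n, Val n)) = u + v :=
      map_add (Lp.toTemperedDistributionCLM (Val n) (volume : Measure (Space n)) 2) u v
    simp only [Set.mem_ofPred_eq, h] at hu hv ⊢
    exact hu.add hv
  smul_mem' := by
    intro c u hu
    have h : ((c • u : L2 n) : 𝓢'(Space n, Val n)) = c • (u : 𝓢'(Space n, Val n)) :=
      map_smul (Lp.toTemperedDistributionCLM (Val n) (volume : Measure (Space n)) 2) c u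
    simp only [Set.mem_ofPred_eq, h] at hu ⊢
    exact hu.smul c

theorem toTemperedDistribution_injective {n : ℕ} {u v : L2 n}
    (h : (u : 𝓢'(Space n, Val n)) = v) : u = v :=
  LinearMap.ker_eq_bot.1
    (Lp.ker_toTemperedDistributionCLM_eq_bot (F := Val n) (μ := (volume : Measure (Space n)))
      (p := 2)) h

theorem memSobolev_zero_postcomp {n : ℕ} (A : Val n →L[ℂ] Val n) {f : 𝓢'(Space n, Val n)}
    (hf : MemSobolev 0 2 f) :
    MemSobolev 0 2 (PointwiseConvergenceCLM.postcomp 𝓢(Space n, ℂ) A f) := by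
  rw [memSobolev_zero_iff] at hf ⊢
  obtain ⟨g, rfl⟩ := hf
  refine ⟨A.compLp g, ?_⟩
  ext1 φ
  have hφ : Integrable (fun x => φ x • g x) (volume : Measure (Space n)) :=
    memLp_one_iff_integrable.1 ((Lp.memLp g).smul (φ.memLp 2 volume))
  change A ((g : 𝓢'(Space n, Val n)) φ) = ((A.compLp g : L2 n) : 𝓢'(Space n, Val n)) φ
  rw [Lp.toTemperedDistribution_apply, Lp.toTemperedDistribution_apply,
    ← A.integral_comp_comm hφ]
  refine integral_congr_ae ?_
  filter_upwards [A.coeFn_compLp g] with x hx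
  rw [hx, map_smul]

theorem memSobolev_sum {n : ℕ} {ι : Type*} (t : Finset ι) (f : ι → 𝓢'(Space n, Val n))
    (hf : ∀ i ∈ t, MemSobolev 0 2 (f i)) : MemSobolev 0 2 (∑ i ∈ t, f i) := by
  classical
  induction t using Finset.induction_on with
  | empty => simp
  | insert a t ha ih =>
    rw [Finset.sum_insert ha]
    exact (hf a (by simp)).add (ih fun i hi => hf i (by simp [hi]))

/-- The Lamé expression maps `H²` into `L²`. -/
theorem exists_lameDistr_eq {n : ℕ} (lam mu : ℝ) (u : H2 n) :
    ∃ v : L2 n, lameDistr n lam mu ((u : L2 n) : 𝓢'(Space n, Val n)) = v := by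
  have hu : MemSobolev 2 2 ((u : L2 n) : 𝓢'(Space n, Val n)) := u.2
  rw [← memSobolev_zero_iff]
  have hlap := hu.laplacian
  rw [sub_self] at hlap
  have hgd : MemSobolev 0 2 (gradDiv n ((u : L2 n) : 𝓢'(Space n, Val n))) := by
    simp only [gradDiv, LinearMap.sum_apply, LinearMap.comp_apply]
    refine memSobolev_sum _ _ fun l _ => memSobolev_sum _ _ fun j _ => ?_
    refine memSobolev_zero_postcomp _ ?_
    have h := (hu.lineDerivOp (m := (EuclideanSpace.single j (1 : ℝ) : Space n))).lineDerivOp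
      (m := (EuclideanSpace.single l (1 : ℝ) : Space n))
    norm_num at h
    exact h
  have h := ((hlap.smul (mu : ℂ)).neg).sub (hgd.smul ((lam : ℂ) + (mu : ℂ)))
  simpa [lameDistr] using h

/-- The selfadjoint Lamé operator `L₀ u = -μ Δ u - (λ + μ) ∇ div u` in `(L²(ℝⁿ))ⁿ`, with domain
`(H²(ℝⁿ))ⁿ`. -/
def lame (n : ℕ) (lam mu : ℝ) : L2 n →ₗ.[ℂ] L2 n where
  domain := H2 n
  toFun :=
    { toFun := fun u => (exists_lameDistr_eq lam mu u).choose
      map_add' := fun u v => by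
        apply toTemperedDistribution_injective
        refine (exists_lameDistr_eq lam mu (u + v)).choose_spec.symm.trans ?_
        have h1 := (exists_lameDistr_eq lam mu u).choose_spec
        have h2 := (exists_lameDistr_eq lam mu v).choose_spec
        have h3 := map_add (Lp.toTemperedDistributionCLM (Val n) (volume : Measure (Space n)) 2)
        have h4 := map_add (lameDistr n lam mu)
        exact ((congrArg (lameDistr n lam mu) (h3 u v)).trans (h4 _ _)).trans
          ((congrArg₂ (· + ·) h1 h2).trans (h3 _ _).symm)
      map_smul' := fun c u => by
        apply toTemperedDistribution_injective
        refine (exists_lameDistr_eq lam mu (c • u)).choose_spec.symm.trans ?_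
        have h1 := (exists_lameDistr_eq lam mu u).choose_spec
        have h3 := map_smul (Lp.toTemperedDistributionCLM (Val n) (volume : Measure (Space n)) 2)
        have h4 := map_smul (lameDistr n lam mu)
        exact ((congrArg (lameDistr n lam mu) (h3 c u)).trans (h4 _ _)).trans
          ((congrArg (c • ·) h1).trans (h3 _ _).symm) }

/-- The defining property of `L₀`, as an identity of tempered distributions. -/
theorem lame_spec (n : ℕ) (lam mu : ℝ) (u : H2 n) :
    ((lame n lam mu u : L2 n) : 𝓢'(Space n, Val n))
      = lameDistr n lam mu ((u : L2 n) : 𝓢'(Space n, Val n)) :=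
  (exists_lameDistr_eq lam mu u).choose_spec.symm

/-! ### Point evaluations -/

/-- Neighbourhoods of `x` up to null sets. A function (class) `u` which is a.e. equal to a function
continuous in a punctured neighbourhood of `x` has the limit `a` along this filter if and only if
its continuous representative has the limit `a` at `x`, in the usual sense. -/
def essNhds {n : ℕ} (x : Space n) : Filter (Space n) := 𝓝 x ⊓ ae volume

/-- The trace `(γ u)_{j,k} = u_j(y⁽ᵏ⁾)`. A function of class `H²` has a continuous representative
for `n ≤ 3`, and its value at `y⁽ᵏ⁾` is the limit taken here. -/
def gammaTrace {n N : ℕ} (Y : Fin N → Space n) (u : L2 n) : Mat n N :=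
  WithLp.toLp 2 fun p => limUnder (essNhds (Y p.2)) fun x => u x p.1

/-- The functions which vanish at the points of `Y`; within `H²` this is `ker γ`. -/
def kerTrace {n N : ℕ} (Y : Fin N → Space n) : Submodule ℂ (L2 n) where
  carrier := {u | ∀ k, Tendsto u (essNhds (Y k)) (𝓝 0)}
  zero_mem' := fun k =>
    Tendsto.congr' (((Lp.coeFn_zero _ _ _).symm.filter_mono inf_le_right)) tendsto_const_nhds
  add_mem' := fun {u v} hu hv k => by
    refine Tendsto.congr' ((Lp.coeFn_add u v).symm.filter_mono inf_le_right) ?_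
    have h := (hu k).add (hv k)
    rwa [add_zero] at h
  smul_mem' := fun c u hu k => by
    refine Tendsto.congr' ((Lp.coeFn_smul c u).symm.filter_mono inf_le_right) ?_
    have h := (hu k).const_smul c
    rwa [smul_zero] at h

/-- The symmetric restriction of `L₀` to `ker γ`. -/
def lameMin {n N : ℕ} (lam mu : ℝ) (Y : Fin N → Space n) : L2 n →ₗ.[ℂ] L2 n :=
  (lame n lam mu).domRestrict (kerTrace Y)

/-! ### Resolvents and the Krein formula -/

/-- `R` is the bounded inverse of `T - z`. -/
def IsResolventAt {n : ℕ} (T : L2 n →ₗ.[ℂ] L2 n) (z : ℂ) (R : L2 n →L[ℂ] L2 n) : Prop :=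
  (∀ f : L2 n, ∃ h : R f ∈ T.domain, T ⟨R f, h⟩ - z • R f = f) ∧
    ∀ u : T.domain, R (T u - z • (u : L2 n)) = u

/-- The resolvent `K_z = (L₀ - z)⁻¹`, for `z ∈ ℂ ∖ [0, ∞)`. -/
def lameRes (n : ℕ) (lam mu : ℝ) (z : ℂ) : L2 n →L[ℂ] L2 n :=
  Classical.epsilon fun R => IsResolventAt (lame n lam mu) z R

/-- The bounded operator `γ K_z` from `(L²(ℝⁿ))ⁿ` to `ℂ^{n,N}`, for `z ∈ ℂ ∖ [0, ∞)`. -/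
def traceRes {n N : ℕ} (lam mu : ℝ) (Y : Fin N → Space n) (z : ℂ) : L2 n →L[ℂ] Mat n N :=
  Classical.epsilon fun B => ∀ f, B f = gammaTrace Y (lameRes n lam mu z f)

/-- The operator `G_z = K_z γ*`, where `K_z` acts on `H⁻²` by duality. As `K_z` is dual to
`K_{conj z}`, this says `⟨G_z X, f⟩ = ⟨X, γ K_{conj z} f⟩` for all `f` in `(L²(ℝⁿ))ⁿ`. -/
def gField {n N : ℕ} (lam mu : ℝ) (Y : Fin N → Space n) (z : ℂ) : Mat n N →L[ℂ] L2 n :=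
  ContinuousLinearMap.adjoint (traceRes lam mu Y (conj z))

/-- The linear map `γ (G_{-1} - G_z)` of `ℂ^{n,N}`, given by its values on the standard basis. -/
def traceDiff {n N : ℕ} (lam mu : ℝ) (Y : Fin N → Space n) (z : ℂ) : Mat n N →L[ℂ] Mat n N :=
  Matrix.toEuclideanCLM (𝕜 := ℂ) (n := Fin n × Fin N) <| Matrix.of fun p q =>
    gammaTrace Y (gField lam mu Y (-1) (EuclideanSpace.single q (1 : ℂ))
      - gField lam mu Y z (EuclideanSpace.single q (1 : ℂ))) p

/-- The set of the `z ∈ ℂ ∖ [0, ∞)` for which `θ + γ (G_{-1} - G_z)` is invertible. -/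
def zSet {n N : ℕ} (lam mu : ℝ) (Y : Fin N → Space n) (θ : Mat n N →L[ℂ] Mat n N) : Set ℂ :=
  {z | (z.im ≠ 0 ∨ z.re < 0) ∧ IsUnit (θ + traceDiff lam mu Y z)}

/-- `Λ_z(θ) = (θ + γ (G_{-1} - G_z))⁻¹`. -/
def weyl {n N : ℕ} (lam mu : ℝ) (Y : Fin N → Space n) (θ : Mat n N →L[ℂ] Mat n N) (z : ℂ) :
    Mat n N →L[ℂ] Mat n N :=
  Ring.inverse (θ + traceDiff lam mu Y z)

/-- The right-hand side `K_z + G_z Λ_z(θ) (G_{conj z})*` of the Krein formula. -/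
def kreinRes {n N : ℕ} (lam mu : ℝ) (Y : Fin N → Space n) (θ : Mat n N →L[ℂ] Mat n N) (z : ℂ) :
    L2 n →L[ℂ] L2 n :=
  lameRes n lam mu z + gField lam mu Y z ∘L weyl lam mu Y θ z ∘L
    ContinuousLinearMap.adjoint (gField lam mu Y (conj z))

/-- `T` is the point perturbation `L_{Λ(θ)}`: the selfadjoint extension of `L₀` restricted to
`ker γ` whose resolvent is given by the Krein formula. -/
structure IsPointPerturbation {n N : ℕ} (lam mu : ℝ) (Y : Fin N → Space n)
    (θ : Mat n N →L[ℂ] Mat n N) (T : L2 n →ₗ.[ℂ] L2 n) : Prop where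
  selfAdjoint : IsSelfAdjoint T
  extends_min : lameMin lam mu Y ≤ T
  resolvent : ∀ z ∈ zSet lam mu Y θ, IsResolventAt T z (kreinRes lam mu Y θ z)

/-- The set `{u₀ + G_z Λ_z(θ) γ u₀ : u₀ ∈ (H²(ℝⁿ))ⁿ}`. -/
def kreinDomain {n N : ℕ} (lam mu : ℝ) (Y : Fin N → Space n) (θ : Mat n N →L[ℂ] Mat n N) (z : ℂ) :
    Set (L2 n) :=
  {u | ∃ u₀ ∈ H2 n, u = u₀ + gField lam mu Y z (weyl lam mu Y θ z (gammaTrace Y u₀))}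

/-! ### Green tensors -/

/-- The square root `ζ` of `z ∈ ℂ ∖ [0, ∞)` with positive imaginary part. -/
def upperRoot (z : ℂ) : ℂ := Complex.I * (-z) ^ (1 / 2 : ℂ)

/-- The Hankel function `H₀⁽¹⁾` in the upper half plane, through
`H₀⁽¹⁾(w) = (π i)⁻¹ ∫ exp (i w cosh t) dt`. -/
def hankelZero (w : ℂ) : ℂ :=
  (1 / (Real.pi * Complex.I)) * ∫ t : ℝ, Complex.exp (Complex.I * w * Real.cosh t)

/-- The Green function `Φ_z` of `-Δ - z` in dimensions two and three, for `z ∈ ℂ ∖ [0, ∞)`. -/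
def helmholtzGreen (n : ℕ) (z : ℂ) (x : Space n) : ℂ :=
  if n = 2 then Complex.I / 4 * hankelZero (upperRoot z * ‖x‖)
  else Complex.exp (Complex.I * upperRoot z * ‖x‖) / (4 * Real.pi * ‖x‖)

/-- The second partial derivative `∂_j ∂_l g`. -/
def secondPartial {n : ℕ} (j l : Fin n) (g : Space n → ℂ) (x : Space n) : ℂ :=
  fderiv ℝ (fun y => fderiv ℝ g y (EuclideanSpace.single l 1)) x (EuclideanSpace.single j 1)

/-- The Green tensor of the Lamé operator,
`Γ_z = μ⁻¹ Φ_{z/μ} I + z⁻¹ ∇ div ((Φ_{z/μ} - Φ_{z/(λ+2μ)}) I)`. -/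
def lameGreen (n : ℕ) (lam mu : ℝ) (z : ℂ) (x : Space n) : Matrix (Fin n) (Fin n) ℂ :=
  Matrix.of fun j l =>
    1 / (mu : ℂ) * helmholtzGreen n (z / mu) x * (1 : Matrix (Fin n) (Fin n) ℂ) j l
      + 1 / z * secondPartial j l
          (fun y => helmholtzGreen n (z / mu) y - helmholtzGreen n (z / (lam + 2 * mu)) y) x

/-- The static Green tensor `Γ₀` (Kelvin matrix) in dimensions two and three. -/
def kelvin (n : ℕ) (lam mu : ℝ) (x : Space n) : Matrix (Fin n) (Fin n) ℂ :=
  Matrix.of fun j l =>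
    (((if n = 2 then
        1 / (4 * Real.pi) *
          (-((lam + 3 * mu) / (mu * (lam + 2 * mu))) * Real.log ‖x‖ *
              (1 : Matrix (Fin n) (Fin n) ℝ) j l
            + (lam + mu) / (mu * (lam + 2 * mu)) * (x j * x l / ‖x‖ ^ 2))
      else
        (lam + 3 * mu) / (8 * Real.pi * mu * (lam + 2 * mu)) *
            ((1 : Matrix (Fin n) (Fin n) ℝ) j l / ‖x‖)
          + (lam + mu) / (8 * Real.pi * mu * (lam + 2 * mu)) * (x j * x l / ‖x‖ ^ 3)) : ℝ) : ℂ)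

/-- `χ` is the constant with `Γ_z(x) - Γ₀(x) → χ I` as `x → 0`. -/
def IsChi (n : ℕ) (lam mu : ℝ) (z χ : ℂ) : Prop :=
  Tendsto (fun x : Space n => lameGreen n lam mu z x - kelvin n lam mu x) (𝓝[≠] 0)
    (𝓝 (χ • (1 : Matrix (Fin n) (Fin n) ℂ)))

/-- The constant `χ_z`, defined by `χ_z I = lim_{x → 0} (Γ_z(x) - Γ₀(x))`. -/
def chi (n : ℕ) (lam mu : ℝ) (z : ℂ) : ℂ :=
  Classical.epsilon fun χ => IsChi n lam mu z χ

/-- The operator `(Ξ_z X)_{j,k} = ∑_{k' ≠ k} (Γ_z(y⁽ᵏ⁾ - y⁽ᵏ'⁾) X)_{j,k'}` of `ℂ^{n,N}`. -/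
def xi {n N : ℕ} (lam mu : ℝ) (Y : Fin N → Space n) (z : ℂ) : Mat n N →L[ℂ] Mat n N :=
  Matrix.toEuclideanCLM (𝕜 := ℂ) (n := Fin n × Fin N) <| Matrix.of fun p q =>
    if q.2 = p.2 then 0 else lameGreen n lam mu z (Y p.2 - Y q.2) p.1 q.1

/-! ### Singular and regular parts -/

/-- The function `x ↦ ∑_l (Γ₀(x - y⁽ᵏ⁾)⁻¹)_{j,l} u_l(x)` with `p = (j, k)`. -/
def tauOneFun {n N : ℕ} (lam mu : ℝ) (Y : Fin N → Space n) (u : L2 n) (p : Fin n × Fin N)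
    (x : Space n) : ℂ :=
  ∑ l, (kelvin n lam mu (x - Y p.2))⁻¹ p.1 l * u x l

/-- The coefficient of the singular part: `τ₁ u` is the limit of `tauOneFun` at `y⁽ᵏ⁾`. -/
def tauOne {n N : ℕ} (lam mu : ℝ) (Y : Fin N → Space n) (u : L2 n) : Mat n N :=
  WithLp.toLp 2 fun p => limUnder (essNhds (Y p.2)) (tauOneFun lam mu Y u p)

/-- The function `x ↦ u_j(x) - ∑_l (Γ₀(x - y⁽ᵏ⁾))_{j,l} (τ₁ u)_{l,k}` with `p = (j, k)`. -/
def tauTwoFun {n N : ℕ} (lam mu : ℝ) (Y : Fin N → Space n) (u : L2 n) (p : Fin n × Fin N)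
    (x : Space n) : ℂ :=
  u x p.1 - ∑ l, kelvin n lam mu (x - Y p.2) p.1 l * tauOne lam mu Y u (l, p.2)

/-- The regular part: `τ₂ u` is the limit of `tauTwoFun` at `y⁽ᵏ⁾`. -/
def tauTwo {n N : ℕ} (lam mu : ℝ) (Y : Fin N → Space n) (u : L2 n) : Mat n N :=
  WithLp.toLp 2 fun p => limUnder (essNhds (Y p.2)) (tauTwoFun lam mu Y u p)

/-- The functions `u` in the domain of `(L₀|ker γ)*` with
`τ₂ u = (Ξ_{-1} + θ + χ_{-1} I) τ₁ u`. -/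
def bcDomain {n N : ℕ} (lam mu : ℝ) (Y : Fin N → Space n) (θ : Mat n N →L[ℂ] Mat n N) :
    Set (L2 n) :=
  {u | u ∈ (lameMin lam mu Y).adjoint.domain ∧
    tauTwo lam mu Y u =
      (xi lam mu Y (-1) + θ + chi n lam mu (-1) • ContinuousLinearMap.id ℂ (Mat n N))
        (tauOne lam mu Y u)}

end Lame

end

noncomputable section

open scoped FourierTransform InnerProductSpace

namespace Lame

section

variable {n : ℕ}

/-! ### Testing against Schwartz functions -/

/-! Write S = `lameMin` for the restriction of L₀ to ker γ. Two facts about γ carry the abstract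
half: it maps H² onto ℂ^{n,N} (bump functions at the points), and it is unbounded for the L² norm in
every direction. The first makes every linear functional on H² that vanishes on ker γ equal to ⟨X, γ
·⟩ for some X; the second makes S densely defined. The domain of S* then consists of the functions u
+ G_{-1}X with u in H² (`mem_adjoint_domain_iff`), where S* acts as L₀u - G_{-1}X. The boundary form
of S* is ⟨γu, W⟩ - ⟨X, γw⟩ (`green_identity`), so for selfadjoint θ the condition γu = θX cuts out a
selfadjoint operator, `bvOperator`. Since G_z - G_{-1} maps into H², solving (T - z)v = f under this
condition amounts to (θ + γ(G_{-1} - G_z))X = γK_z f, which is the Krein formula. An operator is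
fixed by its resolvent at one point, hence uniqueness. Non-real z are admissible because Im⟨X,
γ(G_{-1} - G_z)X⟩ = -Im z ‖G_z X‖².

The concrete half turns γu = θX into the condition on τ₁ and τ₂. The columns of G_{-1}, known so far
only through their Fourier transforms, must be recognised as columns of Γ_{-1}. The Helmholtz Green
functions at negative energy are Laplace transforms in time of heat kernels (`helmholtzGreen_neg`),
so the entries of Γ_{-1} are time integrals of Gaussians with quadratic factors; Fubini gives their
Fourier transform (`fourier_greenEntry`), and it agrees with the inverse of the Lamé symbol
(`gField_single_ae_eq`). The same integrals describe Γ_{-1} near 0: expanding the damping factor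
exp(-at) at t = 0 produces the Kelvin matrix as leading term. In the variable s = |x|² the remainder
of the scalar part has an integrable derivative, and that of the x xᵀ part vanishes in the limit; so
χ_{-1} exists. Finally u + G_{-1}X minus its Kelvin singularity tends to γu + Ξ_{-1}X + χ_{-1}X
(`tendsto_sub_kelvin`), and the inverse Kelvin matrix tends to 0, so τ₁ = X. The terms with Ξ_{-1}
and χ_{-1} then cancel from the boundary condition, which leaves γu = θX. -/

theorem ae_eq_of_integral_schwartz_smul_eq {f g : Space n → Val n}
    (hf : LocallyIntegrable f) (hg : LocallyIntegrable g)
    (h : ∀ φ : 𝓢(Space n, ℂ), ∫ x, φ x • f x = ∫ x, φ x • g x) : f =ᵐ[volume] g := by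
  refine ae_eq_of_integral_contDiff_smul_eq hf hg fun φ hφ hc => ?_
  have hc' : HasCompactSupport fun x => (φ x : ℂ) := hc.comp_left Complex.ofReal_zero
  exact h (hc'.toSchwartzMap (Complex.ofRealCLM.contDiff.comp hφ))

theorem locallyIntegrable_L2 (u : L2 n) : LocallyIntegrable (u : Space n → Val n) :=
  (Lp.memLp u).locallyIntegrable (by norm_num)

/-- Plancherel in distributional form, from φ = 𝓕 𝓕⁻ φ. It is the bridge from L² classes to
pointwise inversion formulas. -/
theorem fourier_apply_eq (u : L2 n) (φ : 𝓢(Space n, ℂ)) :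
    ((u : L2 n) : 𝓢'(Space n, Val n)) φ = ∫ x, (𝓕⁻ φ) x • (𝓕 u : L2 n) x := by
  have h := Lp.fourier_toTemperedDistribution_eq u
  have h2 := congrArg (fun T : 𝓢'(Space n, Val n) => T (𝓕⁻ φ)) h
  simp only [TemperedDistribution.fourier_apply, FourierTransform.fourier_fourierInv_eq,
    Lp.toTemperedDistribution_apply] at h2
  rw [Lp.toTemperedDistribution_apply, h2]

/-- Sobolev regularity is phrased with tempered distributions; this turns it into almost everywhere
statements about Fourier transforms in L². -/
theorem smulLeftCLM_eq_iff {m : Space n → ℂ} (hm : m.HasTemperateGrowth) (u v : L2 n) :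
    smulLeftCLM (Val n) m ((u : L2 n) : 𝓢'(Space n, Val n)) = v ↔
      (fun ξ => m ξ • u ξ) =ᵐ[volume] v := by
  constructor
  · intro h
    refine ae_eq_of_integral_schwartz_smul_eq
      ((locallyIntegrable_L2 u).continuous_smul hm.1.continuous)
      (locallyIntegrable_L2 v) fun φ => ?_
    have h2 := congrArg (fun T : 𝓢'(Space n, Val n) => T φ) h
    simp only [smulLeftCLM_apply_apply, Lp.toTemperedDistribution_apply] at h2
    rw [← h2]
    refine integral_congr_ae (ae_of_all _ fun x => ?_)
    simp [hm, smul_smul, mul_comm]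
  · intro h
    ext1 φ
    simp only [smulLeftCLM_apply_apply, Lp.toTemperedDistribution_apply]
    refine integral_congr_ae ?_
    filter_upwards [h] with x hx
    simp [hm, ← hx, smul_smul, mul_comm]

/-! ### The symbol of the Lamé operator -/

/-- A real vector as an element of `ℂⁿ`. -/
def cvec (ξ : Space n) : Val n := WithLp.toLp 2 fun i => (ξ i : ℂ)

theorem cvec_apply (ξ : Space n) (i : Fin n) : cvec ξ i = ξ i := rfl

theorem norm_cvec (ξ : Space n) : ‖cvec ξ‖ = ‖ξ‖ := by
  simp [EuclideanSpace.norm_eq, cvec_apply]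

theorem continuous_cvec : Continuous (cvec : Space n → Val n) := by
  unfold cvec; fun_prop

theorem inner_cvec_self (ξ : Space n) : ⟪cvec ξ, cvec ξ⟫_ℂ = (‖ξ‖ ^ 2 : ℝ) := by
  rw [inner_self_eq_norm_sq_to_K, norm_cvec]; norm_cast

/-- The symbol `v ↦ a v + b ⟨ξ, v⟩ ξ`. -/
def symb (a b : ℂ) (ξ : Space n) : Val n →L[ℂ] Val n :=
  a • ContinuousLinearMap.id ℂ (Val n) + b • (innerSL ℂ (cvec ξ)).smulRight (cvec ξ)

theorem symb_apply (a b : ℂ) (ξ : Space n) (v : Val n) :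
    symb a b ξ v = a • v + (b * ⟪cvec ξ, v⟫_ℂ) • cvec ξ := by
  simp [symb, smul_smul]

/-- The family is closed under composition because (ξ ξ*)² = |ξ|² ξ ξ*. The inverse of the Lamé
symbol can therefore be sought in the same family. -/
theorem symb_symb (a b c d : ℂ) (ξ : Space n) (v : Val n) :
    symb a b ξ (symb c d ξ v) =
      symb (a * c) (a * d + b * c + b * d * (‖ξ‖ ^ 2 : ℝ)) ξ v := by
  simp only [symb_apply, inner_add_right, inner_smul_right, inner_cvec_self]
  module

theorem norm_symb_le (a b : ℂ) (ξ : Space n) : ‖symb a b ξ‖ ≤ ‖a‖ + ‖b‖ * ‖ξ‖ ^ 2 := by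
  refine ContinuousLinearMap.opNorm_le_bound _ (by positivity) fun v => ?_
  rw [symb_apply]
  refine (norm_add_le _ _).trans ?_
  rw [norm_smul, norm_smul, norm_mul, norm_cvec]
  have := norm_inner_le_norm (𝕜 := ℂ) (cvec ξ) v
  rw [norm_cvec] at this
  calc ‖a‖ * ‖v‖ + ‖b‖ * ‖⟪cvec ξ, v⟫_ℂ‖ * ‖ξ‖
      ≤ ‖a‖ * ‖v‖ + ‖b‖ * (‖ξ‖ * ‖v‖) * ‖ξ‖ := by gcongr
    _ = _ := by ring

theorem inner_symb_left (a b : ℂ) (ξ : Space n) (v w : Val n) :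
    ⟪symb a b ξ v, w⟫_ℂ = ⟪v, symb (conj a) (conj b) ξ w⟫_ℂ := by
  simp only [symb_apply, inner_add_left, inner_add_right, inner_smul_left, inner_smul_right,
    map_mul, inner_conj_symm]
  ring

theorem continuous_symb {a b : Space n → ℂ} (ha : Continuous a) (hb : Continuous b) :
    Continuous fun ξ => symb (a ξ) (b ξ) ξ := by
  unfold symb
  have h1 : Continuous fun ξ : Space n => (innerSL ℂ (cvec ξ)).smulRight (cvec ξ) := by
    have h2 : Continuous fun ξ : Space n => innerSL ℂ (cvec ξ) :=
      (innerSL ℂ (E := Val n)).continuous.comp continuous_cvec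
    exact ((ContinuousLinearMap.smulRightL ℂ (Val n) (Val n)).continuous.comp h2).clm_apply
      continuous_cvec
  exact (ha.smul continuous_const).add (hb.smul h1)

/-- Multiplication by a bounded continuous operator-valued function. -/
theorem exists_multiplication {m : Space n → Val n →L[ℂ] Val n} (hm : Continuous m) {C : ℝ}
    (hC : ∀ ξ, ‖m ξ‖ ≤ C) :
    ∃ R : L2 n →L[ℂ] L2 n, ∀ f : L2 n, R f =ᵐ[volume] fun ξ => m ξ (f ξ) := by
  have hmem : MemLp m ∞ (volume : Measure (Space n)) :=
    memLp_top_of_bound hm.aestronglyMeasurable C (ae_of_all _ hC)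
  refine ⟨(ContinuousLinearMap.id ℂ (Val n →L[ℂ] Val n)).holderL volume ∞ 2 2 hmem.toLp,
    fun f => ?_⟩
  filter_upwards [(ContinuousLinearMap.id ℂ (Val n →L[ℂ] Val n)).coeFn_holder (r := 2)
    hmem.toLp f, hmem.coeFn_toLp] with ξ h1 h2
  rw [ContinuousLinearMap.holderL_apply_apply, h1, h2]
  rfl

/-! ### The Fourier transform of `H²` -/

theorem mem_H2_iff (u : L2 n) :
    u ∈ H2 n ↔ MemLp (fun ξ => ((1 + ‖ξ‖ ^ 2 : ℝ) : ℂ) • (𝓕 u : L2 n) ξ) 2 volume := by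
  change MemSobolev 2 2 _ ↔ _
  rw [memSobolev_iff_exists_smulLeftCLM_fourier, Lp.fourier_toTemperedDistribution_eq]
  have hg : (fun ξ : Space n => ((1 + ‖ξ‖ ^ 2 : ℝ) : ℂ)).HasTemperateGrowth := by fun_prop
  -- The Sobolev weight for order 2 has exponent 2 / 2 = 1.
  have he : (fun ξ : Space n => (((1 + ‖ξ‖ ^ 2) ^ ((2 : ℝ) / 2) : ℝ) : ℂ)) =
      fun ξ => ((1 + ‖ξ‖ ^ 2 : ℝ) : ℂ) := by
    ext ξ; simp
  rw [he]
  constructor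
  · rintro ⟨f, hf⟩
    exact (memLp_congr_ae ((smulLeftCLM_eq_iff hg _ _).1 hf)).2 (Lp.memLp f)
  · intro h
    exact ⟨h.toLp, (smulLeftCLM_eq_iff hg _ _).2 h.coeFn_toLp.symm⟩

theorem fourier_laplacian_apply (u : L2 n) (φ : 𝓢(Space n, ℂ)) :
    (Δ ((u : L2 n) : 𝓢'(Space n, Val n))) (𝓕 φ) =
      ∫ ξ, φ ξ • ((-(2 * Real.pi) ^ 2 * ‖ξ‖ ^ 2 : ℝ) : ℂ) • (𝓕 u : L2 n) ξ := by
  rw [laplacian_eq_fourierMultiplierCLM, fourierMultiplierCLM_apply,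
    Lp.fourier_toTemperedDistribution_eq]
  have hg : (fun ξ : Space n => ((‖ξ‖ ^ 2 : ℝ) : ℂ)).HasTemperateGrowth := by fun_prop
  change (-(2 * Real.pi) ^ 2 : ℝ) • ((𝓕⁻ (smulLeftCLM (Val n) _
    ((𝓕 u : L2 n) : 𝓢'(Space n, Val n)))) (𝓕 φ)) = _
  rw [TemperedDistribution.fourierInv_apply, FourierTransform.fourierInv_fourier_eq,
    smulLeftCLM_apply_apply, Lp.toTemperedDistribution_apply, ← integral_smul]
  refine integral_congr_ae (ae_of_all _ fun ξ => ?_)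
  simp only [SchwartzMap.smulLeftCLM_apply_apply hg, ← Complex.coe_smul, smul_smul]
  congr 1
  push_cast
  simp only [smul_eq_mul]
  ring

theorem fourier_lineDeriv_lineDeriv_apply (u : L2 n) (l j : Fin n) (φ : 𝓢(Space n, ℂ)) :
    (∂_{(EuclideanSpace.single l (1 : ℝ) : Space n)}
      (∂_{(EuclideanSpace.single j (1 : ℝ) : Space n)}
        ((u : L2 n) : 𝓢'(Space n, Val n)))) (𝓕 φ) =
      ∫ ξ, φ ξ • ((-(2 * Real.pi) ^ 2 * (ξ l * ξ j) : ℝ) : ℂ) • (𝓕 u : L2 n) ξ := by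
  have hg : ∀ l : Fin n, (fun ξ : Space n =>
      ((inner ℝ ξ (EuclideanSpace.single l (1 : ℝ)) : ℝ) : ℂ)).HasTemperateGrowth := by
    intro l; fun_prop
  rw [lineDeriv_eq_fourierMultiplierCLM, lineDeriv_eq_fourierMultiplierCLM, map_smul,
    fourierMultiplierCLM_fourierMultiplierCLM_apply (hg _) (hg _), smul_smul,
    fourierMultiplierCLM_apply, Lp.fourier_toTemperedDistribution_eq]
  change (_ : ℂ) • ((𝓕⁻ (smulLeftCLM (Val n) _
    ((𝓕 u : L2 n) : 𝓢'(Space n, Val n)))) (𝓕 φ)) = _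
  rw [TemperedDistribution.fourierInv_apply, FourierTransform.fourierInv_fourier_eq,
    smulLeftCLM_apply_apply, Lp.toTemperedDistribution_apply, ← integral_smul]
  refine integral_congr_ae (ae_of_all _ fun ξ => ?_)
  simp only [SchwartzMap.smulLeftCLM_apply_apply ((hg _).mul (hg _)), smul_smul]
  congr 1
  simp only [smul_eq_mul, Pi.mul_apply, EuclideanSpace.inner_single_right]
  simp
  linear_combination (4 * Real.pi ^ 2 * ξ l * ξ j * φ ξ) * Complex.I_sq


/-- The matrix units weighted by ξ_l ξ_j add up to the dyad ξ ξ*; the factors (2π)² come from the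
normalisation of 𝓕. -/
theorem lame_symbol_eq_sum (lam mu : ℝ) (ξ : Space n) (v : Val n) :
    symb ((mu * (2 * Real.pi) ^ 2 * ‖ξ‖ ^ 2 : ℝ) : ℂ)
        (((lam + mu) * (2 * Real.pi) ^ 2 : ℝ) : ℂ) ξ v =
      -((mu : ℂ) • ((-(2 * Real.pi) ^ 2 * ‖ξ‖ ^ 2 : ℝ) : ℂ) • v) -
        ((lam : ℂ) + mu) • ∑ l, ∑ j, matUnit n l j
          (((-(2 * Real.pi) ^ 2 * (ξ l * ξ j) : ℝ) : ℂ) • v) := by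
  ext i
  have : ∀ l j : Fin n, matUnit n l j (((-(2 * Real.pi) ^ 2 * (ξ l * ξ j) : ℝ) : ℂ) • v) i =
      if i = l then ((-(2 * Real.pi) ^ 2 * (ξ l * ξ j) : ℝ) : ℂ) * v j else 0 := by
    intro l j
    split_ifs with h <;> simp [matUnit, h]
  rw [symb_apply]
  simp only [PiLp.add_apply, PiLp.sub_apply, PiLp.neg_apply, PiLp.smul_apply, WithLp.ofLp_sum,
    Finset.sum_apply, this, smul_eq_mul]
  rw [Finset.sum_eq_single i (fun l _ hl => by simp [hl.symm]) (by simp)]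
  simp only [if_true, cvec_apply, PiLp.inner_apply, RCLike.inner_apply, Complex.conj_ofReal]
  simp only [Finset.mul_sum, Finset.sum_mul]
  push_cast
  rw [← sub_eq_zero]
  have h : ∀ a b c d : ℂ, a + b - (c - d) = (a - c) + (b + d) := by intros; ring
  rw [h, ← Finset.sum_add_distrib, Finset.sum_eq_zero]
  · ring
  · intro j _; ring

/-- The Lamé operator is a Fourier multiplier. -/
theorem fourier_lame (lam mu : ℝ) (u : H2 n) :
    (𝓕 (lame n lam mu u) : L2 n) =ᵐ[volume] fun ξ =>
      symb ((mu * (2 * Real.pi) ^ 2 * ‖ξ‖ ^ 2 : ℝ) : ℂ)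
        (((lam + mu) * (2 * Real.pi) ^ 2 : ℝ) : ℂ) ξ ((𝓕 (u : L2 n) : L2 n) ξ) := by
  have hw := (mem_H2_iff _).1 u.2
  -- Any coefficient of at most quadratic growth keeps û in L², because (1 + |ξ|²) û is in L². All
  -- terms of the symbol are of this kind, which justifies splitting the integrals below.
  have hint : ∀ {a : Space n → ℝ} (C : ℝ), Continuous a → (∀ ξ, |a ξ| ≤ C * (1 + ‖ξ‖ ^ 2)) →
      MemLp (fun ξ => (a ξ : ℂ) • (𝓕 (u : L2 n) : L2 n) ξ) 2 volume := by
    intro a C ha hb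
    refine (hw.const_smul (C : ℂ)).mono
      ((Complex.continuous_ofReal.comp ha).aestronglyMeasurable.smul
        (Lp.aestronglyMeasurable _)) (ae_of_all _ fun ξ => ?_)
    simp only [Pi.smul_apply, norm_smul, Complex.norm_real, Real.norm_eq_abs]
    have hC : 0 ≤ C * (1 + ‖ξ‖ ^ 2) := (abs_nonneg _).trans (hb ξ)
    rw [← mul_assoc, ← abs_mul, abs_of_nonneg hC]
    exact mul_le_mul_of_nonneg_right (hb ξ) (norm_nonneg _)
  have h0 : MemLp (fun ξ => ((-(2 * Real.pi) ^ 2 * ‖ξ‖ ^ 2 : ℝ) : ℂ) •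
      (𝓕 (u : L2 n) : L2 n) ξ) 2 volume := by
    refine hint ((2 * Real.pi) ^ 2) (by fun_prop) fun ξ => ?_
    rw [abs_mul, abs_neg, abs_of_nonneg (by positivity), abs_of_nonneg (by positivity)]
    gcongr
    linarith
  have h1 : ∀ l j : Fin n, MemLp (fun ξ => ((-(2 * Real.pi) ^ 2 * (ξ l * ξ j) : ℝ) : ℂ) •
      (𝓕 (u : L2 n) : L2 n) ξ) 2 volume := by
    intro l j
    refine hint ((2 * Real.pi) ^ 2) (by fun_prop) fun ξ => ?_
    have hl := PiLp.norm_apply_le ξ l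
    have hj := PiLp.norm_apply_le ξ j
    rw [Real.norm_eq_abs] at hl hj
    rw [abs_mul, abs_neg, abs_of_nonneg (by positivity : (0 : ℝ) ≤ (2 * Real.pi) ^ 2), abs_mul]
    gcongr
    nlinarith [abs_nonneg (ξ l), abs_nonneg (ξ j), norm_nonneg ξ]
  have h2 : MemLp (fun ξ => symb ((mu * (2 * Real.pi) ^ 2 * ‖ξ‖ ^ 2 : ℝ) : ℂ)
        (((lam + mu) * (2 * Real.pi) ^ 2 : ℝ) : ℂ) ξ ((𝓕 (u : L2 n) : L2 n) ξ)) 2 volume := by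
    simp only [lame_symbol_eq_sum]
    have h3 : MemLp (fun ξ => ∑ l, ∑ j, matUnit n l j
        (((-(2 * Real.pi) ^ 2 * (ξ l * ξ j) : ℝ) : ℂ) • (𝓕 (u : L2 n) : L2 n) ξ)) 2 volume :=
      memLp_finsetSum _ fun l _ =>
        memLp_finsetSum _ fun j _ => (matUnit n l j).comp_memLp' (h1 l j)
    exact ((h0.const_smul (mu : ℂ)).neg).sub (h3.const_smul ((lam : ℂ) + mu))
  refine ae_eq_of_integral_schwartz_smul_eq (locallyIntegrable_L2 _)
    (h2.locallyIntegrable (by norm_num)) fun φ => ?_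
  have i0 : ∀ {f : Space n → Val n}, MemLp f 2 volume → Integrable (fun ξ => φ ξ • f ξ) :=
    fun hf => memLp_one_iff_integrable.1 (hf.smul (φ.memLp 2 volume))
  have e1 := congrArg (fun T : 𝓢'(Space n, Val n) => T φ)
    (Lp.fourier_toTemperedDistribution_eq (lame n lam mu u))
  rw [Lp.toTemperedDistribution_apply] at e1
  rw [← e1, TemperedDistribution.fourier_apply, lame_spec]
  have e2 : lameDistr n lam mu ((u : L2 n) : 𝓢'(Space n, Val n)) (𝓕 φ) =
      -((mu : ℂ) • (Δ ((u : L2 n) : 𝓢'(Space n, Val n))) (𝓕 φ)) -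
        ((lam : ℂ) + mu) • ∑ l, ∑ j, matUnit n l j
          ((∂_{(EuclideanSpace.single l (1 : ℝ) : Space n)}
            (∂_{(EuclideanSpace.single j (1 : ℝ) : Space n)}
              ((u : L2 n) : 𝓢'(Space n, Val n)))) (𝓕 φ)) := by
    simp only [lameDistr, gradDiv, LinearMap.sub_apply, LinearMap.neg_apply, LinearMap.smul_apply,
      LinearMap.sum_apply, LinearMap.comp_apply, ContinuousLinearMap.coe_coe,
      TemperedDistribution.laplacianCLM_apply, LineDeriv.lineDerivOpCLM_apply]
    have hs : ∀ (f : Fin n → 𝓢'(Space n, Val n)) (ψ : 𝓢(Space n, ℂ)),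
        (∑ i, f i) ψ = ∑ i, f i ψ := fun f ψ =>
      map_sum (⟨⟨fun T : 𝓢'(Space n, Val n) => T ψ, rfl⟩, fun _ _ => rfl⟩ :
        𝓢'(Space n, Val n) →+ Val n) f _
    change -((mu : ℂ) • _) - ((lam : ℂ) + mu) • ((∑ _, _ : 𝓢'(Space n, Val n)) (𝓕 φ)) = _
    simp only [hs]
    rfl
  rw [e2]
  simp only [fourier_lineDeriv_lineDeriv_apply, fourier_laplacian_apply, lame_symbol_eq_sum]
  simp only [← ContinuousLinearMap.integral_comp_comm _ (i0 (h1 _ _))]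
  simp only [map_smul (matUnit n _ _) (φ _)]
  have h4 : ∀ l j, Integrable (fun ξ => φ ξ • matUnit n l j
      (((-(2 * Real.pi) ^ 2 * (ξ l * ξ j) : ℝ) : ℂ) • (𝓕 (u : L2 n) : L2 n) ξ)) :=
    fun l j => i0 ((matUnit n l j).comp_memLp' (h1 l j))
  have h5 : ∫ ξ, φ ξ • ∑ l, ∑ j, matUnit n l j
      (((-(2 * Real.pi) ^ 2 * (ξ l * ξ j) : ℝ) : ℂ) • (𝓕 (u : L2 n) : L2 n) ξ) =
      ∑ l, ∑ j, ∫ ξ, φ ξ • matUnit n l j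
        (((-(2 * Real.pi) ^ 2 * (ξ l * ξ j) : ℝ) : ℂ) • (𝓕 (u : L2 n) : L2 n) ξ) := by
    simp only [Finset.smul_sum]
    rw [integral_finsetSum _ fun l _ => integrable_finsetSum _ fun j _ => h4 l j]
    exact Finset.sum_congr rfl fun l _ => integral_finsetSum _ fun j _ => h4 l j
  have h6 : Integrable fun ξ => φ ξ • ∑ l, ∑ j, matUnit n l j
      (((-(2 * Real.pi) ^ 2 * (ξ l * ξ j) : ℝ) : ℂ) • (𝓕 (u : L2 n) : L2 n) ξ) := by
    simp only [Finset.smul_sum]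
    exact integrable_finsetSum _ fun l _ => integrable_finsetSum _ fun j _ => h4 l j
  rw [← h5]
  simp only [smul_sub, smul_neg, smul_comm (φ _) (mu : ℂ), smul_comm (φ _) ((lam : ℂ) + mu)]
  rw [integral_sub, integral_neg, integral_smul, integral_smul]
  · exact ((i0 h0).smul (mu : ℂ)).neg
  · exact h6.smul ((lam : ℂ) + mu)

end

section

variable {n : ℕ}

/-! ### The resolvent of the Lamé operator -/

theorem lame_symmetric (lam mu : ℝ) (u v : H2 n) :
    ⟪lame n lam mu u, (v : L2 n)⟫_ℂ = ⟪(u : L2 n), lame n lam mu v⟫_ℂ := by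
  rw [← Lp.inner_fourier_eq, ← Lp.inner_fourier_eq (u : L2 n), L2.inner_def, L2.inner_def]
  refine integral_congr_ae ?_
  filter_upwards [fourier_lame lam mu u, fourier_lame lam mu v] with ξ h1 h2
  rw [h1, h2, inner_symb_left, Complex.conj_ofReal, Complex.conj_ofReal]

/-- The scalar part of the symbol of the resolvent. -/
def resScal (mu : ℝ) (z : ℂ) (ξ : Space n) : ℂ :=
  (((mu * (2 * Real.pi) ^ 2 * ‖ξ‖ ^ 2 : ℝ) : ℂ) - z)⁻¹

/-- The symbol of the resolvent of the Lamé operator. -/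
def resSymb (lam mu : ℝ) (z : ℂ) (ξ : Space n) : Val n →L[ℂ] Val n :=
  symb (resScal mu z ξ)
    (-(((lam + mu) * (2 * Real.pi) ^ 2 : ℝ) : ℂ) * resScal mu z ξ * resScal (lam + 2 * mu) z ξ) ξ

/-- Two regimes are combined: a positive distance m from z to the half line, which settles bounded
q, and linear growth in q, which settles large q. -/
theorem exists_le_norm_sub {z : ℂ} (hz : z.im ≠ 0 ∨ z.re < 0) {a : ℝ} (ha : 0 < a) :
    ∃ c > 0, ∀ q : ℝ, 0 ≤ q → c * (1 + q) ≤ ‖((a * q : ℝ) : ℂ) - z‖ := by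
  obtain ⟨m, hm, hmz⟩ : ∃ m > 0, ∀ q : ℝ, 0 ≤ q → m ≤ ‖((a * q : ℝ) : ℂ) - z‖ := by
    rcases hz with hz | hz
    · refine ⟨|z.im|, abs_pos.2 hz, fun q _ => ?_⟩
      simpa using Complex.abs_im_le_norm (((a * q : ℝ) : ℂ) - z)
    · refine ⟨-z.re, by linarith, fun q hq => ?_⟩
      have := Complex.re_le_norm (((a * q : ℝ) : ℂ) - z)
      rw [Complex.sub_re, Complex.ofReal_re] at this
      nlinarith [mul_nonneg ha.le hq]
  have hR := abs_nonneg z.re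
  -- With D the norm on the right, D ≥ aq - |Re z| and D ≥ m give a(1 + q) ≤ D + (|Re z| + a) ≤ D (1
  -- + (|Re z| + a) / m).
  refine ⟨a / (1 + (|z.re| + a) / m), by positivity, fun q hq => ?_⟩
  have h1 := hmz q hq
  have h2 : a * q - |z.re| ≤ ‖((a * q : ℝ) : ℂ) - z‖ := by
    have := Complex.re_le_norm (((a * q : ℝ) : ℂ) - z)
    rw [Complex.sub_re, Complex.ofReal_re] at this
    linarith [le_abs_self z.re]
  rw [div_mul_eq_mul_div, div_le_iff₀ (by positivity)]
  have h3 : |z.re| + a ≤ ‖((a * q : ℝ) : ℂ) - z‖ * ((|z.re| + a) / m) := by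
    rw [mul_div_assoc', le_div_iff₀ hm]
    nlinarith
  linarith

theorem exists_norm_resScal_le {z : ℂ} (hz : z.im ≠ 0 ∨ z.re < 0) {a : ℝ} (ha : 0 < a) :
    ∃ C ≥ 0, ∀ ξ : Space n, (((a * (2 * Real.pi) ^ 2 * ‖ξ‖ ^ 2 : ℝ) : ℂ) - z) ≠ 0 ∧
      (1 + ‖ξ‖ ^ 2) * ‖resScal a z ξ‖ ≤ C := by
  obtain ⟨c, hc, h⟩ := exists_le_norm_sub hz (a := a * (2 * Real.pi) ^ 2) (by positivity)
  refine ⟨1 / c, by positivity, fun ξ => ?_⟩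
  have h1 := h (‖ξ‖ ^ 2) (by positivity)
  have h2 : 0 < c * (1 + ‖ξ‖ ^ 2) := by positivity
  refine ⟨norm_pos_iff.1 (h2.trans_le h1), ?_⟩
  rw [resScal, norm_inv, le_div_iff₀ hc, mul_right_comm, ← div_eq_mul_inv,
    div_le_one (h2.trans_le h1)]
  linarith

/-- The dyad contributes |ξ|², but it comes with two scalar resolvents: one absorbs |ξ|², the other
provides the decay. -/
theorem exists_norm_resSymb_le {lam mu : ℝ} (hmu : 0 < mu) (hlm : 0 < lam + mu) {z : ℂ}
    (hz : z.im ≠ 0 ∨ z.re < 0) :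
    ∃ C, ∀ ξ : Space n, (1 + ‖ξ‖ ^ 2) * ‖resSymb lam mu z ξ‖ ≤ C := by
  obtain ⟨C, hC, h⟩ := exists_norm_resScal_le (n := n) hz hmu
  obtain ⟨D, hD, h'⟩ := exists_norm_resScal_le (n := n) hz (a := lam + 2 * mu) (by linarith)
  refine ⟨C + ((lam + mu) * (2 * Real.pi) ^ 2) * C * D, fun ξ => ?_⟩
  have h1 := (h ξ).2
  have h2 := (h' ξ).2
  have h0 : 0 ≤ (lam + mu) * (2 * Real.pi) ^ 2 := by positivity
  have h3 := norm_symb_le (resScal mu z ξ)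
    (-(((lam + mu) * (2 * Real.pi) ^ 2 : ℝ) : ℂ) * resScal mu z ξ * resScal (lam + 2 * mu) z ξ) ξ
  rw [norm_mul, norm_mul, norm_neg, Complex.norm_real, Real.norm_of_nonneg h0] at h3
  calc (1 + ‖ξ‖ ^ 2) * ‖resSymb lam mu z ξ‖
      ≤ (1 + ‖ξ‖ ^ 2) * _ := mul_le_mul_of_nonneg_left h3 (by positivity)
    _ = (1 + ‖ξ‖ ^ 2) * ‖resScal mu z ξ‖ + ((lam + mu) * (2 * Real.pi) ^ 2) *
        ((1 + ‖ξ‖ ^ 2) * ‖resScal mu z ξ‖) * (‖ξ‖ ^ 2 * ‖resScal (lam + 2 * mu) z ξ‖) := by ring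
    _ ≤ C + ((lam + mu) * (2 * Real.pi) ^ 2) * C * D := by
        gcongr
        refine le_trans ?_ h2
        gcongr
        linarith

/-- The Sherman-Morrison inverse of A + B ξ ξ*. Along ξ its eigenvalue is A + B|ξ|², and this is the
Helmholtz symbol with coefficient λ + 2μ because μ + (λ + μ) = λ + 2μ. -/
theorem resScal_add {lam mu : ℝ} {z : ℂ} {ξ : Space n}
    (h1 : ((mu * (2 * Real.pi) ^ 2 * ‖ξ‖ ^ 2 : ℝ) : ℂ) - z ≠ 0)
    (h2 : (((lam + 2 * mu) * (2 * Real.pi) ^ 2 * ‖ξ‖ ^ 2 : ℝ) : ℂ) - z ≠ 0) (v : Val n) :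
    symb (((mu * (2 * Real.pi) ^ 2 * ‖ξ‖ ^ 2 : ℝ) : ℂ) - z)
      (((lam + mu) * (2 * Real.pi) ^ 2 : ℝ) : ℂ) ξ (resSymb lam mu z ξ v) = v ∧
    resSymb lam mu z ξ (symb (((mu * (2 * Real.pi) ^ 2 * ‖ξ‖ ^ 2 : ℝ) : ℂ) - z)
      (((lam + mu) * (2 * Real.pi) ^ 2 : ℝ) : ℂ) ξ v) = v := by
  have key : ∀ A B D q : ℂ, A ≠ 0 → D ≠ 0 → D = A + B * q →
      A * A⁻¹ = 1 ∧ A⁻¹ * A = 1 ∧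
      A * (-B * A⁻¹ * D⁻¹) + B * A⁻¹ + B * (-B * A⁻¹ * D⁻¹) * q = 0 ∧
      A⁻¹ * B + (-B * A⁻¹ * D⁻¹) * A + (-B * A⁻¹ * D⁻¹) * B * q = 0 := by
    intro A B D q hA hD h
    refine ⟨mul_inv_cancel₀ hA, inv_mul_cancel₀ hA, ?_, ?_⟩
    · field_simp; rw [h]; ring
    · field_simp; rw [h]; ring
  obtain ⟨k1, k2, k3, k4⟩ := key _ (((lam + mu) * (2 * Real.pi) ^ 2 : ℝ) : ℂ) _
    ((‖ξ‖ ^ 2 : ℝ) : ℂ) h1 h2 (by push_cast; ring)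
  unfold resSymb resScal
  rw [symb_symb, symb_symb, k1, k2, k3, k4, symb_apply]
  simp

theorem continuous_resScal {a : ℝ} {z : ℂ}
    (h : ∀ ξ : Space n, (((a * (2 * Real.pi) ^ 2 * ‖ξ‖ ^ 2 : ℝ) : ℂ) - z) ≠ 0) :
    Continuous (resScal a z : Space n → ℂ) := by
  unfold resScal
  exact Continuous.inv₀ (by fun_prop) h

theorem continuous_resSymb {lam mu : ℝ} (hmu : 0 < mu) (hlm : 0 < lam + mu) {z : ℂ}
    (hz : z.im ≠ 0 ∨ z.re < 0) : Continuous (resSymb lam mu z : Space n → _) := by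
  obtain ⟨C, hC, h⟩ := exists_norm_resScal_le (n := n) hz hmu
  obtain ⟨D, hD, h'⟩ := exists_norm_resScal_le (n := n) hz (a := lam + 2 * mu) (by linarith)
  have h1 := continuous_resScal fun ξ => (h ξ).1
  have h2 := continuous_resScal fun ξ => (h' ξ).1
  exact continuous_symb h1 ((continuous_const.mul h1).mul h2)

theorem symb_sub_smul (a b z : ℂ) (ξ : Space n) (v : Val n) :
    symb (a - z) b ξ v = symb a b ξ v - z • v := by
  simp only [symb_apply]; module

/-- The resolvent is the Fourier conjugate of multiplication by the inverse symbol. The quadratic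
decay of that symbol is what puts the range inside H². -/
theorem exists_isResolventAt_lame {lam mu : ℝ} (hmu : 0 < mu) (hlm : 0 < lam + mu) {z : ℂ}
    (hz : z.im ≠ 0 ∨ z.re < 0) :
    ∃ R : L2 n →L[ℂ] L2 n, IsResolventAt (lame n lam mu) z R ∧
      ∀ f, (𝓕 (R f) : L2 n) =ᵐ[volume] fun ξ => resSymb lam mu z ξ ((𝓕 f : L2 n) ξ) := by
  obtain ⟨C, hC⟩ := exists_norm_resSymb_le (n := n) hmu hlm hz
  obtain ⟨_, -, h1⟩ := exists_norm_resScal_le (n := n) hz hmu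
  obtain ⟨_, -, h2⟩ := exists_norm_resScal_le (n := n) hz (a := lam + 2 * mu) (by linarith)
  obtain ⟨R, hR⟩ := exists_multiplication (continuous_resSymb (n := n) hmu hlm hz) (C := C)
    fun ξ => le_trans (le_mul_of_one_le_left (norm_nonneg _) (by nlinarith [norm_nonneg ξ])) (hC ξ)
  let F := (Lp.fourierTransformₗᵢ (Space n) (Val n))
  let K : L2 n →L[ℂ] L2 n := (F.symm : L2 n →L[ℂ] L2 n) ∘L R ∘L (F : L2 n →L[ℂ] L2 n)
  have hK : ∀ f, (𝓕 (K f) : L2 n) = R (𝓕 f) := fun f => F.apply_symm_apply _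
  have hK' : ∀ f, (𝓕 (K f) : L2 n) =ᵐ[volume]
      fun ξ => resSymb lam mu z ξ ((𝓕 f : L2 n) ξ) := fun f => by rw [hK]; exact hR _
  have hmem : ∀ f, K f ∈ H2 n := by
    intro f
    rw [mem_H2_iff]
    refine ((Lp.memLp (𝓕 f : L2 n)).const_smul (C : ℂ)).mono
      ((by fun_prop : Continuous fun ξ : Space n =>
        ((1 + ‖ξ‖ ^ 2 : ℝ) : ℂ)).aestronglyMeasurable.smul (Lp.aestronglyMeasurable _)) ?_
    filter_upwards [hK' f] with ξ hξ
    have hC0 : 0 ≤ C := le_trans (by positivity) (hC ξ)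
    rw [Pi.smul_apply, norm_smul, norm_smul, hξ, Complex.norm_real, Complex.norm_real,
      Real.norm_of_nonneg hC0, Real.norm_of_nonneg (by positivity)]
    calc (1 + ‖ξ‖ ^ 2) * ‖resSymb lam mu z ξ ((𝓕 f : L2 n) ξ)‖
        ≤ (1 + ‖ξ‖ ^ 2) * (‖resSymb lam mu z ξ‖ * ‖(𝓕 f : L2 n) ξ‖) := by
          gcongr; exact ContinuousLinearMap.le_opNorm _ _
      _ ≤ C * ‖(𝓕 f : L2 n) ξ‖ := by
          rw [← mul_assoc]; gcongr; exact hC ξ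
  have hsub : ∀ u : H2 n, (𝓕 (lame n lam mu u - z • (u : L2 n)) : L2 n) =ᵐ[volume] fun ξ =>
      symb (((mu * (2 * Real.pi) ^ 2 * ‖ξ‖ ^ 2 : ℝ) : ℂ) - z)
        (((lam + mu) * (2 * Real.pi) ^ 2 : ℝ) : ℂ) ξ ((𝓕 (u : L2 n) : L2 n) ξ) := by
    intro u
    have : (𝓕 (lame n lam mu u - z • (u : L2 n)) : L2 n) =
        𝓕 (lame n lam mu u) - z • 𝓕 (u : L2 n) := by
      change F _ = F _ - z • F _
      rw [map_sub, map_smul]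
    rw [this]
    filter_upwards [fourier_lame lam mu u, Lp.coeFn_sub (𝓕 (lame n lam mu u) : L2 n)
      (z • 𝓕 (u : L2 n)), Lp.coeFn_smul z (𝓕 (u : L2 n) : L2 n)] with ξ e1 e2 e3
    rw [e2, Pi.sub_apply, e3, Pi.smul_apply, e1, symb_sub_smul]
  refine ⟨K, ⟨fun f => ⟨hmem f, ?_⟩, fun u => ?_⟩, hK'⟩
  · apply F.injective
    refine Lp.ext ((hsub ⟨K f, hmem f⟩).trans ?_)
    filter_upwards [hK' f] with ξ hξ
    rw [hξ, (resScal_add (h1 ξ).1 (h2 ξ).1 _).1]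
    rfl
  · apply F.injective
    refine Lp.ext ((hK' _).trans ?_)
    filter_upwards [hsub u] with ξ hξ
    rw [hξ, (resScal_add (h1 ξ).1 (h2 ξ).1 _).2]
    rfl

/-- This identifies the chosen `lameRes` with the explicit Fourier multiplier. -/
theorem IsResolventAt.unique {T : L2 n →ₗ.[ℂ] L2 n} {z : ℂ} {R R' : L2 n →L[ℂ] L2 n}
    (h : IsResolventAt T z R) (h' : IsResolventAt T z R') : R = R' := by
  ext1 f
  obtain ⟨hf, e⟩ := h.1 f
  have := h'.2 ⟨R f, hf⟩
  rw [e] at this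
  exact this.symm

theorem isResolventAt_lameRes {lam mu : ℝ} (hmu : 0 < mu) (hlm : 0 < lam + mu) {z : ℂ}
    (hz : z.im ≠ 0 ∨ z.re < 0) : IsResolventAt (lame n lam mu) z (lameRes n lam mu z) :=
  Classical.epsilon_spec
    (let ⟨R, hR, _⟩ := exists_isResolventAt_lame (n := n) hmu hlm hz; ⟨R, hR⟩)

theorem fourier_lameRes {lam mu : ℝ} (hmu : 0 < mu) (hlm : 0 < lam + mu) {z : ℂ}
    (hz : z.im ≠ 0 ∨ z.re < 0) (f : L2 n) :
    (𝓕 (lameRes n lam mu z f) : L2 n) =ᵐ[volume]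
      fun ξ => resSymb lam mu z ξ ((𝓕 f : L2 n) ξ) := by
  obtain ⟨R, hR, h⟩ := exists_isResolventAt_lame (n := n) hmu hlm hz
  rw [(isResolventAt_lameRes hmu hlm hz).unique hR]
  exact h f

end

section

variable {n : ℕ}

/-! ### Continuous representatives -/

theorem integral_schwartz_smul_fourierInv (φ : 𝓢(Space n, ℂ)) {g : Space n → Val n}
    (hg : Integrable g) : ∫ x, φ x • (𝓕⁻ g) x = ∫ ξ, (𝓕⁻ φ) ξ • g ξ := by
  have h := VectorFourier.integral_fourierIntegral_smul_eq_flip (μ := volume) (ν := volume)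
    (L := -innerₗ (Space n)) Real.continuous_fourierChar
    (by simpa using (continuous_inner (𝕜 := ℝ) (E := Space n)).fun_neg) (φ.integrable (μ := volume)) hg
  have hfl : (-innerₗ (Space n)).flip = -innerₗ (Space n) := by
    ext x y; simp [real_inner_comm]
  rw [hfl] at h
  rw [SchwartzMap.fourierInv_coe]
  exact h.symm

theorem integral_schwartz_smul_fourier (φ : 𝓢(Space n, ℂ)) {g : Space n → Val n}
    (hg : Integrable g) : ∫ x, φ x • (𝓕 g) x = ∫ ξ, (𝓕 φ) ξ • g ξ := by
  have h := VectorFourier.integral_fourierIntegral_smul_eq_flip (μ := volume) (ν := volume)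
    (L := innerₗ (Space n)) Real.continuous_fourierChar
    (by simpa using! (continuous_inner (𝕜 := ℝ) (E := Space n))) (φ.integrable (μ := volume)) hg
  have hfl : (innerₗ (Space n)).flip = innerₗ (Space n) := by
    ext x y; simp
  rw [hfl] at h
  rw [SchwartzMap.fourier_coe]
  exact h.symm

theorem continuous_fourierInv {g : Space n → Val n} (hg : Integrable g) : Continuous (𝓕⁻ g) :=
  VectorFourier.fourierIntegral_continuous Real.continuous_fourierChar
    (by simpa using (continuous_inner (𝕜 := ℝ) (E := Space n)).fun_neg) hg

theorem ae_eq_fourierInv {u : L2 n} (hu : Integrable (𝓕 u : L2 n)) :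
    u =ᵐ[volume] 𝓕⁻ ((𝓕 u : L2 n) : Space n → Val n) := by
  refine ae_eq_of_integral_schwartz_smul_eq (locallyIntegrable_L2 _)
    (continuous_fourierInv hu).locallyIntegrable fun φ => ?_
  rw [integral_schwartz_smul_fourierInv φ hu, ← fourier_apply_eq, Lp.toTemperedDistribution_apply]

theorem ae_eq_of_fourier_ae_eq {u : L2 n} {g : Space n → Val n} (hg : Integrable g)
    (h : (𝓕 u : L2 n) =ᵐ[volume] 𝓕 g) : u =ᵐ[volume] g := by
  refine ae_eq_of_integral_schwartz_smul_eq (locallyIntegrable_L2 _) hg.locallyIntegrable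
    fun φ => ?_
  have h1 := integral_schwartz_smul_fourier (𝓕⁻ φ) hg
  rw [FourierTransform.fourier_fourierInv_eq] at h1
  rw [← h1, ← Lp.toTemperedDistribution_apply, fourier_apply_eq]
  refine integral_congr_ae ?_
  filter_upwards [h] with x hx
  rw [hx]

/-- The dimension restriction enters here: (1 + |ξ|²)⁻² is integrable only for n < 4. By
Cauchy-Schwarz, functions in H² then have integrable Fourier transforms, hence continuous
representatives. -/
theorem memLp_weight_inv (hn : n < 4) :
    MemLp (fun ξ : Space n => ((1 + ‖ξ‖ ^ 2 : ℝ)⁻¹ : ℝ)) 2 volume := by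
  have hc : Continuous fun ξ : Space n => ((1 + ‖ξ‖ ^ 2 : ℝ)⁻¹ : ℝ) :=
    Continuous.inv₀ (by fun_prop) fun ξ => by positivity
  rw [memLp_two_iff_integrable_sq hc.aestronglyMeasurable]
  have h := integrable_rpow_neg_one_add_norm_sq (E := Space n) (μ := volume) (r := 4)
    (by simpa using by exact_mod_cast hn)
  refine h.congr (ae_of_all _ fun ξ => ?_)
  have : (-4 / 2 : ℝ) = -(2 : ℕ) := by norm_num
  simp only [this]
  rw [Real.rpow_neg (by positivity), Real.rpow_natCast, inv_pow]

theorem integrable_fourier_of_mem_H2 (hn : n < 4) {u : L2 n} (hu : u ∈ H2 n) :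
    Integrable (𝓕 u : L2 n) := by
  have h1 := (memLp_weight_inv hn).ofReal (K := ℂ)
  have h2 := (mem_H2_iff u).1 hu
  refine (memLp_one_iff_integrable.1 (h2.smul h1)).congr (ae_of_all _ fun ξ => ?_)
  have : ((1 + ‖ξ‖ ^ 2 : ℝ) : ℂ) ≠ 0 := by
    norm_cast; positivity
  simp only [Pi.smul_apply', smul_smul, RCLike.ofReal_eq_complex_ofReal, Complex.ofReal_inv]
  rw [inv_mul_cancel₀ this, one_smul]

theorem exists_continuous_rep (hn : n < 4) {u : L2 n} (hu : u ∈ H2 n) :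
    ∃ v : Space n → Val n, Continuous v ∧ u =ᵐ[volume] v :=
  ⟨_, continuous_fourierInv (integrable_fourier_of_mem_H2 hn hu),
    ae_eq_fourierInv (integrable_fourier_of_mem_H2 hn hu)⟩

/-! ### Limits up to null sets, and linearity of the trace on H². -/

instance essNhds_neBot (x : Space n) : (essNhds x).NeBot := by
  refine inf_neBot_iff.2 fun s hs t ht => ?_
  have h1 : 0 < volume (s ∩ t) := by
    rw [measure_inter_conull (mem_ae_iff.1 ht)]
    exact MeasureTheory.Measure.measure_pos_of_mem_nhds _ hs
  exact nonempty_of_measure_ne_zero h1.ne'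

theorem tendsto_essNhds {E : Type*} [TopologicalSpace E] {u v : Space n → E} {y : Space n}
    (h : u =ᵐ[volume] v) (hv : ContinuousAt v y) : Tendsto u (essNhds y) (𝓝 (v y)) :=
  (hv.mono_left inf_le_left).congr' (h.symm.filter_mono inf_le_right)

variable {N : ℕ} (Y : Fin N → Space n)

theorem gammaTrace_eq {u : L2 n} {v : Space n → Val n} (hv : Continuous v)
    (h : u =ᵐ[volume] v) (p : Fin n × Fin N) : gammaTrace Y u p = v (Y p.2) p.1 := by
  have h1 : Tendsto (fun x => u x p.1) (essNhds (Y p.2)) (𝓝 (v (Y p.2) p.1)) :=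
    ((EuclideanSpace.proj (𝕜 := ℂ) p.1).continuous.tendsto _).comp
      (tendsto_essNhds h hv.continuousAt)
  exact h1.limUnder_eq

theorem gammaTrace_add (hn : n < 4) {u v : L2 n} (hu : u ∈ H2 n) (hv : v ∈ H2 n) :
    gammaTrace Y (u + v) = gammaTrace Y u + gammaTrace Y v := by
  obtain ⟨f, hf, hf'⟩ := exists_continuous_rep hn hu
  obtain ⟨g, hg, hg'⟩ := exists_continuous_rep hn hv
  ext p
  rw [gammaTrace_eq Y (hf.add hg) ((Lp.coeFn_add u v).trans (hf'.add hg')), PiLp.add_apply,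
    gammaTrace_eq Y hf hf', gammaTrace_eq Y hg hg']
  rfl

theorem gammaTrace_smul (hn : n < 4) (c : ℂ) {u : L2 n} (hu : u ∈ H2 n) :
    gammaTrace Y (c • u) = c • gammaTrace Y u := by
  obtain ⟨f, hf, hf'⟩ := exists_continuous_rep hn hu
  ext p
  rw [gammaTrace_eq Y (hf.const_smul c) ((Lp.coeFn_smul c u).trans (hf'.const_smul c)),
    PiLp.smul_apply, gammaTrace_eq Y hf hf']
  rfl

theorem mem_kerTrace_iff (hn : n < 4) {u : L2 n} (hu : u ∈ H2 n) :
    u ∈ kerTrace Y ↔ gammaTrace Y u = 0 := by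
  obtain ⟨f, hf, hf'⟩ := exists_continuous_rep hn hu
  constructor
  · intro h
    ext p
    have h1 := tendsto_nhds_unique (h p.2) (tendsto_essNhds hf' hf.continuousAt)
    rw [gammaTrace_eq Y hf hf', ← h1]
    rfl
  · intro h k
    have h1 : f (Y k) = 0 := by
      ext j
      have := congrArg (fun X : Mat n N => X (j, k)) h
      simpa [gammaTrace_eq Y hf hf'] using this
    rw [← h1]
    exact tendsto_essNhds hf' hf.continuousAt

/-! ### The trace of the resolvent -/

/-- The Fourier transform of a column of the Green tensor with singularity at `y`. -/
def greenHat (lam mu : ℝ) (y : Space n) (j : Fin n) (z : ℂ) (ξ : Space n) : Val n :=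
  Real.fourierChar (-⟪ξ, y⟫_ℝ) • resSymb lam mu z ξ (EuclideanSpace.single j 1)

theorem memLp_greenHat (hn : n < 4) {lam mu : ℝ} (hmu : 0 < mu) (hlm : 0 < lam + mu) {z : ℂ}
    (hz : z.im ≠ 0 ∨ z.re < 0) (y : Space n) (j : Fin n) :
    MemLp (greenHat lam mu y j z) 2 volume := by
  obtain ⟨C, hC⟩ := exists_norm_resSymb_le (n := n) hmu hlm hz
  have hc : Continuous (greenHat lam mu y j z) :=
    (Real.continuous_fourierChar.comp (by fun_prop)).smul
      ((continuous_resSymb hmu hlm hz).clm_apply continuous_const)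
  refine ((memLp_weight_inv hn).const_mul C).mono hc.aestronglyMeasurable
    (ae_of_all _ fun ξ => ?_)
  have h1 := ContinuousLinearMap.le_opNorm (resSymb lam mu z ξ) (EuclideanSpace.single j 1)
  have h2 : (0 : ℝ) < 1 + ‖ξ‖ ^ 2 := by positivity
  have h3 : ‖resSymb lam mu z ξ‖ ≤ C * (1 + ‖ξ‖ ^ 2)⁻¹ := by
    rw [← div_eq_mul_inv, le_div_iff₀ h2, mul_comm]; exact hC ξ
  rw [greenHat, Circle.norm_smul]
  refine h1.trans (le_trans ?_ (le_abs_self _))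
  simpa using h3

theorem inner_resSymb_left (lam mu : ℝ) (z : ℂ) (ξ : Space n) (v w : Val n) :
    ⟪resSymb lam mu (conj z) ξ v, w⟫_ℂ = ⟪v, resSymb lam mu z ξ w⟫_ℂ := by
  have h : ∀ a : ℝ, conj (resScal a (conj z) ξ) = resScal a z ξ := by
    intro a
    rw [resScal, resScal, map_inv₀, map_sub, Complex.conj_ofReal, Complex.conj_conj]
  rw [resSymb, inner_symb_left, map_mul, map_mul, map_neg, Complex.conj_ofReal, h, h]
  rfl

/-- By Fourier inversion the value at y is the integral of û against a character. For u = K_z f the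
symbol moves to the other side of the inner product, where its adjoint is the symbol at conj z, and
the resulting column is in L² because n < 4. -/
theorem exists_green (hn : n < 4) {lam mu : ℝ} (hmu : 0 < mu) (hlm : 0 < lam + mu) {z : ℂ}
    (hz : z.im ≠ 0 ∨ z.re < 0) (p : Fin n × Fin N) :
    ∃ g : L2 n, (𝓕 g : L2 n) =ᵐ[volume] greenHat lam mu (Y p.2) p.1 (conj z) ∧
      ∀ f, gammaTrace Y (lameRes n lam mu z f) p = ⟪g, f⟫_ℂ := by
  have hz' : (conj z).im ≠ 0 ∨ (conj z).re < 0 := by simpa using hz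
  have hm := memLp_greenHat hn hmu hlm hz' (Y p.2) p.1
  refine ⟨𝓕⁻ hm.toLp, ?_, fun f => ?_⟩
  · rw [FourierTransform.fourier_fourierInv_eq]
    exact hm.coeFn_toLp
  · have hu : lameRes n lam mu z f ∈ H2 n := ((isResolventAt_lameRes hmu hlm hz).1 f).choose
    have hi := integrable_fourier_of_mem_H2 hn hu
    rw [gammaTrace_eq Y (continuous_fourierInv hi) (ae_eq_fourierInv hi), Real.fourierInv_eq]
    rw [← Lp.inner_fourier_eq, FourierTransform.fourier_fourierInv_eq, L2.inner_def]
    have hi' : Integrable fun ξ => Real.fourierChar ⟪ξ, Y p.2⟫_ℝ •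
        (𝓕 (lameRes n lam mu z f) : L2 n) ξ := by
      rw [← integrable_norm_iff]
      · simpa using hi.norm
      · exact (Real.continuous_fourierChar.comp (by fun_prop)).aestronglyMeasurable.smul
          hi.aestronglyMeasurable
    have h1 := (EuclideanSpace.proj (𝕜 := ℂ) p.1 : Val n →L[ℂ] ℂ).integral_comp_comm hi'
    refine h1.symm.trans (integral_congr_ae ?_)
    filter_upwards [hm.coeFn_toLp, fourier_lameRes hmu hlm hz f] with ξ e1 e2
    have h2 : ⟪(Real.fourierChar (-⟪ξ, Y p.2⟫_ℝ) : ℂ) • resSymb lam mu (conj z) ξ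
        (EuclideanSpace.single p.1 1), (𝓕 f : L2 n) ξ⟫_ℂ =
        (Real.fourierChar ⟪ξ, Y p.2⟫_ℝ : ℂ) • (resSymb lam mu z ξ ((𝓕 f : L2 n) ξ)) p.1 := by
      rw [inner_smul_left, inner_resSymb_left, EuclideanSpace.inner_single_left]
      simp [AddChar.map_neg_eq_inv]
    rw [e1, e2, greenHat]
    exact h2.symm

/-- The trace of the resolvent is bounded. -/
theorem traceRes_apply (hn : n < 4) {lam mu : ℝ} (hmu : 0 < mu) (hlm : 0 < lam + mu) {z : ℂ}
    (hz : z.im ≠ 0 ∨ z.re < 0) (f : L2 n) :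
    traceRes lam mu Y z f = gammaTrace Y (lameRes n lam mu z f) := by
  have h : ∃ B : L2 n →L[ℂ] Mat n N, ∀ f, B f = gammaTrace Y (lameRes n lam mu z f) := by
    choose g hg hg' using exists_green Y hn hmu hlm hz
    refine ⟨((PiLp.continuousLinearEquiv 2 ℂ (fun _ : Fin n × Fin N => ℂ)).symm :
      _ →L[ℂ] Mat n N) ∘L ContinuousLinearMap.pi fun p => innerSL ℂ (g p), fun f => ?_⟩
    ext p
    rw [hg']
    rfl
  exact Classical.epsilon_spec h f

theorem fourier_gField_single (hn : n < 4) {lam mu : ℝ} (hmu : 0 < mu) (hlm : 0 < lam + mu)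
    {z : ℂ} (hz : z.im ≠ 0 ∨ z.re < 0) (p : Fin n × Fin N) :
    (𝓕 (gField lam mu Y z (EuclideanSpace.single p 1)) : L2 n) =ᵐ[volume]
      greenHat lam mu (Y p.2) p.1 z := by
  have hz' : (conj z).im ≠ 0 ∨ (conj z).re < 0 := by simpa using hz
  obtain ⟨g, hg, hg'⟩ := exists_green Y hn hmu hlm hz' p
  rw [Complex.conj_conj] at hg
  have : gField lam mu Y z (EuclideanSpace.single p 1) = g := by
    refine ext_inner_right ℂ fun f => ?_
    rw [gField, ContinuousLinearMap.adjoint_inner_left, traceRes_apply Y hn hmu hlm hz', ← hg',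
      EuclideanSpace.inner_single_left]
    simp
  rwa [this]

end

section

variable {n N : ℕ}

/-! ### Smooth functions concentrated at one point -/

theorem schwartz_mem_H2 (f : 𝓢(Space n, Val n)) : f.toLp 2 volume ∈ H2 n := by
  change MemSobolev 2 2 _
  rw [Lp.toTemperedDistribution_toLp_eq]
  exact f.memSobolev

theorem nontrivial_space (h : 0 < n) : Nontrivial (Space n) :=
  ⟨⟨EuclideanSpace.single ⟨0, h⟩ 1, 0, fun h' => by simpa using congrArg norm h'⟩⟩

theorem exists_mem_H2_gammaTrace_eq_single (Y : Fin N → Space n) (hY : Function.Injective Y)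
    (p : Fin n × Fin N) {ε : ℝ} (hε : 0 < ε) :
    ∃ u ∈ H2 n, gammaTrace Y u = EuclideanSpace.single p 1 ∧ ‖u‖ < ε := by
  obtain ⟨j, k⟩ := p
  have := nontrivial_space (Fin.pos j)
  -- A bump with values in [0, 1] supported in U has L² norm at most the square root of the measure
  -- of U; hence the threshold ε².
  obtain ⟨U, hU, hUo, hUv⟩ := Set.exists_isOpen_lt_of_lt ({Y k} : Set (Space n))
    (ENNReal.ofReal (ε ^ 2)) (μ := volume) (by simpa using by positivity)
  -- Removing the other points from U makes the trace of the bump vanish there. Injectivity of `Y`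
  -- keeps `Y k` itself in V.
  let V : Set (Space n) := U ∩ ⋂ k' ∈ ({k}ᶜ : Set (Fin N)), {Y k'}ᶜ
  have hVo : IsOpen V := hUo.inter
    (Set.Finite.isOpen_biInter (Set.toFinite _) fun _ _ => isOpen_compl_singleton)
  have hVk : Y k ∈ V := by
    refine ⟨hU rfl, ?_⟩
    simp only [Set.mem_iInter]
    exact fun k' hk' h => hk' (hY h).symm
  obtain ⟨r, hr, hrV⟩ := Metric.isOpen_iff.1 hVo _ hVk
  let φ : ContDiffBump (Y k) := ⟨r / 2, r, by positivity, by linarith⟩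
  have hc : HasCompactSupport fun x => (φ x : ℂ) • (EuclideanSpace.single j 1 : Val n) :=
    (φ.hasCompactSupport.comp_left Complex.ofReal_zero).smul_right
  have hd : ContDiff ℝ (⊤ : ℕ∞) fun x => (φ x : ℂ) • (EuclideanSpace.single j 1 : Val n) :=
    (Complex.ofRealCLM.contDiff.comp φ.contDiff).smul contDiff_const
  let f : 𝓢(Space n, Val n) := hc.toSchwartzMap hd
  have hf : ∀ x, f x = (φ x : ℂ) • (EuclideanSpace.single j 1 : Val n) := fun x => rfl
  refine ⟨f.toLp 2 volume, schwartz_mem_H2 f, ?_, ?_⟩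
  · ext ⟨i, k'⟩
    rw [gammaTrace_eq Y f.continuous (f.coeFn_toLp 2 volume), hf]
    by_cases hk : k' = k
    · subst hk
      rw [φ.one_of_mem_closedBall (by simp [φ.rIn_pos.le])]
      by_cases hi : i = j <;> simp [hi]
    · have h0 : φ (Y k') = 0 := by
        rw [← Function.notMem_support, φ.support_eq]
        intro h
        have := (hrV h).2
        simp only [Set.mem_iInter] at this
        exact this k' hk rfl
      simp [h0, hk]
  · rw [Lp.norm_def]
    have h1 : eLpNorm (f.toLp 2 volume) 2 volume ≤
        eLpNorm (U.indicator fun _ => (1 : ℝ)) 2 volume := by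
      rw [eLpNorm_congr_ae (f.coeFn_toLp 2 volume)]
      refine eLpNorm_mono fun x => ?_
      rw [hf, norm_smul]
      by_cases hx : x ∈ U
      · rw [Set.indicator_of_mem hx]
        simpa [abs_of_nonneg φ.nonneg] using φ.le_one
      · have h0 : φ x = 0 := by
          rw [← Function.notMem_support, φ.support_eq]
          exact fun h => hx (hrV h).1
        simp [h0]
    have h2 := h1.trans (eLpNorm_indicator_const_le (1 : ℝ) 2)
    have h3 : ‖(1 : ℝ)‖ₑ * volume U ^ (1 / (2 : ℝ≥0∞).toReal) < ENNReal.ofReal ε := by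
      have : ENNReal.ofReal ε = ENNReal.ofReal (ε ^ 2) ^ (1 / (2 : ℝ)) := by
        rw [ENNReal.ofReal_rpow_of_pos (by positivity), ← Real.sqrt_eq_rpow,
          Real.sqrt_sq hε.le]
      rw [this]
      simpa using ENNReal.rpow_lt_rpow hUv (by norm_num : (0 : ℝ) < 1 / 2)
    exact (ENNReal.lt_ofReal_iff_toReal_lt (h2.trans_lt (h3.trans ENNReal.ofReal_lt_top)).ne).1
      (h2.trans_lt h3)

theorem exists_mem_H2_gammaTrace_eq (hn : n < 4) (Y : Fin N → Space n)
    (hY : Function.Injective Y) (X : Mat n N) : ∃ u ∈ H2 n, gammaTrace Y u = X := by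
  choose u hu hu' _ using fun p => exists_mem_H2_gammaTrace_eq_single Y hY p one_pos
  have key : ∀ s : Finset (Fin n × Fin N), ∃ v ∈ H2 n,
      gammaTrace Y v = ∑ p ∈ s, X p • EuclideanSpace.single p (1 : ℂ) := by
    intro s
    classical
    induction s using Finset.induction_on with
    | empty =>
      refine ⟨0, zero_mem _, ?_⟩
      rw [Finset.sum_empty, ← mem_kerTrace_iff Y hn (zero_mem _)]
      exact zero_mem _
    | insert p s hp ih =>
      obtain ⟨v, hv, hv'⟩ := ih
      refine ⟨X p • u p + v, add_mem (Submodule.smul_mem _ _ (hu p)) hv, ?_⟩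
      rw [gammaTrace_add Y hn (Submodule.smul_mem _ _ (hu p)) hv, gammaTrace_smul Y hn _ (hu p),
        hu', hv', Finset.sum_insert hp]
  obtain ⟨v, hv, hv'⟩ := key Finset.univ
  refine ⟨v, hv, ?_⟩
  rw [hv']
  ext q
  simp [Finset.sum_apply, Pi.single_apply]

/-- The trace is not continuous in the norm of `L²` in any direction. -/
theorem eq_zero_of_inner_gammaTrace (Y : Fin N → Space n) (hY : Function.Injective Y)
    {X : Mat n N} {f : L2 n} (h : ∀ u ∈ H2 n, ⟪f, u⟫_ℂ = ⟪X, gammaTrace Y u⟫_ℂ) : X = 0 := by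
  ext p
  rw [PiLp.zero_apply]
  by_contra hX
  have hX' : 0 < ‖X p‖ := norm_pos_iff.2 hX
  -- For this ε, Cauchy-Schwarz gives |X p| = |⟨f, u⟩| ≤ ‖f‖ ‖u‖, while (‖f‖ + 1) ‖u‖ < |X p|.
  obtain ⟨u, hu, hu', hu''⟩ := exists_mem_H2_gammaTrace_eq_single Y hY p
    (ε := ‖X p‖ / (‖f‖ + 1)) (by positivity)
  have h1 := norm_inner_le_norm (𝕜 := ℂ) f u
  rw [h u hu, hu', EuclideanSpace.inner_single_right] at h1
  rw [lt_div_iff₀ (by positivity)] at hu''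
  simp only [one_mul, RCLike.norm_conj] at h1
  nlinarith [norm_nonneg u, norm_nonneg f]

end

section

variable {n N : ℕ}

/-! ### The trace and the fields `G_z` -/

/-- The trace as a linear map on `H²`. -/
def traceH2 (hn : n < 4) (Y : Fin N → Space n) : H2 n →ₗ[ℂ] Mat n N where
  toFun u := gammaTrace Y u
  map_add' u v := gammaTrace_add Y hn u.2 v.2
  map_smul' c u := gammaTrace_smul Y hn c u.2

/-- Since γ is onto, a functional vanishing on its kernel factors through ℂ^{n,N}, where the Riesz
theorem applies. No continuity of l is needed, because the factored functional lives on a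
finite-dimensional space. -/
theorem exists_inner_gammaTrace (hn : n < 4) (Y : Fin N → Space n) (hY : Function.Injective Y)
    (l : H2 n →ₗ[ℂ] ℂ) (hl : ∀ u : H2 n, gammaTrace Y u = 0 → l u = 0) :
    ∃ X : Mat n N, ∀ u : H2 n, l u = ⟪X, gammaTrace Y u⟫_ℂ := by
  obtain ⟨r, hr⟩ := (traceH2 hn Y).exists_rightInverse_of_surjective
    (LinearMap.range_eq_top.2 fun X =>
      let ⟨u, hu, h⟩ := exists_mem_H2_gammaTrace_eq hn Y hY X; ⟨⟨u, hu⟩, h⟩)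
  refine ⟨(InnerProductSpace.toDual ℂ (Mat n N)).symm (LinearMap.toContinuousLinearMap (l ∘ₗ r)),
    fun u => ?_⟩
  rw [InnerProductSpace.toDual_symm_apply]
  change l u = l (r (traceH2 hn Y u))
  rw [← sub_eq_zero, ← map_sub]
  refine hl _ ?_
  change traceH2 hn Y (u - r (traceH2 hn Y u)) = 0
  rw [map_sub, sub_eq_zero]
  exact (LinearMap.congr_fun hr (traceH2 hn Y u)).symm

/-- The Lamé operator as a linear map on `H²`. -/
def lameMap (lam mu : ℝ) : H2 n →ₗ[ℂ] L2 n := (lame n lam mu).toFun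

theorem lameMap_symmetric (lam mu : ℝ) (u v : H2 n) :
    ⟪lameMap lam mu u, (v : L2 n)⟫_ℂ = ⟪(u : L2 n), lameMap lam mu v⟫_ℂ :=
  lame_symmetric lam mu u v

/-- The algebra behind `im_inner_traceDiff`, with a = G_{-1}X and g = G_z X: the hypothesis is the
symmetry of L₀ at a - g, whose image under L₀ is -a - zg. -/
theorem im_inner_of_symm {E : Type*} [NormedAddCommGroup E] [InnerProductSpace ℂ E] {a g : E}
    {z : ℂ} (h : ⟪(-1 : ℂ) • a - z • g, a - g⟫_ℂ = ⟪a - g, (-1 : ℂ) • a - z • g⟫_ℂ) :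
    (⟪a, (-1 : ℂ) • a - z • g⟫_ℂ - -1 * ⟪a, a - g⟫_ℂ).im = -(z.im * ‖g‖ ^ 2) := by
  have h3 := inner_conj_symm (𝕜 := ℂ) a g
  simp only [inner_sub_left, inner_sub_right, inner_smul_left, inner_smul_right,
    inner_self_eq_norm_sq_to_K, ← h3] at h ⊢
  generalize ⟪g, a⟫_ℂ = w at h ⊢
  have h4 := congrArg Complex.im h
  simp [← Complex.ofReal_pow] at h4 ⊢
  linarith

variable {lam mu : ℝ} (hn : n < 4) (hmu : 0 < mu) (hlm : 0 < lam + mu) (Y : Fin N → Space n)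

include hmu hlm

theorem lameRes_mem {z : ℂ} (hz : z.im ≠ 0 ∨ z.re < 0) (f : L2 n) : lameRes n lam mu z f ∈ H2 n :=
  ((isResolventAt_lameRes hmu hlm hz).1 f).choose

theorem lameMap_lameRes {z : ℂ} (hz : z.im ≠ 0 ∨ z.re < 0) (f : L2 n) :
    lameMap lam mu ⟨lameRes n lam mu z f, lameRes_mem hmu hlm hz f⟩ =
      f + z • lameRes n lam mu z f :=
  sub_eq_iff_eq_add.1 ((isResolventAt_lameRes hmu hlm hz).1 f).choose_spec

theorem lameRes_lameMap {z : ℂ} (hz : z.im ≠ 0 ∨ z.re < 0) (u : H2 n) :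
    lameRes n lam mu z (lameMap lam mu u - z • (u : L2 n)) = u :=
  (isResolventAt_lameRes hmu hlm hz).2 u

include hn

/-- The weak form of (L₀ - z) G_z X = γ* X. All later properties of G_z are deduced from it. -/
theorem inner_gField_left {z : ℂ} (hz : z.im ≠ 0 ∨ z.re < 0) (X : Mat n N) (u : H2 n) :
    ⟪gField lam mu Y z X, lameMap lam mu u⟫_ℂ =
      ⟪X, gammaTrace Y u⟫_ℂ + conj z * ⟪gField lam mu Y z X, (u : L2 n)⟫_ℂ := by
  have hz' : (conj z).im ≠ 0 ∨ (conj z).re < 0 := by simpa using hz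
  have h := ContinuousLinearMap.adjoint_inner_left (traceRes lam mu Y (conj z))
    (lameMap lam mu u - conj z • (u : L2 n)) X
  rw [traceRes_apply Y hn hmu hlm hz', lameRes_lameMap hmu hlm hz'] at h
  rw [← h, inner_sub_right, inner_smul_right, gField]
  ring

theorem inner_gField_right {z : ℂ} (hz : z.im ≠ 0 ∨ z.re < 0) (X : Mat n N) (u : H2 n) :
    ⟪lameMap lam mu u, gField lam mu Y z X⟫_ℂ =
      ⟪gammaTrace Y u, X⟫_ℂ + z * ⟪(u : L2 n), gField lam mu Y z X⟫_ℂ := by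
  have h := congrArg conj (inner_gField_left hn hmu hlm Y hz X u)
  simpa [inner_conj_symm] using h

theorem gField_injective (hY : Function.Injective Y) {z : ℂ} (hz : z.im ≠ 0 ∨ z.re < 0)
    {X : Mat n N} (h : gField lam mu Y z X = 0) : X = 0 := by
  obtain ⟨u, hu, hu'⟩ := exists_mem_H2_gammaTrace_eq hn Y hY X
  have := inner_gField_left hn hmu hlm Y hz X ⟨u, hu⟩
  rw [h, hu'] at this
  simpa using this.symm

/-- The first resolvent identity applied to γ*. Its consequence is that the singularities of G_z X
do not depend on z modulo H². -/
theorem gField_sub {z w : ℂ} (hz : z.im ≠ 0 ∨ z.re < 0) (hw : w.im ≠ 0 ∨ w.re < 0)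
    (X : Mat n N) :
    gField lam mu Y z X - gField lam mu Y w X =
      (z - w) • lameRes n lam mu w (gField lam mu Y z X) := by
  have hw' : (conj w).im ≠ 0 ∨ (conj w).re < 0 := by simpa using hw
  refine ext_inner_right ℂ fun f => ?_
  have hf := lameMap_lameRes hmu hlm hw' f
  set u : H2 n := ⟨lameRes n lam mu (conj w) f, lameRes_mem hmu hlm hw' f⟩ with hu
  have hf' : f = lameMap lam mu u - conj w • (u : L2 n) := by rw [hf]; simp [hu]
  have h1 := inner_gField_left hn hmu hlm Y hz X u
  have h2 := inner_gField_left hn hmu hlm Y hw X u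
  have h3 := lameMap_symmetric lam mu ⟨_, lameRes_mem hmu hlm hw (gField lam mu Y z X)⟩ u
  rw [lameMap_lameRes hmu hlm hw, inner_add_left, inner_smul_left] at h3
  simp only at h3
  rw [hf', inner_sub_left, inner_sub_right, inner_sub_right, inner_smul_left, inner_smul_right,
    inner_smul_right, inner_sub_right, inner_smul_right, h1, h2, ← h3]
  simp only [map_sub]
  ring

theorem gField_sub_mem {z w : ℂ} (hz : z.im ≠ 0 ∨ z.re < 0) (hw : w.im ≠ 0 ∨ w.re < 0)
    (X : Mat n N) : gField lam mu Y z X - gField lam mu Y w X ∈ H2 n := by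
  rw [gField_sub hn hmu hlm Y hz hw]
  exact Submodule.smul_mem _ _ (lameRes_mem hmu hlm hw _)

theorem lameMap_gField_sub {z w : ℂ} (hz : z.im ≠ 0 ∨ z.re < 0) (hw : w.im ≠ 0 ∨ w.re < 0)
    (X : Mat n N) :
    lameMap lam mu ⟨_, gField_sub_mem hn hmu hlm Y hz hw X⟩ =
      z • gField lam mu Y z X - w • gField lam mu Y w X := by
  have h := gField_sub hn hmu hlm Y hz hw X
  have h1 : (⟨_, gField_sub_mem hn hmu hlm Y hz hw X⟩ : H2 n) =
      (z - w) • ⟨_, lameRes_mem hmu hlm hw (gField lam mu Y z X)⟩ := Subtype.ext h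
  have h2 := map_smul (lameMap lam mu) (z - w)
    ⟨_, lameRes_mem hmu hlm hw (gField lam mu Y z X)⟩
  rw [lameMap_lameRes hmu hlm hw, smul_add, smul_comm, ← h] at h2
  rw [h1]
  refine h2.trans ?_
  module

/-- `gammaTrace` is a choice of limits and is linear only where these exist, so extending from basis
vectors uses that the differences lie in H². -/
theorem traceDiff_apply {z : ℂ} (hz : z.im ≠ 0 ∨ z.re < 0) (X : Mat n N) :
    traceDiff lam mu Y z X = gammaTrace Y (gField lam mu Y (-1) X - gField lam mu Y z X) := by
  have h1 : (-1 : ℂ).im ≠ 0 ∨ (-1 : ℂ).re < 0 := by right; simp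
  let D : Mat n N →ₗ[ℂ] H2 n := LinearMap.codRestrict (H2 n)
    ((gField lam mu Y (-1) - gField lam mu Y z : Mat n N →L[ℂ] L2 n) : Mat n N →ₗ[ℂ] L2 n)
    (gField_sub_mem hn hmu hlm Y h1 hz)
  have hX : X = ∑ q, X q • EuclideanSpace.single q (1 : ℂ) := by
    ext p; simp [Pi.single_apply]
  have h2 : gammaTrace Y (gField lam mu Y (-1) X - gField lam mu Y z X) =
      traceH2 hn Y (D X) := rfl
  rw [h2]
  ext p
  conv_rhs => rw [hX]
  rw [map_sum, map_sum, traceDiff, Matrix.ofLp_toEuclideanCLM]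
  simp only [map_smul, Matrix.mulVec, dotProduct, WithLp.ofLp_sum, Finset.sum_apply,
    PiLp.smul_apply, smul_eq_mul]
  exact Finset.sum_congr rfl fun q _ => mul_comm _ _

theorem im_inner_traceDiff {z : ℂ} (hz : z.im ≠ 0 ∨ z.re < 0) (X : Mat n N) :
    (⟪X, traceDiff lam mu Y z X⟫_ℂ).im = -(z.im * ‖gField lam mu Y z X‖ ^ 2) := by
  have h1 : (-1 : ℂ).im ≠ 0 ∨ (-1 : ℂ).re < 0 := by right; simp
  have e1 := lameMap_gField_sub hn hmu hlm Y h1 hz X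
  have e2 := inner_gField_left hn hmu hlm Y h1 X ⟨_, gField_sub_mem hn hmu hlm Y h1 hz X⟩
  have e3 := lameMap_symmetric lam mu ⟨_, gField_sub_mem hn hmu hlm Y h1 hz X⟩
    ⟨_, gField_sub_mem hn hmu hlm Y h1 hz X⟩
  rw [e1] at e2 e3
  rw [traceDiff_apply hn hmu hlm Y hz]
  refine (congrArg Complex.im (eq_sub_iff_add_eq.2 e2.symm)).trans ?_
  rw [map_neg, map_one]
  exact im_inner_of_symm e3

/-- The quadratic form of θ is real, so on the kernel Im z ‖G_z X‖² = 0. Hence X = 0, and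
injectivity suffices in finite dimension. -/
theorem mem_zSet_of_im_ne_zero (hY : Function.Injective Y) {θ : Mat n N →L[ℂ] Mat n N}
    (hθ : IsSelfAdjoint θ) {z : ℂ} (hz : z.im ≠ 0) : z ∈ zSet lam mu Y θ := by
  refine ⟨Or.inl hz, ?_⟩
  have hinj : Function.Injective (θ + traceDiff lam mu Y z) := by
    rw [injective_iff_map_eq_zero]
    intro X hX
    have h1 : (⟪X, (θ + traceDiff lam mu Y z) X⟫_ℂ).im = 0 := by rw [hX]; simp
    have h2 : (⟪X, θ X⟫_ℂ).im = 0 := by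
      have := ContinuousLinearMap.adjoint_inner_left θ X X
      rw [hθ.adjoint_eq, ← inner_conj_symm] at this
      exact Complex.conj_eq_iff_im.1 this
    rw [add_apply, inner_add_right, Complex.add_im, h2,
      im_inner_traceDiff hn hmu hlm Y (Or.inl hz)] at h1
    have h3 : ‖gField lam mu Y z X‖ = 0 := by
      have : z.im * ‖gField lam mu Y z X‖ ^ 2 = 0 := by linarith
      simpa [hz] using this
    exact gField_injective hn hmu hlm Y hY (Or.inl hz) (norm_eq_zero.1 h3)
  have hbij : Function.Bijective (θ + traceDiff lam mu Y z) :=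
    ⟨hinj, (LinearMap.injective_iff_surjective
      (f := ((θ + traceDiff lam mu Y z : Mat n N →L[ℂ] Mat n N) : Mat n N →ₗ[ℂ] Mat n N))).1 hinj⟩
  exact ContinuousLinearMap.isUnit_iff_bijective.2 hbij

end

section

variable {n N : ℕ} {lam mu : ℝ}

/-! ### The adjoint of the minimal operator -/

theorem mem_lameMin_domain {Y : Fin N → Space n} {u : L2 n} :
    u ∈ (lameMin lam mu Y).domain ↔ u ∈ kerTrace Y ∧ u ∈ H2 n := Iff.rfl

theorem lameMin_apply {Y : Fin N → Space n} (u : (lameMin lam mu Y).domain) :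
    lameMin lam mu Y u = lameMap lam mu ⟨u.1, (mem_lameMin_domain.1 u.2).2⟩ :=
  rfl

/-- The domain of the point perturbation in terms of `G_{-1}`. -/
def bvDomain (hn : n < 4) (lam mu : ℝ) (Y : Fin N → Space n) (θ : Mat n N →L[ℂ] Mat n N) :
    Submodule ℂ (L2 n) where
  carrier := {v | ∃ u : H2 n, ∃ X : Mat n N, gammaTrace Y u = θ X ∧
    v = u + gField lam mu Y (-1) X}
  zero_mem' := ⟨0, 0, by
    rw [map_zero]; exact map_zero (traceH2 hn Y), by simp⟩
  add_mem' := by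
    rintro _ _ ⟨u, X, h, rfl⟩ ⟨w, W, h', rfl⟩
    refine ⟨u + w, X + W, ?_, ?_⟩
    · rw [map_add, ← h, ← h']; exact map_add (traceH2 hn Y) u w
    · rw [map_add, Submodule.coe_add]; abel
  smul_mem' := by
    rintro c _ ⟨u, X, h, rfl⟩
    refine ⟨c • u, c • X, ?_, ?_⟩
    · rw [map_smul, ← h]; exact map_smul (traceH2 hn Y) c u
    · rw [map_smul, Submodule.coe_smul, smul_add]

/-- The restriction of the adjoint of the minimal operator by a boundary condition. -/
def bvOperator (hn : n < 4) (lam mu : ℝ) (Y : Fin N → Space n) (θ : Mat n N →L[ℂ] Mat n N) :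
    L2 n →ₗ.[ℂ] L2 n :=
  (lameMin lam mu Y).adjoint.domRestrict (bvDomain hn lam mu Y θ)

variable (hn : n < 4) (hmu : 0 < mu) (hlm : 0 < lam + mu) (Y : Fin N → Space n)

include hn in
-- If f is orthogonal to the domain, ⟨f, ·⟩ on H² equals ⟨X, γ ·⟩. The left side is L² bounded and γ
-- is not, which forces X = 0, so f is orthogonal to H² and in particular to all Schwartz functions.
theorem dense_lameMin_domain (hY : Function.Injective Y) :
    Dense ((lameMin lam mu Y).domain : Set (L2 n)) := by
  rw [Submodule.dense_iff_topologicalClosure_eq_top, Submodule.topologicalClosure_eq_top_iff,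
    Submodule.eq_bot_iff]
  intro f hf
  rw [Submodule.mem_orthogonal'] at hf
  obtain ⟨X, hX⟩ := exists_inner_gammaTrace hn Y hY ((innerₛₗ ℂ f) ∘ₗ (H2 n).subtype)
    fun u hu => hf u ⟨(mem_kerTrace_iff Y hn u.2).2 hu, u.2⟩
  have hX0 : X = 0 := eq_zero_of_inner_gammaTrace Y hY fun u hu => hX ⟨u, hu⟩
  subst hX0
  have h2 : ∀ u ∈ H2 n, ⟪f, u⟫_ℂ = 0 := fun u hu => by simpa using hX ⟨u, hu⟩
  have h3 : Dense ((H2 n : Submodule ℂ (L2 n)) : Set (L2 n)) := by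
    refine Dense.mono ?_ (SchwartzMap.denseRange_toLpCLM (E := Space n) (F := Val n) (p := 2)
      (μ := volume) ENNReal.ofNat_ne_top)
    rintro _ ⟨φ, rfl⟩
    exact schwartz_mem_H2 φ
  exact h3.eq_zero_of_inner_left ℂ fun v hv => h2 v hv

include hn hmu hlm

/-- Green's identity for the adjoint of the minimal operator. -/
theorem green_identity (u w : H2 n) (X W : Mat n N) :
    ⟪lameMap lam mu u - gField lam mu Y (-1) X, (w : L2 n) + gField lam mu Y (-1) W⟫_ℂ -
        ⟪(u : L2 n) + gField lam mu Y (-1) X, lameMap lam mu w - gField lam mu Y (-1) W⟫_ℂ =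
      ⟪gammaTrace Y u, W⟫_ℂ - ⟪X, gammaTrace Y w⟫_ℂ := by
  have h1 : (-1 : ℂ).im ≠ 0 ∨ (-1 : ℂ).re < 0 := by right; simp
  have e1 := inner_gField_left hn hmu hlm Y h1 X w
  have e2 := inner_gField_right hn hmu hlm Y h1 W u
  have e3 := lameMap_symmetric lam mu u w
  rw [map_neg, map_one] at e1
  simp only [inner_add_left, inner_add_right, inner_sub_left, inner_sub_right, e1, e2, e3]
  ring

theorem inner_adjoint_lameMin (u : H2 n) (X : Mat n N) (x : (lameMin lam mu Y).domain) :
    ⟪lameMap lam mu u - gField lam mu Y (-1) X, (x : L2 n)⟫_ℂ =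
      ⟪(u : L2 n) + gField lam mu Y (-1) X, lameMin lam mu Y x⟫_ℂ := by
  have h := green_identity hn hmu hlm Y u ⟨x.1, (mem_lameMin_domain.1 x.2).2⟩ X 0
  rw [map_zero, add_zero, sub_zero, inner_zero_right, zero_sub,
    (mem_kerTrace_iff Y hn (mem_lameMin_domain.1 x.2).2).1 (mem_lameMin_domain.1 x.2).1, inner_zero_right, neg_zero, sub_eq_zero] at h
  exact h

theorem mem_adjoint_domain_iff (hY : Function.Injective Y) (v : L2 n) :
    v ∈ (lameMin lam mu Y).adjoint.domain ↔
      ∃ u : H2 n, ∃ X : Mat n N, v = u + gField lam mu Y (-1) X := by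
  have h1 : (-1 : ℂ).im ≠ 0 ∨ (-1 : ℂ).re < 0 := by right; simp
  have hd := dense_lameMin_domain (lam := lam) (mu := mu) hn Y hY
  constructor
  · intro hv
    have hS := (lameMin lam mu Y).adjoint_isFormalAdjoint hd ⟨v, hv⟩
    set g := (lameMin lam mu Y).adjoint ⟨v, hv⟩
    simp only at hS
    -- If v = u + G_{-1}X then S*v + v = (L₀ + 1)u, so this is the only possible regular part.
    let w : H2 n := ⟨_, lameRes_mem hmu hlm h1 (g + v)⟩
    have hw : lameMap lam mu w + w = g + v := by
      have := lameMap_lameRes hmu hlm h1 (g + v)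
      rw [this]; change _ + (-1 : ℂ) • (w : L2 n) + w = _; module
    -- v - w is orthogonal to (L₀ + 1) ker γ, so the functional φ ↦ ⟨v - w, (L₀ + 1)φ⟩ factors
    -- through γ.
    obtain ⟨X, hX⟩ := exists_inner_gammaTrace hn Y hY
      ((innerₛₗ ℂ (v - w)) ∘ₗ (lameMap lam mu + (H2 n).subtype)) (by
        intro φ hφ
        have hS' := hS ⟨φ, (mem_kerTrace_iff Y hn φ.2).2 hφ, φ.2⟩
        rw [lameMin_apply] at hS'
        change ⟪v - w, lameMap lam mu φ + φ⟫_ℂ = 0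
        have h2 := lameMap_symmetric lam mu w φ
        have h3 := congrArg (fun f => ⟪f, (φ : L2 n)⟫_ℂ) hw
        simp only [inner_add_left] at h3
        simp only at hS'
        rw [inner_sub_left, inner_add_right, inner_add_right, ← hS', ← h2, h3]
        ring)
    refine ⟨w, X, ?_⟩
    rw [← sub_eq_iff_eq_add']
    -- As (L₀ + 1) maps H² onto L², testing with f = (L₀ + 1)K_{-1}f identifies v - w with G_{-1}X.
    refine ext_inner_right ℂ fun f => ?_
    have hf := lameMap_lameRes hmu hlm h1 f
    have h4 := hX ⟨_, lameRes_mem hmu hlm h1 f⟩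
    have h5 := inner_gField_left hn hmu hlm Y h1 X ⟨_, lameRes_mem hmu hlm h1 f⟩
    have h6 : (((innerₛₗ ℂ (v - w)) ∘ₗ (lameMap lam mu + (H2 n).subtype))
        ⟨_, lameRes_mem hmu hlm h1 f⟩ : ℂ) = ⟪v - (w : L2 n), f⟫_ℂ := by
      change ⟪v - (w : L2 n), lameMap lam mu ⟨_, lameRes_mem hmu hlm h1 f⟩ +
        lameRes n lam mu (-1) f⟫_ℂ = _
      rw [hf]
      simp
    rw [hf, inner_add_right, inner_smul_right] at h5
    rw [← h6, h4]
    simpa using h5.symm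
  · rintro ⟨u, X, rfl⟩
    exact LinearPMap.mem_adjoint_domain_of_exists _
      ⟨_, inner_adjoint_lameMin hn hmu hlm Y u X⟩

theorem adjoint_lameMin_apply (hY : Function.Injective Y) (u : H2 n) (X : Mat n N)
    (v : (lameMin lam mu Y).adjoint.domain) (hv : (v : L2 n) = u + gField lam mu Y (-1) X) :
    (lameMin lam mu Y).adjoint v = lameMap lam mu u - gField lam mu Y (-1) X := by
  refine LinearPMap.adjoint_apply_eq (dense_lameMin_domain hn Y hY) _ fun x => ?_
  rw [hv]
  exact inner_adjoint_lameMin hn hmu hlm Y u X x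

/-! ### The operator with boundary condition γu = θX. -/

theorem mem_bvOperator_domain (hY : Function.Injective Y) (θ : Mat n N →L[ℂ] Mat n N) (v : L2 n) :
    v ∈ (bvOperator hn lam mu Y θ).domain ↔ v ∈ bvDomain hn lam mu Y θ := by
  refine ⟨fun h => h.1, fun h => ⟨h, ?_⟩⟩
  obtain ⟨u, X, -, rfl⟩ := h
  exact (mem_adjoint_domain_iff hn hmu hlm Y hY _).2 ⟨u, X, rfl⟩

theorem bvOperator_apply (hY : Function.Injective Y) (θ : Mat n N →L[ℂ] Mat n N) (u : H2 n)
    (X : Mat n N) (v : (bvOperator hn lam mu Y θ).domain)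
    (hv : (v : L2 n) = u + gField lam mu Y (-1) X) :
    bvOperator hn lam mu Y θ v = lameMap lam mu u - gField lam mu Y (-1) X :=
  adjoint_lameMin_apply hn hmu hlm Y hY u X ⟨v, v.2.2⟩ hv

theorem lameMin_le_bvOperator (hY : Function.Injective Y) (θ : Mat n N →L[ℂ] Mat n N) :
    lameMin lam mu Y ≤ bvOperator hn lam mu Y θ := by
  have hx : ∀ x ∈ (lameMin lam mu Y).domain, x ∈ bvDomain hn lam mu Y θ := fun x hx =>
    ⟨⟨x, hx.2⟩, 0, by rw [map_zero]; exact (mem_kerTrace_iff Y hn hx.2).1 hx.1, by simp⟩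
  refine ⟨fun x h => (mem_bvOperator_domain hn hmu hlm Y hY θ x).2 (hx x h), ?_⟩
  intro x y hxy
  rw [bvOperator_apply hn hmu hlm Y hY θ ⟨x.1, (mem_lameMin_domain.1 x.2).2⟩ 0 y (by simp [hxy]), lameMin_apply]
  simp

/-- Symmetry is the vanishing of the boundary form. Conversely, an element of the adjoint domain
lies in the domain of S*, and pairing it with all W, each realised because γ is onto, gives ⟨γu, W⟩
= ⟨X, θW⟩ = ⟨θX, W⟩. -/
theorem isSelfAdjoint_bvOperator (hY : Function.Injective Y) {θ : Mat n N →L[ℂ] Mat n N}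
    (hθ : IsSelfAdjoint θ) : IsSelfAdjoint (bvOperator hn lam mu Y θ) := by
  have hle := lameMin_le_bvOperator hn hmu hlm Y hY θ
  have hdS := dense_lameMin_domain (lam := lam) (mu := mu) hn Y hY
  have hd : Dense ((bvOperator hn lam mu Y θ).domain : Set (L2 n)) := hdS.mono hle.1
  have hsym : (bvOperator hn lam mu Y θ).IsFormalAdjoint (bvOperator hn lam mu Y θ) := by
    intro x y
    obtain ⟨u, X, h, e⟩ := (mem_bvOperator_domain hn hmu hlm Y hY θ x).1 x.2
    obtain ⟨w, W, h', e'⟩ := (mem_bvOperator_domain hn hmu hlm Y hY θ y).1 y.2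
    rw [bvOperator_apply hn hmu hlm Y hY θ u X x e, bvOperator_apply hn hmu hlm Y hY θ w W y e',
      e, e', ← sub_eq_zero, green_identity hn hmu hlm, h, h', sub_eq_zero]
    have := ContinuousLinearMap.adjoint_inner_left θ W X
    rwa [hθ.adjoint_eq] at this
  rw [LinearPMap.isSelfAdjoint_def]
  refine (LinearPMap.eq_of_le_of_domain_eq (hsym.le_adjoint hd)
    (le_antisymm (hsym.le_adjoint hd).1 fun v hv => ?_)).symm
  have hv' := (bvOperator hn lam mu Y θ).adjoint_isFormalAdjoint hd ⟨v, hv⟩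
  set g := (bvOperator hn lam mu Y θ).adjoint ⟨v, hv⟩
  simp only at hv'
  have hS : ∀ x : (lameMin lam mu Y).domain, ⟪g, (x : L2 n)⟫_ℂ = ⟪v, lameMin lam mu Y x⟫_ℂ := by
    intro x
    rw [hle.2 (x := x) (y := ⟨x, hle.1 x.2⟩) rfl]
    exact hv' ⟨x, hle.1 x.2⟩
  have hvS : v ∈ (lameMin lam mu Y).adjoint.domain :=
    LinearPMap.mem_adjoint_domain_of_exists _ ⟨g, hS⟩
  have hg := LinearPMap.adjoint_apply_eq hdS ⟨v, hvS⟩ hS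
  obtain ⟨u, X, e⟩ := (mem_adjoint_domain_iff hn hmu hlm Y hY v).1 hvS
  rw [adjoint_lameMin_apply hn hmu hlm Y hY u X ⟨v, hvS⟩ e] at hg
  refine (mem_bvOperator_domain hn hmu hlm Y hY θ v).2 ⟨u, X, ?_, e⟩
  refine ext_inner_right ℂ fun W => ?_
  obtain ⟨w, hw, hw'⟩ := exists_mem_H2_gammaTrace_eq hn Y hY (θ W)
  have hm : w + gField lam mu Y (-1) W ∈ (bvOperator hn lam mu Y θ).domain :=
    (mem_bvOperator_domain hn hmu hlm Y hY θ _).2 ⟨⟨w, hw⟩, W, hw', rfl⟩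
  have h1 := hv' ⟨_, hm⟩
  rw [bvOperator_apply hn hmu hlm Y hY θ ⟨w, hw⟩ W ⟨_, hm⟩ rfl, ← hg, e, ← sub_eq_zero] at h1
  have h2 := green_identity hn hmu hlm Y u ⟨w, hw⟩ X W
  simp only at h1 h2
  rw [h1, hw'] at h2
  have := ContinuousLinearMap.adjoint_inner_left θ W X
  rw [hθ.adjoint_eq] at this
  rw [this]
  exact (sub_eq_zero.1 h2.symm)

end

section

section Krein

variable {n N : ℕ} {lam mu : ℝ}

/-! ### The Krein formula -/

/-- The range of the resolvent is the domain, and its inverse recovers the action, so one spectral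
point determines the operator. -/
theorem IsResolventAt.eq_of_eq {T T' : L2 n →ₗ.[ℂ] L2 n} {z : ℂ} {R : L2 n →L[ℂ] L2 n}
    (h : IsResolventAt T z R) (h' : IsResolventAt T' z R) : T = T' := by
  have key : ∀ {A B : L2 n →ₗ.[ℂ] L2 n}, IsResolventAt A z R → IsResolventAt B z R →
      A ≤ B := by
    intro A B hA hB
    refine ⟨fun u hu => ?_, fun x y hxy => ?_⟩
    · have := hA.2 ⟨u, hu⟩
      rw [← show R _ = u from this]
      exact (hB.1 _).choose
    · obtain ⟨h1, h2⟩ := hB.1 (A x - z • (x : L2 n))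
      have h3 : (⟨_, h1⟩ : B.domain) = y := Subtype.ext ((hA.2 x).trans hxy)
      rw [h3, hA.2 x] at h2
      exact (sub_left_injective h2).symm
  exact le_antisymm (key h h') (key h' h)

variable {Y : Fin N → Space n} {θ : Mat n N →L[ℂ] Mat n N}

theorem weyl_spec {z : ℂ} (hz : z ∈ zSet lam mu Y θ) (X : Mat n N) :
    θ (weyl lam mu Y θ z X) + traceDiff lam mu Y z (weyl lam mu Y θ z X) = X := by
  have := congrArg (fun A : Mat n N →L[ℂ] Mat n N => A X) (Ring.mul_inverse_cancel _ hz.2)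
  exact this

theorem eq_zero_of_mem_zSet {z : ℂ} (hz : z ∈ zSet lam mu Y θ) {X : Mat n N}
    (h : θ X + traceDiff lam mu Y z X = 0) : X = 0 := by
  have := congrArg (fun A : Mat n N →L[ℂ] Mat n N => A X) (Ring.inverse_mul_cancel _ hz.2)
  change weyl lam mu Y θ z (θ X + traceDiff lam mu Y z X) = X at this
  rw [← this, h, map_zero]

variable (hn : n < 4) (hmu : 0 < mu) (hlm : 0 < lam + mu)

include hn hmu hlm

theorem kreinRes_apply {z : ℂ} (hz : z.im ≠ 0 ∨ z.re < 0) (f : L2 n) :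
    kreinRes lam mu Y θ z f = lameRes n lam mu z f +
      gField lam mu Y z (weyl lam mu Y θ z (gammaTrace Y (lameRes n lam mu z f))) := by
  have h : ContinuousLinearMap.adjoint (gField lam mu Y (conj z)) f =
      gammaTrace Y (lameRes n lam mu z f) := by
    rw [gField, ContinuousLinearMap.adjoint_adjoint, Complex.conj_conj,
      traceRes_apply Y hn hmu hlm hz]
  rw [← h]
  rfl

theorem isResolventAt_bvOperator (hY : Function.Injective Y) {z : ℂ}
    (hz : z ∈ zSet lam mu Y θ) :
    IsResolventAt (bvOperator hn lam mu Y θ) z (kreinRes lam mu Y θ z) := by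
  have h1 : (-1 : ℂ).im ≠ 0 ∨ (-1 : ℂ).re < 0 := by right; simp
  have fwd : ∀ f : L2 n, ∃ h : kreinRes lam mu Y θ z f ∈ (bvOperator hn lam mu Y θ).domain,
      bvOperator hn lam mu Y θ ⟨kreinRes lam mu Y θ z f, h⟩ - z • kreinRes lam mu Y θ z f = f := by
    intro f
    rw [kreinRes_apply hn hmu hlm hz.1]
    set X := weyl lam mu Y θ z (gammaTrace Y (lameRes n lam mu z f)) with hX
    let k : H2 n := ⟨_, lameRes_mem hmu hlm hz.1 f⟩
    let d : H2 n := ⟨_, gField_sub_mem hn hmu hlm Y hz.1 h1 X⟩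
    let d' : H2 n := ⟨_, gField_sub_mem hn hmu hlm Y h1 hz.1 X⟩
    have hdd : d = -d' := Subtype.ext (neg_sub _ _).symm
    -- The splitting is moved from G_z to G_{-1}; the difference is regular. The trace of the new
    -- regular part is γK_z f - γ(G_{-1} - G_z)X, which equals θX by the choice of X.
    have hv : lameRes n lam mu z f + gField lam mu Y z X =
        ((k + d : H2 n) : L2 n) + gField lam mu Y (-1) X := by
      rw [Submodule.coe_add]
      change _ = lameRes n lam mu z f + (gField lam mu Y z X - gField lam mu Y (-1) X) + _
      abel
    have hg : gammaTrace Y ((k + d : H2 n) : L2 n) = θ X := by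
      change traceH2 hn Y (k + d) = θ X
      have e1 : traceH2 hn Y k = θ X + traceDiff lam mu Y z X := (weyl_spec hz _).symm
      have e2 : traceH2 hn Y d' = traceDiff lam mu Y z X :=
        (traceDiff_apply hn hmu hlm Y hz.1 X).symm
      rw [map_add, hdd, map_neg, e1, e2, add_neg_cancel_right]
    have hm : lameRes n lam mu z f + gField lam mu Y z X ∈ (bvOperator hn lam mu Y θ).domain :=
      (mem_bvOperator_domain hn hmu hlm Y hY θ _).2 ⟨k + d, X, hg, hv⟩
    refine ⟨hm, ?_⟩
    rw [bvOperator_apply hn hmu hlm Y hY θ (k + d) X ⟨_, hm⟩ hv, map_add]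
    have e3 : lameMap lam mu k = _ := lameMap_lameRes hmu hlm hz.1 f
    have e4 : lameMap lam mu d = _ := lameMap_gField_sub hn hmu hlm Y hz.1 h1 X
    rw [e3, e4]
    module
  refine ⟨fwd, fun u => ?_⟩
  obtain ⟨h2, h3⟩ := fwd (bvOperator hn lam mu Y θ u - z • (u : L2 n))
  set f := bvOperator hn lam mu Y θ u - z • (u : L2 n)
  -- It remains to exclude eigenvectors at z. Rewritten with G_z, the regular part of w is an
  -- eigenvector of L₀ in H², hence zero, and then its singular coefficient is killed by θ +
  -- γ(G_{-1} - G_z).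
  set w : (bvOperator hn lam mu Y θ).domain := u - ⟨_, h2⟩ with hw
  have h4 : bvOperator hn lam mu Y θ w = z • (w : L2 n) := by
    rw [hw, LinearPMap.map_sub, sub_eq_iff_eq_add.1 h3]
    simp only [AddSubgroupClass.coe_sub, f]
    module
  obtain ⟨w₀, W, h5, h6⟩ := (mem_bvOperator_domain hn hmu hlm Y hY θ _).1 w.2
  rw [bvOperator_apply hn hmu hlm Y hY θ w₀ W w h6, h6] at h4
  let d : H2 n := ⟨_, gField_sub_mem hn hmu hlm Y h1 hz.1 W⟩
  have e4 : lameMap lam mu d = _ := lameMap_gField_sub hn hmu hlm Y h1 hz.1 W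
  have h7 : lameMap lam mu (w₀ + d) - z • ((w₀ + d : H2 n) : L2 n) = 0 := by
    rw [map_add, e4, sub_eq_iff_eq_add.1 h4, Submodule.coe_add]
    change _ - z • ((w₀ : L2 n) + (gField lam mu Y (-1) W - gField lam mu Y z W)) = 0
    module
  have h8 : w₀ + d = 0 := by
    have := lameRes_lameMap hmu hlm hz.1 (w₀ + d)
    rw [h7, map_zero] at this
    exact Subtype.ext this.symm
  have h9 : W = 0 := by
    refine eq_zero_of_mem_zSet hz ?_
    rw [← h5, traceDiff_apply hn hmu hlm Y hz.1]
    change traceH2 hn Y w₀ + traceH2 hn Y d = 0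
    rw [← map_add, h8, map_zero]
  have h10 : (w : L2 n) = 0 := by
    have h11 : (d : L2 n) = 0 := by
      change gField lam mu Y (-1) W - gField lam mu Y z W = 0
      rw [h9]; simp
    have h12 := congrArg (fun v : H2 n => (v : L2 n)) h8
    simp only [Submodule.coe_add, h11, add_zero, Submodule.coe_zero] at h12
    rw [h6, h12, h9]; simp
  have h13 : (u : L2 n) - kreinRes lam mu Y θ z f = 0 := h10
  exact (sub_eq_zero.1 h13).symm

theorem isPointPerturbation_bvOperator (hY : Function.Injective Y) (hθ : IsSelfAdjoint θ) :
    IsPointPerturbation lam mu Y θ (bvOperator hn lam mu Y θ) :=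
  ⟨isSelfAdjoint_bvOperator hn hmu hlm Y hY hθ, lameMin_le_bvOperator hn hmu hlm Y hY θ,
    fun _ hz => isResolventAt_bvOperator hn hmu hlm hY hz⟩

theorem IsPointPerturbation.eq_bvOperator (hY : Function.Injective Y) (hθ : IsSelfAdjoint θ)
    {T : L2 n →ₗ.[ℂ] L2 n} (hT : IsPointPerturbation lam mu Y θ T) :
    T = bvOperator hn lam mu Y θ := by
  have hI : Complex.I ∈ zSet lam mu Y θ :=
    mem_zSet_of_im_ne_zero hn hmu hlm Y hY hθ (by simp)
  exact (hT.resolvent _ hI).eq_of_eq (isResolventAt_bvOperator hn hmu hlm hY hI)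

theorem IsPointPerturbation.domain_eq_kreinDomain {T : L2 n →ₗ.[ℂ] L2 n}
    (hT : IsPointPerturbation lam mu Y θ T) {z : ℂ} (hz : z ∈ zSet lam mu Y θ) :
    (T.domain : Set (L2 n)) = kreinDomain lam mu Y θ z := by
  have hR := hT.resolvent z hz
  ext u
  constructor
  · intro hu
    have h := hR.2 ⟨u, hu⟩
    rw [kreinRes_apply hn hmu hlm hz.1] at h
    exact ⟨_, lameRes_mem hmu hlm hz.1 _, h.symm⟩
  · rintro ⟨u₀, hu₀, rfl⟩
    obtain ⟨h, -⟩ := hR.1 (lameMap lam mu ⟨u₀, hu₀⟩ - z • u₀)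
    rw [kreinRes_apply hn hmu hlm hz.1, lameRes_lameMap hmu hlm hz.1 ⟨u₀, hu₀⟩] at h
    exact h

end Krein

end

/-! ### Integrals of heat kernels over time -/

open Set Real in
-- The substitution t ↦ 1 / t turns this into a Gamma integral.
theorem integrableOn_rpow_neg_mul_exp_neg_div {m s : ℝ} (hm : 1 < m) (hs : 0 < s) :
    IntegrableOn (fun t : ℝ => t ^ (-m) * exp (-(s / (4 * t)))) (Ioi 0) ∧
      ∫ t in Ioi (0 : ℝ), t ^ (-m) * exp (-(s / (4 * t))) = Gamma (m - 1) * (4 / s) ^ (m - 1) := by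
  have e : ∀ t ∈ Ioi (0 : ℝ), (|(-1 : ℝ)| * t ^ ((-1 : ℝ) - 1)) •
      ((t ^ (-1 : ℝ)) ^ (m - 1 - 1) * exp (-(s / 4 * t ^ (-1 : ℝ)))) =
      t ^ (-m) * exp (-(s / (4 * t))) := by
    intro t ht
    rw [mem_Ioi] at ht
    rw [← rpow_mul ht.le, smul_eq_mul, abs_neg, abs_one, one_mul, ← mul_assoc, ← rpow_add ht,
      rpow_neg_one]
    congr 2
    · ring
    · field_simp
  have h1 := integrableOn_rpow_mul_exp_neg_mul_rpow (s := m - 1 - 1) (p := 1) (b := s / 4)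
    (by linarith) one_pos (by positivity)
  simp only [rpow_one, neg_mul] at h1
  constructor
  · exact ((integrableOn_Ioi_comp_rpow_iff _ (by norm_num : (-1 : ℝ) ≠ 0)).2 h1).congr_fun e
      measurableSet_Ioi
  · have h2 := integral_comp_rpow_Ioi
      (fun u : ℝ => u ^ (m - 1 - 1) * exp (-(s / 4 * u))) (by norm_num : (-1 : ℝ) ≠ 0)
    rw [integral_rpow_mul_exp_neg_mul_Ioi (by linarith) (by positivity)] at h2
    rw [← setIntegral_congr_fun measurableSet_Ioi e, h2, mul_comm]
    congr 2
    field_simp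

/-- The integral `∫ exp (-κ t) t^(-m) exp (-s / (4 t)) dt` over `(0, ∞)`. -/
def heatInt (κ m s : ℝ) : ℝ :=
  ∫ t in Set.Ioi (0 : ℝ), Real.exp (-(κ * t)) * (t ^ (-m) * Real.exp (-(s / (4 * t))))

open Set Real in
-- The damping is traded for half a power of t. This gives integrability at infinity for all m >
-- 1/2, including m = 1 in the plane, where the undamped integral diverges.
theorem exp_neg_mul_rpow_half_le {κ t : ℝ} (hκ : 0 < κ) (ht : 0 < t) :
    exp (-(κ * t)) * t ^ (1 / 2 : ℝ) ≤ 1 + 1 / κ := by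
  have h1 : t ^ (1 / 2 : ℝ) ≤ 1 + t := by
    rw [← Real.sqrt_eq_rpow, Real.sqrt_le_left (by positivity)]
    nlinarith
  have h2 : 1 + t ≤ (1 + 1 / κ) * exp (κ * t) := by
    have h3 := add_one_le_exp (κ * t)
    have h4 : 1 + t ≤ (1 + 1 / κ) * (κ * t + 1) := by
      have : (1 + 1 / κ) * (κ * t + 1) = 1 + t + κ * t + 1 / κ := by field_simp; ring
      rw [this]
      have : 0 < κ * t + 1 / κ := by positivity
      linarith
    exact h4.trans (by gcongr)
  calc exp (-(κ * t)) * t ^ (1 / 2 : ℝ) ≤ exp (-(κ * t)) * ((1 + 1 / κ) * exp (κ * t)) := by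
        gcongr; exact h1.trans h2
    _ = (1 + 1 / κ) * (exp (-(κ * t)) * exp (κ * t)) := by ring
    _ = 1 + 1 / κ := by rw [← exp_add]; simp

open Set Real in
theorem integrableOn_heatInt {κ m s : ℝ} (hκ : 0 < κ) (hm : 1 / 2 < m) (hs : 0 < s) :
    IntegrableOn (fun t => exp (-(κ * t)) * (t ^ (-m) * exp (-(s / (4 * t))))) (Ioi 0) := by
  have h := (integrableOn_rpow_neg_mul_exp_neg_div (m := m + 1 / 2) (by linarith) hs).1
  refine (h.const_mul (1 + 1 / κ)).mono' (by fun_prop) ?_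
  filter_upwards [ae_restrict_mem measurableSet_Ioi] with t ht
  rw [mem_Ioi] at ht
  rw [norm_of_nonneg (by positivity)]
  have e : t ^ (-m) = t ^ (1 / 2 : ℝ) * t ^ (-(m + 1 / 2)) := by
    rw [← rpow_add ht]; congr 1; ring
  rw [e]
  calc _ = (exp (-(κ * t)) * t ^ (1 / 2 : ℝ)) * (t ^ (-(m + 1 / 2)) * exp (-(s / (4 * t)))) := by
        ring
    _ ≤ _ := by gcongr; exact exp_neg_mul_rpow_half_le hκ ht

open Set Real in
-- Differentiation in s = |x|² stays within the family, so every derivative of the Green functions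
-- is again such an integral. On (s / 2, ∞) the integrand at s / 2 is a majorant.
theorem hasDerivAt_heatInt {κ m s : ℝ} (hκ : 0 < κ) (hm : 1 / 2 < m) (hs : 0 < s) :
    HasDerivAt (heatInt κ m) (-(1 / 4) * heatInt κ (m + 1) s) s := by
  have hb := ((integrableOn_heatInt hκ (m := m + 1) (by linarith)
    (half_pos hs)).const_mul (1 / 4))
  have h := (hasDerivAt_integral_of_dominated_loc_of_deriv_le (μ := volume.restrict (Ioi 0))
    (F := fun s t => exp (-(κ * t)) * (t ^ (-m) * exp (-(s / (4 * t)))))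
    (F' := fun s t => -(1 / 4) * (exp (-(κ * t)) * (t ^ (-(m + 1)) * exp (-(s / (4 * t))))))
    (s := Ioi (s / 2)) (Ioi_mem_nhds (by linarith))
    (Eventually.of_forall fun s => by fun_prop) (integrableOn_heatInt hκ hm hs)
    (by fun_prop) ?_ hb ?_).2
  · rw [integral_const_mul] at h
    exact h
  · filter_upwards [ae_restrict_mem measurableSet_Ioi] with t ht x hx
    rw [mem_Ioi] at ht hx
    rw [norm_mul, norm_neg, norm_of_nonneg (by norm_num : (0 : ℝ) ≤ 1 / 4),
      norm_of_nonneg (by positivity)]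
    gcongr
  · filter_upwards [ae_restrict_mem measurableSet_Ioi] with t ht x hx
    rw [mem_Ioi] at ht
    have h1 : HasDerivAt (fun s : ℝ => exp (-(s / (4 * t))))
        (exp (-(x / (4 * t))) * (-(1 / (4 * t)))) x :=
      (((hasDerivAt_id x).div_const (4 * t)).neg).exp
    refine ((h1.const_mul (t ^ (-m))).const_mul (exp (-(κ * t)))).congr_deriv ?_
    rw [neg_add, rpow_add ht, rpow_neg_one]
    field_simp

open Set Real in
/-- The substitution `t = c exp τ` in `heatInt`. -/
theorem heatInt_comp_exp {κ m r : ℝ} (hκ : 0 < κ) (hm : 1 / 2 < m) (hr : 0 < r) :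
    Integrable (fun τ : ℝ => (r / (2 * √κ)) ^ (1 - m) *
      (exp ((1 - m) * τ) * exp (-(√κ * r * cosh τ)))) ∧
    heatInt κ m (r ^ 2) = ∫ τ : ℝ, (r / (2 * √κ)) ^ (1 - m) *
      (exp ((1 - m) * τ) * exp (-(√κ * r * cosh τ))) := by
  have hk : 0 < √κ := sqrt_pos.2 hκ
  -- At t = c the exponents κt and r² / (4t) are equal, so in the variable τ their sum is √κ r cosh
  -- τ.
  set c := r / (2 * √κ) with hc
  have hc0 : 0 < c := by positivity
  have himg : (fun τ : ℝ => c * exp τ) '' univ = Ioi 0 := by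
    ext t
    constructor
    · rintro ⟨τ, -, rfl⟩; exact mul_pos hc0 (exp_pos _)
    · intro ht
      rw [mem_Ioi] at ht
      exact ⟨log (t / c), mem_univ _, by
        simp only; rw [exp_log (by positivity)]; field_simp⟩
  have hinj : InjOn (fun τ : ℝ => c * exp τ) univ := fun x _ y _ h =>
    exp_injective (mul_left_cancel₀ hc0.ne' h)
  have hder : ∀ τ ∈ (univ : Set ℝ), HasDerivWithinAt (fun τ : ℝ => c * exp τ) (c * exp τ) univ τ :=
    fun τ _ => ((hasDerivAt_exp τ).const_mul c).hasDerivWithinAt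
  have key : ∀ τ : ℝ, |c * exp τ| • (exp (-(κ * (c * exp τ))) * ((c * exp τ) ^ (-m) *
      exp (-(r ^ 2 / (4 * (c * exp τ)))))) =
      c ^ (1 - m) * (exp ((1 - m) * τ) * exp (-(√κ * r * cosh τ))) := by
    intro τ
    have h0 : 0 < c * exp τ := by positivity
    rw [abs_of_pos h0, smul_eq_mul]
    have e1 : (c * exp τ) * (c * exp τ) ^ (-m) = c ^ (1 - m) * exp ((1 - m) * τ) := by
      rw [mul_comm (1 - m) τ, exp_mul, ← mul_rpow hc0.le (exp_pos _).le, sub_eq_add_neg,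
        rpow_add h0, rpow_one]
    have e2 : exp (-(κ * (c * exp τ))) * exp (-(r ^ 2 / (4 * (c * exp τ)))) =
        exp (-(√κ * r * cosh τ)) := by
      rw [← exp_add, cosh_eq, exp_neg τ]
      congr 1
      have h1 : κ = √κ ^ 2 := (sq_sqrt hκ.le).symm
      have h2 := (exp_pos τ).ne'
      rw [hc]
      nth_rewrite 1 [h1]
      field_simp
      ring
    rw [← e2]
    linear_combination (exp (-(κ * (c * exp τ))) * exp (-(r ^ 2 / (4 * (c * exp τ))))) * e1
  have h1 := integrableOn_heatInt hκ hm (pow_pos hr 2)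
  rw [← himg, integrableOn_image_iff_integrableOn_abs_deriv_smul MeasurableSet.univ hder hinj,
    integrableOn_univ] at h1
  simp only [key] at h1
  refine ⟨h1, ?_⟩
  rw [heatInt, ← himg, integral_image_eq_integral_abs_deriv_smul MeasurableSet.univ hder hinj,
    setIntegral_univ]
  simp only [key]

theorem heatInt_one {κ r : ℝ} (hκ : 0 < κ) (hr : 0 < r) :
    heatInt κ 1 (r ^ 2) = ∫ τ : ℝ, Real.exp (-(√κ * r * Real.cosh τ)) := by
  rw [(heatInt_comp_exp hκ (by norm_num) hr).2]
  simp

open Set Real in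
theorem heatInt_three_half {κ r : ℝ} (hκ : 0 < κ) (hr : 0 < r) :
    heatInt κ (3 / 2) (r ^ 2) = 2 * √π * exp (-(√κ * r)) / r := by
  obtain ⟨hi, he⟩ := heatInt_comp_exp (m := 3 / 2) hκ (by norm_num) hr
  have hk : 0 < √κ := sqrt_pos.2 hκ
  set c := r / (2 * √κ) with hc
  have hc0 : 0 < c := by positivity
  set A := √κ * r with hA
  have hA0 : 0 < A := by positivity
  set q := c ^ (1 - 3 / 2 : ℝ) with hq
  let f : ℝ → ℝ := fun τ => q * (exp ((1 - 3 / 2) * τ) * exp (-(A * cosh τ)))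
  have hn : ∫ τ, f (-τ) = ∫ τ, f τ := integral_neg_eq_self f volume
  have hfi : Integrable f := hi
  -- Averaging over τ and -τ turns exp(-τ / 2) into cosh(τ / 2). This is twice the derivative of w =
  -- sinh(τ / 2), and cosh τ = 1 + 2w², so a Gaussian integral in w remains.
  have hs : ∫ τ, f τ = ∫ τ, (f τ + f (-τ)) / 2 := by
    rw [integral_div, integral_add hfi hfi.comp_neg, hn]; ring
  have hderiv : ∀ τ ∈ (univ : Set ℝ), HasDerivWithinAt (fun τ : ℝ => sinh (τ / 2))
      (cosh (τ / 2) * (1 / 2)) univ τ := fun τ _ =>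
    (((hasDerivAt_id τ).div_const 2).sinh).hasDerivWithinAt
  have himg : (fun τ : ℝ => sinh (τ / 2)) '' univ = univ := by
    rw [image_univ, range_eq_univ]
    intro w
    exact ⟨2 * arsinh w, by simp⟩
  have hinj : InjOn (fun τ : ℝ => sinh (τ / 2)) univ := fun x _ y _ h => by
    have := sinh_injective h
    linarith
  have hsub := integral_image_eq_integral_abs_deriv_smul MeasurableSet.univ hderiv hinj
    (fun w : ℝ => 2 * q * exp (-A) * exp (-(2 * A) * w ^ 2))
  rw [himg, setIntegral_univ, setIntegral_univ, integral_const_mul, integral_gaussian] at hsub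
  have hpt : ∀ τ : ℝ, |cosh (τ / 2) * (1 / 2)| • (2 * q * exp (-A) * exp (-(2 * A) *
      sinh (τ / 2) ^ 2)) = (f τ + f (-τ)) / 2 := by
    intro τ
    have h1 : cosh τ = 1 + 2 * sinh (τ / 2) ^ 2 := by
      have : τ = 2 * (τ / 2) := by ring
      conv_lhs => rw [this, cosh_two_mul, cosh_sq]
      ring
    have h2 : exp (-A) * exp (-(2 * A) * sinh (τ / 2) ^ 2) = exp (-(A * cosh τ)) := by
      rw [← exp_add, h1]; congr 1; ring
    rw [abs_of_pos (by have := cosh_pos (τ / 2); positivity), smul_eq_mul]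
    simp only [f, cosh_neg]
    rw [mul_assoc (2 * q), h2, cosh_eq (τ / 2)]
    have h3 : (1 - 3 / 2 : ℝ) * τ = -(τ / 2) := by ring
    have h4 : (1 - 3 / 2 : ℝ) * -τ = τ / 2 := by ring
    rw [h3, h4]
    ring
  simp only [hpt] at hsub
  rw [he]
  change ∫ τ, f τ = _
  rw [hs, ← hsub]
  have hq' : q = (√c)⁻¹ := by
    rw [hq, sqrt_eq_rpow, ← rpow_neg hc0.le]; norm_num
  have h5 : (√c)⁻¹ * √(π / (2 * A)) = √π / r := by
    rw [← sqrt_inv, ← sqrt_mul (by positivity), eq_div_iff hr.ne']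
    have h6 : √(c⁻¹ * (π / (2 * A))) * √(r ^ 2) = √π := by
      rw [← sqrt_mul (by positivity)]
      congr 1
      rw [hc, hA]
      field_simp
    rwa [sqrt_sq hr.le] at h6
  rw [hq']
  calc 2 * (√c)⁻¹ * exp (-A) * √(π / (2 * A)) = 2 * exp (-A) * ((√c)⁻¹ * √(π / (2 * A))) := by ring
    _ = _ := by rw [h5]; ring

/-! ### The Green tensor in terms of heat kernels -/

theorem four_pi_rpow_neg_three_half :
    (4 * Real.pi) ^ (-(3 / 2) : ℝ) = (4 * Real.pi * (2 * √Real.pi))⁻¹ := by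
  rw [Real.rpow_neg (by positivity), show (3 / 2 : ℝ) = 1 + 1 / 2 by norm_num,
    Real.rpow_add (by positivity), Real.rpow_one, ← Real.sqrt_eq_rpow,
    Real.sqrt_mul (by norm_num), show (4 : ℝ) = 2 ^ 2 by norm_num, Real.sqrt_sq (by norm_num)]

/-- The resolvent of the Laplacian at -κ is the Laplace transform of the heat semigroup. For n = 2
the substitution above produces the integral for H₀⁽¹⁾, for n = 3 the Yukawa potential. -/
theorem helmholtzGreen_neg {n : ℕ} (hn : n = 2 ∨ n = 3) {κ : ℝ} (hκ : 0 < κ) {x : Space n}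
    (hx : x ≠ 0) :
    helmholtzGreen n (-(κ : ℂ)) x =
      (((4 * Real.pi) ^ (-(n / 2 : ℝ)) * heatInt κ (n / 2) (‖x‖ ^ 2) : ℝ) : ℂ) := by
  have hr : 0 < ‖x‖ := norm_pos_iff.2 hx
  have hroot : upperRoot (-(κ : ℂ)) = Complex.I * (√κ : ℝ) := by
    rw [upperRoot, neg_neg, Real.sqrt_eq_rpow, Complex.ofReal_cpow hκ.le]
    norm_num
  have hI : Complex.I * Complex.I = -1 := Complex.I_mul_I
  rcases hn with rfl | rfl
  · have e : (((2 : ℕ) : ℝ) / 2) = 1 := by norm_num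
    rw [helmholtzGreen, if_pos rfl, hankelZero, hroot, e, heatInt_one hκ hr, Real.rpow_neg_one]
    have : ∀ t : ℝ, Complex.exp (Complex.I * (Complex.I * (√κ : ℝ) * ‖x‖) * Real.cosh t) =
        ((Real.exp (-(√κ * ‖x‖ * Real.cosh t)) : ℝ) : ℂ) := by
      intro t
      push_cast
      congr 1
      linear_combination (√κ * ‖x‖ * Complex.cosh t) * hI
    simp only [this]
    rw [integral_complex_ofReal]
    push_cast
    have hp : (Real.pi : ℂ) ≠ 0 := by exact_mod_cast Real.pi_ne_zero
    field_simp
  · have e : (((3 : ℕ) : ℝ) / 2) = 3 / 2 := by norm_num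
    rw [helmholtzGreen, if_neg (by norm_num), hroot, e, heatInt_three_half hκ hr]
    have h1 : Complex.exp (Complex.I * (Complex.I * (√κ : ℝ)) * ‖x‖) =
        ((Real.exp (-(√κ * ‖x‖)) : ℝ) : ℂ) := by
      push_cast
      congr 1
      linear_combination (√κ * ‖x‖ : ℂ) * hI
    rw [h1, four_pi_rpow_neg_three_half]
    norm_cast
    have hp : 0 < √Real.pi := Real.sqrt_pos.2 Real.pi_pos
    field_simp

theorem secondPartial_radial {n : ℕ} {F F' F'' : ℝ → ℝ}
    (hF : ∀ s, 0 < s → HasDerivAt F (F' s) s) (hF' : ∀ s, 0 < s → HasDerivAt F' (F'' s) s)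
    {g : Space n → ℂ} (hg : ∀ y, y ≠ 0 → g y = F (‖y‖ ^ 2)) (j l : Fin n) {x : Space n}
    (hx : x ≠ 0) :
    secondPartial j l g x = ((2 * F' (‖x‖ ^ 2) * (if j = l then 1 else 0)
      + 4 * F'' (‖x‖ ^ 2) * (x j * x l) : ℝ) : ℂ) := by
  have hs : ∀ y : Space n, HasFDerivAt (fun y : Space n => ‖y‖ ^ 2) (2 • innerSL ℝ y) y :=
    fun y => (hasStrictFDerivAt_norm_sq y).hasFDerivAt
  have hpos : ∀ y : Space n, y ≠ 0 → 0 < ‖y‖ ^ 2 := fun y hy => by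
    have := norm_pos_iff.2 hy; positivity
  have hcomp : ∀ (H : ℝ → ℝ) (H' : ℝ) (y : Space n), HasDerivAt H H' (‖y‖ ^ 2) →
      HasFDerivAt (fun y : Space n => H (‖y‖ ^ 2)) (H' • (2 • innerSL ℝ y)) y :=
    fun H H' y h => h.comp_hasFDerivAt y (hs y)
  have hof : ∀ (H : Space n → ℝ) (H' : Space n →L[ℝ] ℝ) (y : Space n), HasFDerivAt H H' y →
      HasFDerivAt (fun y => (H y : ℂ)) (Complex.ofRealCLM ∘L H') y :=
    fun H H' y h => Complex.ofRealCLM.hasFDerivAt.comp y h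
  have hev : ∀ y : Space n, y ≠ 0 → ∀ᶠ w in 𝓝 y, w ≠ 0 := fun y hy => isOpen_ne.mem_nhds hy
  have h1 : ∀ y : Space n, y ≠ 0 → fderiv ℝ g y (EuclideanSpace.single l 1) =
      ((2 * F' (‖y‖ ^ 2) * y l : ℝ) : ℂ) := by
    intro y hy
    have e : g =ᶠ[𝓝 y] fun y => ((F (‖y‖ ^ 2) : ℝ) : ℂ) := (hev y hy).mono fun w hw => hg w hw
    rw [e.fderiv_eq, (hof _ _ y (hcomp F _ y (hF _ (hpos y hy)))).fderiv]
    simp [EuclideanSpace.inner_single_right]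
    ring
  have e2 : (fun y => fderiv ℝ g y (EuclideanSpace.single l 1)) =ᶠ[𝓝 x]
      fun y => ((2 * F' (‖y‖ ^ 2) * y l : ℝ) : ℂ) := (hev x hx).mono fun w hw => h1 w hw
  have hl : HasFDerivAt (fun y : Space n => y l) (EuclideanSpace.proj l : Space n →L[ℝ] ℝ) x :=
    (EuclideanSpace.proj l : Space n →L[ℝ] ℝ).hasFDerivAt
  have h2 := ((hcomp F' _ x (hF' _ (hpos x hx))).const_mul 2).mul hl
  have h3 := (hof _ _ x h2).fderiv
  simp only [Pi.mul_apply] at h3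
  rw [secondPartial, e2.fderiv_eq, h3]
  simp [EuclideanSpace.inner_single_right, eq_comm (a := l)]
  split_ifs <;> push_cast <;> ring

/-- The coefficient of the identity in the Green tensor at `z = -1`, with `s = |x|²`, `a = 1 / μ`
and `b = 1 / (λ + 2 μ)`. -/
def greenDiag (n : ℕ) (a b s : ℝ) : ℝ :=
  (4 * Real.pi) ^ (-(n / 2 : ℝ)) * (a * heatInt a (n / 2) s
    + 1 / 2 * (heatInt a (n / 2 + 1) s - heatInt b (n / 2 + 1) s))

/-- The coefficient of `x xᵀ` in the Green tensor at `z = -1`. -/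
def greenDyad (n : ℕ) (a b s : ℝ) : ℝ :=
  -((4 * Real.pi) ^ (-(n / 2 : ℝ)) / 4 *
    (heatInt a (n / 2 + 1 + 1) s - heatInt b (n / 2 + 1 + 1) s))

theorem hasDerivAt_const_mul_heatInt_sub {a b m c s : ℝ} (ha : 0 < a) (hb : 0 < b)
    (hm : 1 / 2 < m) (hs : 0 < s) :
    HasDerivAt (fun s => c * (heatInt a m s - heatInt b m s))
      (-(c / 4) * (heatInt a (m + 1) s - heatInt b (m + 1) s)) s := by
  refine (((hasDerivAt_heatInt ha hm hs).sub (hasDerivAt_heatInt hb hm hs)).const_mul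
    c).congr_deriv ?_
  ring

/-- At z = -1 the two Helmholtz energies are -a and -b. The factor 1 / z = -1 cancels the sign of
the first derivative in s. -/
theorem lameGreen_neg_one {n : ℕ} (hn : n = 2 ∨ n = 3) {lam mu : ℝ} (hmu : 0 < mu)
    (hlm : 0 < lam + mu) {x : Space n} (hx : x ≠ 0) (j l : Fin n) :
    lameGreen n lam mu (-1) x j l =
      ((greenDiag n (1 / mu) (1 / (lam + 2 * mu)) (‖x‖ ^ 2) * (if j = l then 1 else 0)
        + greenDyad n (1 / mu) (1 / (lam + 2 * mu)) (‖x‖ ^ 2) * (x j * x l) : ℝ) : ℂ) := by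
  set a := 1 / mu with ha
  set b := 1 / (lam + 2 * mu) with hb
  have hlm2 : 0 < lam + 2 * mu := by linarith
  have ha0 : 0 < a := by positivity
  have hb0 : 0 < b := by positivity
  have hm : (1 / 2 : ℝ) < n / 2 := by rcases hn with rfl | rfl <;> norm_num
  have e1 : (-1 / mu : ℂ) = -((a : ℝ) : ℂ) := by rw [ha]; push_cast; ring
  have e2 : (-1 / (lam + 2 * mu) : ℂ) = -((b : ℝ) : ℂ) := by rw [hb]; push_cast; ring
  set c := (4 * Real.pi) ^ (-(n / 2 : ℝ)) with hc
  have h := secondPartial_radial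
    (F := fun s => c * (heatInt a (n / 2) s - heatInt b (n / 2) s))
    (F' := fun s => -(c / 4) * (heatInt a (n / 2 + 1) s - heatInt b (n / 2 + 1) s))
    (fun s hs => hasDerivAt_const_mul_heatInt_sub ha0 hb0 hm hs)
    (fun s hs => hasDerivAt_const_mul_heatInt_sub ha0 hb0 (by linarith) hs)
    (g := fun y => helmholtzGreen n (-(a : ℂ)) y - helmholtzGreen n (-(b : ℂ)) y)
    (fun y hy => by
      rw [helmholtzGreen_neg hn ha0 hy, helmholtzGreen_neg hn hb0 hy]; push_cast; ring) j l hx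
  rw [lameGreen, Matrix.of_apply, e1, e2, h, helmholtzGreen_neg hn ha0 hx, greenDiag, greenDyad,
    Matrix.one_apply, ← hc]
  have e3 : (1 / mu : ℂ) = (a : ℝ) := by rw [ha]; push_cast; ring
  rw [e3]
  split_ifs <;> push_cast <;> ring

theorem continuousAt_heatInt {κ m s : ℝ} (hκ : 0 < κ) (hm : 1 / 2 < m) (hs : 0 < s) :
    ContinuousAt (heatInt κ m) s := (hasDerivAt_heatInt hκ hm hs).continuousAt

theorem continuousAt_lameGreen_neg_one {n : ℕ} (hn : n = 2 ∨ n = 3) {lam mu : ℝ} (hmu : 0 < mu)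
    (hlm : 0 < lam + mu) {x : Space n} (hx : x ≠ 0) (j l : Fin n) :
    ContinuousAt (fun x => lameGreen n lam mu (-1) x j l) x := by
  have hs : 0 < ‖x‖ ^ 2 := by have := norm_pos_iff.2 hx; positivity
  have hlm2 : 0 < lam + 2 * mu := by linarith
  have hm : (1 / 2 : ℝ) < n / 2 := by rcases hn with rfl | rfl <;> norm_num
  have h : ∀ (κ m : ℝ), 0 < κ → 1 / 2 < m →
      ContinuousAt (fun x : Space n => heatInt κ m (‖x‖ ^ 2)) x := fun κ m hκ hm' =>
    (continuousAt_heatInt hκ hm' hs).comp (f := fun x : Space n => ‖x‖ ^ 2) (by fun_prop)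
  have h1 := h (1 / mu) (n / 2) (by positivity) hm
  have h2 := h (1 / mu) (n / 2 + 1) (by positivity) (by linarith)
  have h3 := h (1 / (lam + 2 * mu)) (n / 2 + 1) (by positivity) (by linarith)
  have h4 := h (1 / mu) (n / 2 + 1 + 1) (by positivity) (by linarith)
  have h5 := h (1 / (lam + 2 * mu)) (n / 2 + 1 + 1) (by positivity) (by linarith)
  have hev : ∀ᶠ y in 𝓝 x, y ≠ 0 := isOpen_ne.mem_nhds hx
  have e : (fun x => lameGreen n lam mu (-1) x j l) =ᶠ[𝓝 x] _ :=
    hev.mono fun y hy => lameGreen_neg_one hn hmu hlm hy j l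
  refine ContinuousAt.congr ?_ e.symm
  refine Complex.continuous_ofReal.continuousAt.comp ?_
  simp only [greenDiag, greenDyad]
  fun_prop

/-! ### Second moments of oscillating Gaussians -/

/-- The Gaussian `exp (-β |v|²)` times the character `exp (-2 π i ⟨v, ξ⟩)`. -/
def oscGauss {n : ℕ} (β : ℝ) (ξ v : Space n) : ℂ :=
  Complex.exp (-(β : ℂ) * ‖v‖ ^ 2 + -(2 * Real.pi * Complex.I) * ⟪ξ, v⟫_ℝ)

theorem norm_oscGauss {n : ℕ} (β : ℝ) (ξ v : Space n) :
    ‖oscGauss β ξ v‖ = Real.exp (-(β * ‖v‖ ^ 2)) := by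
  rw [oscGauss, Complex.norm_exp]
  congr 1
  simp [← Complex.ofReal_pow]

theorem continuous_oscGauss {n : ℕ} (β : ℝ) (ξ : Space n) : Continuous (oscGauss β ξ) := by
  unfold oscGauss
  fun_prop

theorem integrable_exp_neg_mul_norm_sq {n : ℕ} {β : ℝ} (hβ : 0 < β) :
    Integrable (fun v : Space n => Real.exp (-(β * ‖v‖ ^ 2))) := by
  have h := (GaussianFourier.integrable_cexp_neg_mul_sq_norm_add (b := β) (by simpa using hβ) 0
    (0 : Space n)).norm
  refine h.congr (ae_of_all _ fun v => ?_)
  simp only [Complex.norm_exp]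
  congr 1
  simp [← Complex.ofReal_pow]

theorem integral_exp_neg_mul_norm_sq {n : ℕ} {β : ℝ} (hβ : 0 < β) :
    ∫ v : Space n, Real.exp (-(β * ‖v‖ ^ 2)) = (Real.pi / β) ^ (n / 2 : ℝ) := by
  have h := GaussianFourier.integral_rexp_neg_mul_sq_norm (V := Space n) hβ
  simpa using h

theorem one_add_mul_exp_neg_le (s : ℝ) :
    (1 + s) * Real.exp (-s) ≤ 2 * Real.exp (-(s / 2)) := by
  have h1 := Real.add_one_le_exp (s / 2)
  have h2 : 1 + s ≤ 2 * Real.exp (s / 2) := by linarith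
  calc _ ≤ 2 * Real.exp (s / 2) * Real.exp (-s) := by gcongr
    _ = _ := by rw [mul_assoc, ← Real.exp_add]; congr 2; ring

/-- Half of the Gaussian exponent absorbs the quadratic growth of P. -/
theorem integrable_mul_oscGauss {n : ℕ} {β : ℝ} (hβ : 0 < β) (ξ : Space n) {P : Space n → ℂ}
    (hP : Continuous P) {C : ℝ} (hb : ∀ v, ‖P v‖ ≤ C * (1 + β * ‖v‖ ^ 2)) :
    Integrable (fun v => P v * oscGauss β ξ v) := by
  refine ((integrable_exp_neg_mul_norm_sq (n := n) (half_pos hβ)).const_mul (C * 2)).mono'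
    (hP.mul (continuous_oscGauss β ξ)).aestronglyMeasurable (ae_of_all _ fun v => ?_)
  have hC : 0 ≤ C := by
    have := (norm_nonneg _).trans (hb 0)
    simpa using this
  have h := one_add_mul_exp_neg_le (β * ‖v‖ ^ 2)
  rw [norm_mul, norm_oscGauss]
  calc _ ≤ C * (1 + β * ‖v‖ ^ 2) * Real.exp (-(β * ‖v‖ ^ 2)) := by gcongr; exact hb v
    _ ≤ C * (2 * Real.exp (-(β * ‖v‖ ^ 2 / 2))) := by rw [mul_assoc]; gcongr
    _ = _ := by rw [mul_assoc]; congr 4; ring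

theorem integral_fderiv_apply_eq_zero {n : ℕ} {g : Space n → ℂ} (hg : Integrable g)
    (hd : Differentiable ℝ g) (w : Space n) (hi : Integrable fun x => fderiv ℝ g x w) :
    ∫ x, fderiv ℝ g x w = 0 := by
  have h := integral_mul_fderiv_eq_neg_fderiv_mul_of_integrable (μ := volume) (𝕜 := ℂ)
    (f := fun _ : Space n => (1 : ℂ)) (g := g) (v := w) (by simp) (by simpa using hi)
    (by simpa using hg) (fun x _ => differentiableAt_const _) (fun x _ => hd x)
  simpa using h

theorem hasFDerivAt_oscGauss {n : ℕ} (β : ℝ) (ξ v : Space n) :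
    HasFDerivAt (oscGauss β ξ) (oscGauss β ξ v •
      ((-(β : ℂ)) • (Complex.ofRealCLM ∘L (2 • innerSL ℝ v)) +
      (-(2 * Real.pi * Complex.I)) • (Complex.ofRealCLM ∘L innerSL ℝ ξ))) v := by
  have h1 : HasFDerivAt (fun y : Space n => ((‖y‖ ^ 2 : ℝ) : ℂ))
      (Complex.ofRealCLM ∘L (2 • innerSL ℝ v)) v :=
    Complex.ofRealCLM.hasFDerivAt.comp v (hasStrictFDerivAt_norm_sq v).hasFDerivAt
  have h2 : HasFDerivAt (fun y : Space n => ((⟪ξ, y⟫_ℝ : ℝ) : ℂ))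
      (Complex.ofRealCLM ∘L innerSL ℝ ξ) v :=
    (Complex.ofRealCLM ∘L innerSL ℝ ξ).hasFDerivAt
  have h := ((h1.const_mul (-(β : ℂ))).add (h2.const_mul (-(2 * Real.pi * Complex.I)))).cexp
  have e : oscGauss β ξ = fun x => Complex.exp (-(β : ℂ) * ((‖x‖ ^ 2 : ℝ) : ℂ) +
      -(2 * Real.pi * Complex.I) * ((⟪ξ, x⟫_ℝ : ℝ) : ℂ)) := by
    ext y; simp [oscGauss]
  rw [e]
  exact h

theorem fderiv_oscGauss {n : ℕ} (β : ℝ) (ξ v : Space n) (j : Fin n) :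
    fderiv ℝ (oscGauss β ξ) v (EuclideanSpace.single j 1) =
      (-(2 * β) * v j - 2 * Real.pi * Complex.I * ξ j) * oscGauss β ξ v := by
  rw [(hasFDerivAt_oscGauss β ξ v).fderiv]
  simp [EuclideanSpace.inner_single_right]
  ring

theorem abs_coord_le {n : ℕ} (v : Space n) (j : Fin n) : |v j| ≤ ‖v‖ := by
  simpa using PiLp.norm_apply_le v j

theorem integrable_oscGauss {n : ℕ} {β : ℝ} (hβ : 0 < β) (ξ : Space n) :
    Integrable (oscGauss β ξ) := by
  simpa using integrable_mul_oscGauss hβ ξ (P := fun _ => 1) continuous_const (C := 1)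
    (fun v => by simp; positivity)

theorem integrable_coord_mul_oscGauss {n : ℕ} {β : ℝ} (hβ : 0 < β) (ξ : Space n) (j : Fin n) :
    Integrable (fun v : Space n => (v j : ℂ) * oscGauss β ξ v) := by
  refine integrable_mul_oscGauss hβ ξ (P := fun v => (v j : ℂ)) (by fun_prop) (C := 1 + 1 / β)
    (fun v => ?_)
  rw [Complex.norm_real, Real.norm_eq_abs]
  have h := abs_coord_le v j
  have e : (1 + 1 / β) * (1 + β * ‖v‖ ^ 2) = 1 + β * ‖v‖ ^ 2 + 1 / β + ‖v‖ ^ 2 := by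
    field_simp; ring
  have : 0 < β * ‖v‖ ^ 2 + 1 / β := by positivity
  rw [e]
  nlinarith

theorem integrable_coord_mul_coord_mul_oscGauss {n : ℕ} {β : ℝ} (hβ : 0 < β) (ξ : Space n)
    (j l : Fin n) : Integrable (fun v : Space n => (v j * v l : ℂ) * oscGauss β ξ v) := by
  refine integrable_mul_oscGauss hβ ξ (P := fun v => (v j * v l : ℂ)) (by fun_prop) (C := 1 / β)
    (fun v => ?_)
  rw [norm_mul, Complex.norm_real, Complex.norm_real, Real.norm_eq_abs, Real.norm_eq_abs]
  have h := mul_le_mul (abs_coord_le v j) (abs_coord_le v l) (abs_nonneg _) (norm_nonneg _)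
  have e : 1 / β * (1 + β * ‖v‖ ^ 2) = 1 / β + ‖v‖ ^ 2 := by field_simp
  have : 0 < 1 / β := by positivity
  rw [e]
  nlinarith

theorem integral_oscGauss {n : ℕ} {β : ℝ} (hβ : 0 < β) (ξ : Space n) :
    ∫ v, oscGauss β ξ v =
      (((Real.pi / β) ^ (n / 2 : ℝ) * Real.exp (-(Real.pi ^ 2 * ‖ξ‖ ^ 2 / β)) : ℝ) : ℂ) := by
  have h := GaussianFourier.integral_cexp_neg_mul_sq_norm_add (b := β) (by simpa using hβ)
    (-(2 * Real.pi * Complex.I)) ξ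
  refine h.trans ?_
  rw [Complex.ofReal_mul, Complex.ofReal_cpow (by positivity), Complex.ofReal_exp]
  have hβ' : (β : ℂ) ≠ 0 := by exact_mod_cast hβ.ne'
  congr 1
  · simp
  · congr 1
    push_cast
    have hI := Complex.I_sq
    field_simp
    linear_combination (4 * (‖ξ‖ : ℂ) ^ 2) * hI

theorem integral_coord_mul_oscGauss {n : ℕ} {β : ℝ} (hβ : 0 < β) (ξ : Space n) (j : Fin n) :
    2 * β * ∫ v, (v j : ℂ) * oscGauss β ξ v =
      -(2 * Real.pi * Complex.I * ξ j) * ∫ v, oscGauss β ξ v := by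
  have h1 := (integrable_coord_mul_oscGauss hβ ξ j).const_mul (-(2 * β) : ℂ)
  have h2 := (integrable_oscGauss hβ ξ).const_mul (2 * Real.pi * Complex.I * ξ j)
  have e : ∀ v, fderiv ℝ (oscGauss β ξ) v (EuclideanSpace.single j 1) =
      -(2 * β) * ((v j : ℂ) * oscGauss β ξ v) -
        2 * Real.pi * Complex.I * ξ j * oscGauss β ξ v := fun v => by
    rw [fderiv_oscGauss]; ring
  have h := integral_fderiv_apply_eq_zero (integrable_oscGauss hβ ξ)
    (fun v => (hasFDerivAt_oscGauss β ξ v).differentiableAt) (EuclideanSpace.single j 1)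
    (by simp only [e]; exact h1.sub h2)
  simp only [e] at h
  rw [integral_sub h1 h2, integral_const_mul, integral_const_mul] at h
  linear_combination -h

/-- The Fourier transform of the second derivatives of a Gaussian. -/
theorem integral_coord_mul_coord_mul_oscGauss {n : ℕ} {β : ℝ} (hβ : 0 < β) (ξ : Space n)
    (j l : Fin n) :
    4 * β ^ 2 * (∫ v, (v j * v l : ℂ) * oscGauss β ξ v) -
        2 * β * (if j = l then 1 else 0) * ∫ v, oscGauss β ξ v =
      -(4 * Real.pi ^ 2 * ξ j * ξ l) * ∫ v, oscGauss β ξ v := by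
  have h0 := (integrable_oscGauss hβ ξ).const_mul (if j = l then 1 else 0 : ℂ)
  have h1 := (integrable_coord_mul_coord_mul_oscGauss hβ ξ j l).const_mul (-(2 * β) : ℂ)
  have h2 := (integrable_coord_mul_oscGauss hβ ξ l).const_mul (2 * Real.pi * Complex.I * ξ j)
  have hl : ∀ v : Space n, HasFDerivAt (fun v : Space n => ((v l : ℝ) : ℂ))
      (Complex.ofRealCLM ∘L (EuclideanSpace.proj l : Space n →L[ℝ] ℝ)) v := fun v =>
    (Complex.ofRealCLM ∘L (EuclideanSpace.proj l : Space n →L[ℝ] ℝ)).hasFDerivAt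
  have hd : ∀ v : Space n, HasFDerivAt (fun v : Space n => ((v l : ℝ) : ℂ) * oscGauss β ξ v) _ v :=
    fun v => (hl v).mul (hasFDerivAt_oscGauss β ξ v)
  have e : ∀ v, fderiv ℝ (fun v : Space n => ((v l : ℝ) : ℂ) * oscGauss β ξ v) v
      (EuclideanSpace.single j 1) =
      (if j = l then 1 else 0) * oscGauss β ξ v + (-(2 * β) * ((v j * v l : ℂ) * oscGauss β ξ v) -
        2 * Real.pi * Complex.I * ξ j * ((v l : ℂ) * oscGauss β ξ v)) := fun v => by
    rw [(hd v).fderiv, _root_.add_apply, _root_.smul_apply,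
      ← (hasFDerivAt_oscGauss β ξ v).fderiv, fderiv_oscGauss]
    simp [eq_comm (a := l)]
    split_ifs <;> simp <;> ring
  -- Integrating ∂_j of v_l times the oscillating Gaussian expresses the second moment through the
  -- first one, which is known from `integral_coord_mul_oscGauss`.
  have h := integral_fderiv_apply_eq_zero (integrable_coord_mul_oscGauss hβ ξ l)
    (fun v => (hd v).differentiableAt) (EuclideanSpace.single j 1)
    (by simp only [e]; exact h0.add (h1.sub h2))
  simp only [e] at h
  have h12 : Integrable fun v : Space n => -(2 * β) * ((v j * v l : ℂ) * oscGauss β ξ v) -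
      2 * Real.pi * Complex.I * ξ j * ((v l : ℂ) * oscGauss β ξ v) := h1.sub h2
  rw [integral_add h0 h12, integral_sub h1 h2, integral_const_mul, integral_const_mul,
    integral_const_mul] at h
  have h3 := integral_coord_mul_oscGauss hβ ξ l
  linear_combination (-(2 * β) : ℂ) * h - (2 * Real.pi * Complex.I * ξ j) * h3 +
    (4 * (Real.pi : ℂ) ^ 2 * ξ j * ξ l * ∫ v, oscGauss β ξ v) * Complex.I_sq

/-! ### The Fourier transform of the Green tensor -/

/-- The integrand over time of the entries of the Green tensor at `z = -1`. -/
def greenKernel {n : ℕ} (a b : ℝ) (j l : Fin n) (t : ℝ) (x : Space n) : ℝ :=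
  (4 * Real.pi) ^ (-(n / 2 : ℝ)) *
    ((a * Real.exp (-(a * t)) * (if j = l then 1 else 0)
      + 1 / 2 * (if j = l then 1 else 0) * ((Real.exp (-(a * t)) - Real.exp (-(b * t))) / t)
      - 1 / 4 * (x j * x l) * ((Real.exp (-(a * t)) - Real.exp (-(b * t))) / t ^ 2)) *
    (t ^ (-(n / 2 : ℝ)) * Real.exp (-(‖x‖ ^ 2 / (4 * t)))))

/-- The entries of the Green tensor at `z = -1`. -/
def greenEntry {n : ℕ} (a b : ℝ) (j l : Fin n) (x : Space n) : ℝ :=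
  greenDiag n a b (‖x‖ ^ 2) * (if j = l then 1 else 0) + greenDyad n a b (‖x‖ ^ 2) * (x j * x l)

open Set in
theorem integral_greenKernel {n : ℕ} (hn : 1 < n) {a b : ℝ} (ha : 0 < a) (hb : 0 < b)
    (j l : Fin n) {x : Space n} (hx : x ≠ 0) :
    ∫ t in Ioi (0 : ℝ), greenKernel a b j l t x = greenEntry a b j l x := by
  have hs : 0 < ‖x‖ ^ 2 := by have := norm_pos_iff.2 hx; positivity
  have hn' : (1 : ℝ) < n := by exact_mod_cast hn
  have hm : (1 / 2 : ℝ) < n / 2 := by linarith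
  set m : ℝ := n / 2 with hmdef
  set s := ‖x‖ ^ 2 with hsdef
  set c := (4 * Real.pi) ^ (-m) with hc
  set δ : ℝ := if j = l then 1 else 0 with hδ
  have i0 := (integrableOn_heatInt ha hm hs).const_mul (c * a * δ)
  have i1 := ((integrableOn_heatInt ha (m := m + 1) (by linarith) hs).sub
    (integrableOn_heatInt hb (m := m + 1) (by linarith) hs)).const_mul (c * (1 / 2) * δ)
  have i2 := ((integrableOn_heatInt ha (m := m + 1 + 1) (by linarith) hs).sub
    (integrableOn_heatInt hb (m := m + 1 + 1) (by linarith) hs)).const_mul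
    (-(c * (1 / 4) * (x j * x l)))
  have e : ∫ t in Ioi (0 : ℝ), greenKernel a b j l t x = ∫ t in Ioi (0 : ℝ),
      (c * a * δ * (Real.exp (-(a * t)) * (t ^ (-m) * Real.exp (-(s / (4 * t))))) +
      c * (1 / 2) * δ * (Real.exp (-(a * t)) * (t ^ (-(m + 1)) * Real.exp (-(s / (4 * t)))) -
        Real.exp (-(b * t)) * (t ^ (-(m + 1)) * Real.exp (-(s / (4 * t))))) +
      -(c * (1 / 4) * (x j * x l)) *
        (Real.exp (-(a * t)) * (t ^ (-(m + 1 + 1)) * Real.exp (-(s / (4 * t)))) -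
        Real.exp (-(b * t)) * (t ^ (-(m + 1 + 1)) * Real.exp (-(s / (4 * t)))))) := by
    refine setIntegral_congr_fun measurableSet_Ioi fun t ht => ?_
    rw [mem_Ioi] at ht
    have h1 : t ^ (-(m + 1)) = t ^ (-m) / t := by
      rw [neg_add, Real.rpow_add ht, Real.rpow_neg_one, div_eq_mul_inv]
    have h2 : t ^ (-(m + 1 + 1)) = t ^ (-m) / t ^ 2 := by
      rw [neg_add, Real.rpow_add ht, Real.rpow_neg_one, h1]
      field_simp
    simp only [greenKernel, ← hmdef, ← hsdef, ← hc, ← hδ, h1, h2]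
    field_simp
    ring
  have i1' : IntegrableOn (fun t =>
      c * (1 / 2) * δ * (Real.exp (-(a * t)) * (t ^ (-(m + 1)) * Real.exp (-(s / (4 * t)))) -
        Real.exp (-(b * t)) * (t ^ (-(m + 1)) * Real.exp (-(s / (4 * t)))))) (Ioi 0) := i1
  have i2' : IntegrableOn (fun t => -(c * (1 / 4) * (x j * x l)) *
        (Real.exp (-(a * t)) * (t ^ (-(m + 1 + 1)) * Real.exp (-(s / (4 * t)))) -
        Real.exp (-(b * t)) * (t ^ (-(m + 1 + 1)) * Real.exp (-(s / (4 * t)))))) (Ioi 0) := i2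
  have i01 : IntegrableOn (fun t =>
      c * a * δ * (Real.exp (-(a * t)) * (t ^ (-m) * Real.exp (-(s / (4 * t))))) +
      c * (1 / 2) * δ * (Real.exp (-(a * t)) * (t ^ (-(m + 1)) * Real.exp (-(s / (4 * t)))) -
        Real.exp (-(b * t)) * (t ^ (-(m + 1)) * Real.exp (-(s / (4 * t)))))) (Ioi 0) := i0.add i1'
  rw [e, integral_add i01 i2', integral_add i0 i1', integral_const_mul,
    integral_const_mul, integral_const_mul,
    integral_sub (integrableOn_heatInt ha (by linarith) hs)
      (integrableOn_heatInt hb (by linarith) hs),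
    integral_sub (integrableOn_heatInt ha (by linarith) hs)
      (integrableOn_heatInt hb (by linarith) hs)]
  simp only [greenEntry, greenDiag, greenDyad, heatInt, ← hmdef, ← hsdef, ← hc, ← hδ]
  ring

theorem abs_exp_sub_exp_le {a b t : ℝ} (hab : b ≤ a) (ht : 0 ≤ t) :
    |Real.exp (-(a * t)) - Real.exp (-(b * t))| ≤ (a - b) * t * Real.exp (-(b * t)) := by
  have h1 : Real.exp (-(a * t)) ≤ Real.exp (-(b * t)) := Real.exp_le_exp.2 (by nlinarith)
  have h2 : Real.exp (-(a * t)) = Real.exp (-(b * t)) * Real.exp (-((a - b) * t)) := by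
    rw [← Real.exp_add]; congr 1; ring
  have h3 := Real.add_one_le_exp (-((a - b) * t))
  rw [abs_of_nonpos (by linarith), h2]
  nlinarith [Real.exp_pos (-(b * t))]

/-- The difference of exponentials is O(t), which removes one power of 1 / t. The remaining |x|² / t
is absorbed by half of the Gaussian exponent, hence 1 / (8t) in place of 1 / (4t). Without this
cancellation the kernel would not be integrable in time and space together. -/
theorem abs_greenKernel_le {n : ℕ} {a b : ℝ} (hb : 0 < b) (hab : b ≤ a) (j l : Fin n) {t : ℝ}
    (ht : 0 < t) (x : Space n) :
    |greenKernel a b j l t x| ≤ (4 * Real.pi) ^ (-(n / 2 : ℝ)) * (4 * a) *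
      (Real.exp (-(b * t)) * (t ^ (-(n / 2 : ℝ)) * Real.exp (-(1 / (8 * t) * ‖x‖ ^ 2)))) := by
  have hE := abs_exp_sub_exp_le hab ht.le
  set E := Real.exp (-(a * t)) - Real.exp (-(b * t)) with hEdef
  set B := Real.exp (-(b * t)) with hB
  set δ : ℝ := if j = l then 1 else 0 with hδ
  have hB0 : 0 < B := Real.exp_pos _
  have hδ1 : |δ| ≤ 1 := by rw [hδ]; split_ifs <;> simp
  have hA : Real.exp (-(a * t)) ≤ B := Real.exp_le_exp.2 (by nlinarith)
  have hE' : |E| ≤ a * t * B := hE.trans (by gcongr; linarith)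
  have hx : |x j * x l| ≤ ‖x‖ ^ 2 := by
    rw [abs_mul, sq]
    exact mul_le_mul (abs_coord_le x j) (abs_coord_le x l) (abs_nonneg _) (norm_nonneg _)
  have ha : 0 < a := hb.trans_le hab
  have h1 : |a * Real.exp (-(a * t)) * δ| ≤ a * B := by
    rw [abs_mul, abs_mul, abs_of_pos ha, Real.abs_exp]
    calc _ ≤ a * B * 1 := by gcongr
      _ = _ := mul_one _
  have h2 : |1 / 2 * δ * (E / t)| ≤ 1 / 2 * (a * B) := by
    rw [abs_mul, abs_mul, abs_of_pos (by norm_num : (0 : ℝ) < 1 / 2), abs_div, abs_of_pos ht]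
    calc _ ≤ 1 / 2 * 1 * (a * t * B / t) := by gcongr
      _ = _ := by field_simp
  have h3 : |1 / 4 * (x j * x l) * (E / t ^ 2)| ≤ a * B * (‖x‖ ^ 2 / (4 * t)) := by
    rw [abs_mul, abs_mul, abs_of_pos (by norm_num : (0 : ℝ) < 1 / 4), abs_div,
      abs_of_pos (pow_pos ht 2)]
    calc _ ≤ 1 / 4 * ‖x‖ ^ 2 * (a * t * B / t ^ 2) := by gcongr
      _ = _ := by field_simp
  have h4 := one_add_mul_exp_neg_le (‖x‖ ^ 2 / (4 * t))
  set σ := ‖x‖ ^ 2 / (4 * t) with hσ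
  have hσ0 : 0 ≤ σ := by positivity
  have h5 : |a * Real.exp (-(a * t)) * δ + 1 / 2 * δ * (E / t) - 1 / 4 * (x j * x l) * (E / t ^ 2)|
      ≤ 2 * a * B * (1 + σ) := by
    refine (abs_sub _ _).trans (((add_le_add (abs_add_le _ _) le_rfl)).trans ?_)
    have : 0 < a * B := by positivity
    nlinarith [mul_nonneg this.le hσ0]
  have h6 : -(1 / (8 * t) * ‖x‖ ^ 2) = -(σ / 2) := by rw [hσ]; field_simp; ring
  have hc0 : 0 < (4 * Real.pi) ^ (-(n / 2 : ℝ)) := by positivity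
  have hd0 : 0 < t ^ (-(n / 2 : ℝ)) * Real.exp (-σ) := by positivity
  rw [greenKernel, ← hσ, ← hEdef, ← hδ, abs_mul, abs_mul, abs_of_pos hc0, abs_of_pos hd0, h6]
  calc _ ≤ (4 * Real.pi) ^ (-(n / 2 : ℝ)) * (2 * a * B * (1 + σ) *
        (t ^ (-(n / 2 : ℝ)) * Real.exp (-σ))) := by gcongr
    _ = (4 * Real.pi) ^ (-(n / 2 : ℝ)) * (2 * a) * (B * (t ^ (-(n / 2 : ℝ)) *
        ((1 + σ) * Real.exp (-σ)))) := by ring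
    _ ≤ (4 * Real.pi) ^ (-(n / 2 : ℝ)) * (2 * a) * (B * (t ^ (-(n / 2 : ℝ)) *
        (2 * Real.exp (-(σ / 2))))) := by gcongr
    _ = _ := by ring

open Set in
-- The factor t^(-n/2) compensates the mass of the Gaussian in x, so only exp(-bt) is left to
-- integrate over time.
theorem integrable_heat_majorant {n : ℕ} {b : ℝ} (hb : 0 < b) :
    Integrable (fun p : ℝ × Space n => Real.exp (-(b * p.1)) *
      (p.1 ^ (-(n / 2 : ℝ)) * Real.exp (-(1 / (8 * p.1) * ‖p.2‖ ^ 2))))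
      ((volume.restrict (Ioi 0)).prod volume) := by
  rw [integrable_prod_iff (by
    have : Measurable fun p : ℝ × Space n => Real.exp (-(b * p.1)) *
      (p.1 ^ (-(n / 2 : ℝ)) * Real.exp (-(1 / (8 * p.1) * ‖p.2‖ ^ 2))) := by fun_prop
    exact this.aestronglyMeasurable)]
  constructor
  · filter_upwards [ae_restrict_mem measurableSet_Ioi] with t ht
    rw [mem_Ioi] at ht
    exact ((integrable_exp_neg_mul_norm_sq (by positivity)).const_mul _).const_mul _
  · have h : IntegrableOn (fun t : ℝ => Real.exp (-b * t) * (8 * Real.pi) ^ (n / 2 : ℝ)) (Ioi 0) :=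
      (integrableOn_exp_mul_Ioi (neg_lt_zero.2 hb) 0).mul_const _
    refine h.congr_fun (fun t ht => ?_) measurableSet_Ioi
    rw [mem_Ioi] at ht
    have e : ∀ x : Space n, ‖Real.exp (-(b * t)) * (t ^ (-(n / 2 : ℝ)) *
        Real.exp (-(1 / (8 * t) * ‖x‖ ^ 2)))‖ = Real.exp (-(b * t)) * (t ^ (-(n / 2 : ℝ)) *
        Real.exp (-(1 / (8 * t) * ‖x‖ ^ 2))) := fun x => Real.norm_of_nonneg (by positivity)
    simp only [e]
    rw [integral_const_mul, integral_const_mul, integral_exp_neg_mul_norm_sq (by positivity),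
      neg_mul]
    congr 1
    rw [show Real.pi / (1 / (8 * t)) = t * (8 * Real.pi) by field_simp,
      Real.mul_rpow ht.le (by positivity), ← mul_assoc, ← Real.rpow_add ht]
    simp

open Set in
theorem integrable_greenKernel {n : ℕ} {a b : ℝ} (hb : 0 < b) (hab : b ≤ a) (j l : Fin n) :
    Integrable (fun p : ℝ × Space n => greenKernel a b j l p.1 p.2)
      ((volume.restrict (Ioi 0)).prod volume) := by
  refine ((integrable_heat_majorant hb).const_mul
    ((4 * Real.pi) ^ (-(n / 2 : ℝ)) * (4 * a))).mono' ?_ ?_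
  · have : Measurable fun p : ℝ × Space n => greenKernel a b j l p.1 p.2 := by
      unfold greenKernel; fun_prop
    exact this.aestronglyMeasurable
  · have h : ∀ᵐ p ∂((volume.restrict (Ioi (0 : ℝ))).prod (volume : Measure (Space n))),
        p.1 ∈ Ioi (0 : ℝ) :=
      Measure.quasiMeasurePreserving_fst.ae (ae_restrict_mem measurableSet_Ioi)
    filter_upwards [h] with p hp
    exact abs_greenKernel_le hb hab j l hp p.2

theorem ae_ne_zero {n : ℕ} (hn : 0 < n) : ∀ᵐ x : Space n, x ≠ 0 := by
  have := nontrivial_space hn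
  exact Measure.ae_ne volume 0

theorem integrable_greenEntry {n : ℕ} (hn : 1 < n) {a b : ℝ} (hb : 0 < b) (hab : b ≤ a)
    (j l : Fin n) : Integrable (fun x : Space n => greenEntry a b j l x) := by
  refine (integrable_greenKernel hb hab j l).integral_prod_right.congr ?_
  filter_upwards [ae_ne_zero (by lia)] with x hx
  exact integral_greenKernel hn (hb.trans_le hab) hb j l hx

theorem integral_character_mul_greenKernel {n : ℕ} (a b : ℝ) (j l : Fin n) {t : ℝ} (ht : 0 < t)
    (ξ : Space n) :
    ∫ x : Space n, Real.fourierChar (-⟪x, ξ⟫_ℝ) • (greenKernel a b j l t x : ℂ) =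
      ((a * Real.exp (-(a * t)) * (if j = l then 1 else 0) + 4 * Real.pi ^ 2 * (ξ j * ξ l) *
        (Real.exp (-(a * t)) - Real.exp (-(b * t)))) *
          Real.exp (-(4 * Real.pi ^ 2 * ‖ξ‖ ^ 2 * t)) : ℝ) := by
  set β := 1 / (4 * t) with hβ
  have hβ0 : 0 < β := by positivity
  set E := Real.exp (-(a * t)) - Real.exp (-(b * t)) with hEdef
  set A := a * Real.exp (-(a * t)) with hAdef
  set c := (4 * Real.pi) ^ (-(n / 2 : ℝ)) with hc
  set d := t ^ (-(n / 2 : ℝ)) with hd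
  have hosc : ∀ x : Space n, oscGauss β ξ x =
      Real.fourierChar (-⟪x, ξ⟫_ℝ) • ((Real.exp (-(‖x‖ ^ 2 / (4 * t))) : ℝ) : ℂ) := by
    intro x
    rw [Circle.smul_def, Real.fourierChar_apply, smul_eq_mul, oscGauss, Complex.ofReal_exp,
      ← Complex.exp_add, hβ, real_inner_comm]
    congr 1
    push_cast
    ring
  have hpt : ∀ x : Space n, Real.fourierChar (-⟪x, ξ⟫_ℝ) • (greenKernel a b j l t x : ℂ) =
      (c * d * (A * (if j = l then 1 else 0)) : ℂ) * oscGauss β ξ x +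
        ((c * d * E * (2 * β * (if j = l then 1 else 0)) : ℂ) * oscGauss β ξ x -
        (c * d * E * (4 * β ^ 2) : ℂ) * ((x j * x l : ℂ) * oscGauss β ξ x)) := by
    intro x
    rw [hosc, greenKernel, Circle.smul_def, Circle.smul_def, smul_eq_mul, smul_eq_mul, ← hEdef,
      ← hAdef, ← hc, ← hd]
    have ht' : (t : ℂ) ≠ 0 := by exact_mod_cast ht.ne'
    split_ifs <;> rw [hβ] <;> push_cast <;> field_simp <;> ring
  have hi := integrable_oscGauss hβ0 ξ
  have hi2 := integrable_coord_mul_coord_mul_oscGauss hβ0 ξ j l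
  have hsub : Integrable fun x : Space n =>
        ((c * d * E * (2 * β * (if j = l then 1 else 0)) : ℂ) * oscGauss β ξ x -
        (c * d * E * (4 * β ^ 2) : ℂ) * ((x j * x l : ℂ) * oscGauss β ξ x)) :=
    (hi.const_mul _).sub (hi2.const_mul _)
  simp only [hpt]
  rw [integral_add (hi.const_mul _) hsub, integral_sub (hi.const_mul _) (hi2.const_mul _),
    integral_const_mul, integral_const_mul, integral_const_mul]
  have h1 := integral_coord_mul_coord_mul_oscGauss hβ0 ξ j l
  have h2 := integral_oscGauss (n := n) hβ0 ξ
  -- The heat kernel has total mass one.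
  have h3 : c * d * (Real.pi / β) ^ (n / 2 : ℝ) = 1 := by
    rw [show Real.pi / β = 4 * Real.pi * t by rw [hβ]; field_simp,
      Real.mul_rpow (by positivity) ht.le, hc, hd, Real.rpow_neg (by positivity),
      Real.rpow_neg ht.le]
    have : 0 < (4 * Real.pi) ^ (n / 2 : ℝ) := by positivity
    have : 0 < t ^ (n / 2 : ℝ) := by positivity
    field_simp
  have h4 : (c * d : ℂ) * ∫ x, oscGauss β ξ x =
      ((Real.exp (-(4 * Real.pi ^ 2 * ‖ξ‖ ^ 2 * t)) : ℝ) : ℂ) := by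
    rw [h2]
    norm_cast
    rw [← mul_assoc, h3, one_mul, hβ]
    congr 1
    field_simp
  have h5 : ((if j = l then 1 else 0 : ℝ) : ℂ) = if j = l then 1 else 0 := by
    split_ifs <;> simp
  push_cast [h5] at h4 ⊢
  linear_combination (-(c * d * E : ℂ)) * h1 +
    (A * (if j = l then 1 else 0) + 4 * Real.pi ^ 2 * (ξ j * ξ l) * E : ℂ) * h4

open Set in
-- Fubini reduces the claim to a fixed time. There the bracket is A δ plus second derivatives of a
-- Gaussian, which become multiplication by ξ_j ξ_l, and the time integrals are ∫ exp(-(κ + q)t) dt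
-- = 1 / (κ + q).
theorem fourier_greenEntry {n : ℕ} (hn : 1 < n) {a b : ℝ} (hb : 0 < b) (hab : b ≤ a)
    (j l : Fin n) (ξ : Space n) :
    𝓕 (fun x : Space n => (greenEntry a b j l x : ℂ)) ξ =
      ((a * (if j = l then 1 else 0) / (a + 4 * Real.pi ^ 2 * ‖ξ‖ ^ 2) +
        4 * Real.pi ^ 2 * (ξ j * ξ l) * (1 / (a + 4 * Real.pi ^ 2 * ‖ξ‖ ^ 2) -
          1 / (b + 4 * Real.pi ^ 2 * ‖ξ‖ ^ 2)) : ℝ) : ℂ) := by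
  have ha : 0 < a := hb.trans_le hab
  set q := 4 * Real.pi ^ 2 * ‖ξ‖ ^ 2 with hq
  have hq0 : 0 ≤ q := by positivity
  have hF : Integrable (Function.uncurry fun (x : Space n) (t : ℝ) =>
      Real.fourierChar (-⟪x, ξ⟫_ℝ) • (greenKernel a b j l t x : ℂ))
      (volume.prod (volume.restrict (Ioi 0))) := by
    have h := ((integrable_greenKernel hb hab j l).ofReal (𝕜 := ℂ)).swap
    have hc : Continuous fun p : Space n × ℝ => Real.fourierChar (-⟪p.1, ξ⟫_ℝ) :=
      Real.continuous_fourierChar.comp (by fun_prop)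
    exact h.mono (hc.aestronglyMeasurable.smul h.1) (ae_of_all _ fun p => by
      rw [Function.uncurry, Circle.norm_smul]; rfl)
  have h1 : 𝓕 (fun x : Space n => (greenEntry a b j l x : ℂ)) ξ =
      ∫ x : Space n, ∫ t in Ioi (0 : ℝ),
        Real.fourierChar (-⟪x, ξ⟫_ℝ) • (greenKernel a b j l t x : ℂ) := by
    rw [Real.fourier_eq]
    refine integral_congr_ae ?_
    filter_upwards [ae_ne_zero (by lia)] with x hx
    simp only [Circle.smul_def]
    rw [integral_smul, integral_complex_ofReal, integral_greenKernel hn ha hb j l hx]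
  have hexp : ∀ κ : ℝ, 0 < κ →
      IntegrableOn (fun t : ℝ => Real.exp (-(κ * t)) * Real.exp (-(q * t))) (Ioi 0) ∧
      ∫ t in Ioi (0 : ℝ), Real.exp (-(κ * t)) * Real.exp (-(q * t)) = 1 / (κ + q) := by
    intro κ hκ
    have e : ∀ t : ℝ, Real.exp (-(κ * t)) * Real.exp (-(q * t)) = Real.exp (-(κ + q) * t) :=
      fun t => by rw [← Real.exp_add]; congr 1; ring
    simp only [e]
    refine ⟨integrableOn_exp_mul_Ioi (by linarith) 0, ?_⟩
    rw [integral_exp_mul_Ioi (by linarith), mul_zero, Real.exp_zero, neg_div_neg_eq]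
  rw [h1, integral_integral_swap hF,
    setIntegral_congr_fun measurableSet_Ioi fun t ht =>
      integral_character_mul_greenKernel a b j l ht ξ, integral_complex_ofReal]
  congr 1
  have e : ∀ t : ℝ, (a * Real.exp (-(a * t)) * (if j = l then 1 else 0) +
      4 * Real.pi ^ 2 * (ξ j * ξ l) * (Real.exp (-(a * t)) - Real.exp (-(b * t)))) *
        Real.exp (-(4 * Real.pi ^ 2 * ‖ξ‖ ^ 2 * t)) =
      (a * (if j = l then 1 else 0) + 4 * Real.pi ^ 2 * (ξ j * ξ l)) *
        (Real.exp (-(a * t)) * Real.exp (-(q * t))) -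
      4 * Real.pi ^ 2 * (ξ j * ξ l) * (Real.exp (-(b * t)) * Real.exp (-(q * t))) := fun t => by
    rw [← hq]; ring
  simp only [e]
  rw [integral_sub ((hexp a ha).1.const_mul _) ((hexp b hb).1.const_mul _), integral_const_mul,
    integral_const_mul, (hexp a ha).2, (hexp b hb).2]
  ring

theorem gField_single_ae_eq {n N : ℕ} (hn : n = 2 ∨ n = 3) {lam mu : ℝ} (hmu : 0 < mu)
    (hlm : 0 < lam + mu) (Y : Fin N → Space n) (p : Fin n × Fin N) :
    gField lam mu Y (-1) (EuclideanSpace.single p 1) =ᵐ[volume] fun x => WithLp.toLp 2 fun j =>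
      (greenEntry (1 / mu) (1 / (lam + 2 * mu)) j p.1 (x - Y p.2) : ℂ) := by
  have hlm2 : 0 < lam + 2 * mu := by linarith
  set a := 1 / mu with ha
  set b := 1 / (lam + 2 * mu) with hb
  have hb0 : 0 < b := by positivity
  have hab : b ≤ a := one_div_le_one_div_of_le hmu (by linarith)
  have hn1 : 1 < n := by rcases hn with rfl | rfl <;> norm_num
  set V : Space n → Val n := fun x => WithLp.toLp 2 fun j => (greenEntry a b j p.1 x : ℂ) with hV
  have hVi : Integrable V := by
    have e : V = fun x => ∑ j, (greenEntry a b j p.1 x : ℂ) • EuclideanSpace.single j (1 : ℂ) := by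
      ext x i
      simp [hV, Pi.single_apply]
    rw [e]
    exact integrable_finsetSum _ fun j _ =>
      ((integrable_greenEntry hn1 hb0 hab j p.1).ofReal (𝕜 := ℂ)).smul_const _
  have hVf : ∀ ξ, 𝓕 V ξ = resSymb lam mu (-1) ξ (EuclideanSpace.single p.1 1) := by
    intro ξ
    ext j
    have h1 : 𝓕 V ξ j = 𝓕 (fun x => (greenEntry a b j p.1 x : ℂ)) ξ := by
      have hi : Integrable fun x => Real.fourierChar (-⟪x, ξ⟫_ℝ) • V x :=
        (Real.fourierIntegral_convergent_iff ξ).2 hVi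
      have h := (EuclideanSpace.proj j : Val n →L[ℂ] ℂ).integral_comp_comm hi
      rw [Real.fourier_eq, Real.fourier_eq]
      exact h.symm
    rw [h1, fourier_greenEntry hn1 hb0 hab, resSymb, symb_apply]
    have e1 : resScal mu (-1) ξ = ((a / (a + 4 * Real.pi ^ 2 * ‖ξ‖ ^ 2) : ℝ) : ℂ) := by
      rw [resScal, show ((mu * (2 * Real.pi) ^ 2 * ‖ξ‖ ^ 2 : ℝ) : ℂ) - -1 =
        ((mu * (2 * Real.pi) ^ 2 * ‖ξ‖ ^ 2 + 1 : ℝ) : ℂ) by push_cast; ring, ← Complex.ofReal_inv]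
      congr 1
      rw [ha]
      field_simp
      ring
    have e2 : resScal (lam + 2 * mu) (-1) ξ =
        ((b / (b + 4 * Real.pi ^ 2 * ‖ξ‖ ^ 2) : ℝ) : ℂ) := by
      rw [resScal, show (((lam + 2 * mu) * (2 * Real.pi) ^ 2 * ‖ξ‖ ^ 2 : ℝ) : ℂ) - -1 =
        (((lam + 2 * mu) * (2 * Real.pi) ^ 2 * ‖ξ‖ ^ 2 + 1 : ℝ) : ℂ) by push_cast; ring,
        ← Complex.ofReal_inv]
      congr 1
      rw [hb]
      field_simp
      ring
    rw [e1, e2]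
    have ha0 : 0 < a := hb0.trans_le hab
    have hq : 0 ≤ 4 * Real.pi ^ 2 * ‖ξ‖ ^ 2 := by positivity
    -- With this relation the difference of the two fractions in `fourier_greenEntry` becomes the
    -- rank-one coefficient of the inverse symbol.
    have e3 : lam + mu = (a - b) / (a * b) := by
      have h1 : a * mu = 1 := one_div_mul_cancel hmu.ne'
      have h2 : b * (lam + 2 * mu) = 1 := one_div_mul_cancel hlm2.ne'
      rw [eq_div_iff (by positivity)]
      linear_combination a * h2 - b * h1
    rw [e3]
    have hs : (EuclideanSpace.single p.1 (1 : ℂ) : Val n) j = if j = p.1 then 1 else 0 := by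
      simp
    have hin : ⟪cvec ξ, EuclideanSpace.single p.1 (1 : ℂ)⟫_ℂ = ξ p.1 := by
      simp [EuclideanSpace.inner_single_right, cvec_apply]
    simp only [PiLp.add_apply, PiLp.smul_apply, smul_eq_mul, hs, hin, cvec_apply]
    have h2 : (a + 4 * Real.pi ^ 2 * ‖ξ‖ ^ 2) ≠ 0 := by positivity
    have h3 : (b + 4 * Real.pi ^ 2 * ‖ξ‖ ^ 2) ≠ 0 := by positivity
    have h4 : ((if j = p.1 then 1 else 0 : ℝ) : ℂ) = if j = p.1 then 1 else 0 := by
      split_ifs <;> simp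
    rw [← h4]
    norm_cast
    field_simp
    ring
  have hsh : Integrable fun x => V (x - Y p.2) := hVi.comp_sub_right _
  refine ae_eq_of_fourier_ae_eq (g := fun x => V (x - Y p.2)) hsh
    ((fourier_gField_single Y (by lia) hmu hlm (Or.inr (by simp)) p).trans
      (Eventually.of_forall fun ξ => ?_))
  -- Translation by `Y p.2` produces exactly the character in `greenHat`.
  have h := congrFun (VectorFourier.fourierIntegral_comp_add_right Real.fourierChar volume
    (innerₗ (Space n)) V (-Y p.2)) ξ
  change greenHat lam mu (Y p.2) p.1 (-1) ξ = _
  rw [greenHat, ← hVf ξ]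
  have e : (V ∘ fun v => v + -Y p.2) = fun x => V (x - Y p.2) := by
    ext x; simp [sub_eq_add_neg]
  rw [e] at h
  refine Eq.trans ?_ h.symm
  simp only [innerₗ_apply_apply, inner_neg_left, real_inner_comm]
  rfl

/-! ### The Green tensor near the origin -/

/-- Interpolation between the quadratic bound near 0 and the linear one at infinity. The exponent
7/4, like 3/4 in the next bound, leaves a remainder of order s^(-(m - 3/4)): for m = 1 and m = 3/2
the number m - 3/4 is positive, so the time integral converges, and below 1, so the remainder is
integrable at s = 0. -/
theorem abs_exp_neg_sub_one_add_le {x : ℝ} (hx : 0 < x) :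
    |Real.exp (-x) - 1 + x| ≤ x ^ (7 / 4 : ℝ) := by
  have h0 : 0 ≤ Real.exp (-x) - 1 + x := by linarith [Real.add_one_le_exp (-x)]
  rw [abs_of_nonneg h0]
  have h1 : Real.exp (-x) ≤ 1 / (1 + x) := by
    rw [Real.exp_neg, ← one_div]
    exact one_div_le_one_div_of_le (by positivity) (by linarith [Real.add_one_le_exp x])
  rcases le_total x 1 with h | h
  · calc Real.exp (-x) - 1 + x ≤ 1 / (1 + x) - 1 + x := by linarith
      _ = x ^ 2 / (1 + x) := by field_simp; ring
      _ ≤ x ^ 2 := div_le_self (by positivity) (by linarith)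
      _ = x ^ (2 : ℝ) := by norm_cast
      _ ≤ _ := Real.rpow_le_rpow_of_exponent_ge hx h (by norm_num)
  · calc Real.exp (-x) - 1 + x ≤ x := by linarith [Real.exp_le_one_iff.2 (neg_nonpos.2 hx.le)]
      _ = x ^ (1 : ℝ) := (Real.rpow_one x).symm
      _ ≤ _ := Real.rpow_le_rpow_of_exponent_le h (by norm_num)

theorem abs_exp_neg_sub_one_le {x : ℝ} (hx : 0 < x) :
    |Real.exp (-x) - 1| ≤ x ^ (3 / 4 : ℝ) := by
  have h0 : Real.exp (-x) - 1 ≤ 0 := by linarith [Real.exp_le_one_iff.2 (neg_nonpos.2 hx.le)]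
  rw [abs_of_nonpos h0]
  rcases le_total x 1 with h | h
  · calc -(Real.exp (-x) - 1) ≤ x := by linarith [Real.add_one_le_exp (-x)]
      _ = x ^ (1 : ℝ) := (Real.rpow_one x).symm
      _ ≤ _ := Real.rpow_le_rpow_of_exponent_ge hx h (by norm_num)
  · calc -(Real.exp (-x) - 1) ≤ 1 := by linarith [Real.exp_pos (-x)]
      _ ≤ _ := Real.one_le_rpow h (by norm_num)

open Set in
theorem abs_heatInt_sub_le {a m s : ℝ} (ha : 0 < a) (hm : 3 / 4 < m) (hs : 0 < s) :
    |heatInt a (m + 1) s - Real.Gamma m * (4 / s) ^ m| ≤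
      a ^ (3 / 4 : ℝ) * (Real.Gamma (m - 3 / 4) * (4 / s) ^ (m - 3 / 4)) := by
  obtain ⟨i1, e1⟩ := integrableOn_rpow_neg_mul_exp_neg_div (m := m + 1) (by linarith) hs
  obtain ⟨i2, e2⟩ := integrableOn_rpow_neg_mul_exp_neg_div (m := m + 1 / 4) (by linarith) hs
  rw [show m + 1 - 1 = m by ring] at e1
  rw [show m + 1 / 4 - 1 = m - 3 / 4 by ring] at e2
  rw [heatInt, ← e1, ← e2, ← integral_sub (integrableOn_heatInt ha (by linarith) hs) i1,
    ← integral_const_mul, ← Real.norm_eq_abs]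
  refine norm_integral_le_of_norm_le (i2.const_mul _) ?_
  filter_upwards [ae_restrict_mem measurableSet_Ioi] with t ht
  rw [mem_Ioi] at ht
  have h := abs_exp_neg_sub_one_le (mul_pos ha ht)
  rw [Real.mul_rpow ha.le ht.le] at h
  have e : t ^ (-(m + 1 / 4)) = t ^ (3 / 4 : ℝ) * t ^ (-(m + 1)) := by
    rw [← Real.rpow_add ht]; congr 1; ring
  rw [← sub_one_mul, norm_mul, Real.norm_eq_abs, Real.norm_of_nonneg (by positivity), e]
  calc _ ≤ a ^ (3 / 4 : ℝ) * t ^ (3 / 4 : ℝ) * (t ^ (-(m + 1)) * Real.exp (-(s / (4 * t)))) := by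
        gcongr
    _ = _ := by ring

open Set in
-- In the difference the terms of order zero in t cancel, and the linear ones give the static term,
-- an undamped integral.
theorem abs_heatInt_sub_heatInt_add_le {a b m s : ℝ} (ha : 0 < a) (hb : 0 < b) (hm : 3 / 4 < m)
    (hs : 0 < s) :
    |heatInt a (m + 1 + 1) s - heatInt b (m + 1 + 1) s +
        (a - b) * (Real.Gamma m * (4 / s) ^ m)| ≤
      (a ^ (7 / 4 : ℝ) + b ^ (7 / 4 : ℝ)) *
        (Real.Gamma (m - 3 / 4) * (4 / s) ^ (m - 3 / 4)) := by
  obtain ⟨i1, e1⟩ := integrableOn_rpow_neg_mul_exp_neg_div (m := m + 1) (by linarith) hs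
  obtain ⟨i2, e2⟩ := integrableOn_rpow_neg_mul_exp_neg_div (m := m + 1 / 4) (by linarith) hs
  rw [show m + 1 - 1 = m by ring] at e1
  rw [show m + 1 / 4 - 1 = m - 3 / 4 by ring] at e2
  have ia := integrableOn_heatInt ha (m := m + 1 + 1) (by linarith) hs
  have ib := integrableOn_heatInt hb (m := m + 1 + 1) (by linarith) hs
  have iab : IntegrableOn (fun t =>
      Real.exp (-(a * t)) * (t ^ (-(m + 1 + 1)) * Real.exp (-(s / (4 * t)))) -
        Real.exp (-(b * t)) * (t ^ (-(m + 1 + 1)) * Real.exp (-(s / (4 * t))))) (Ioi 0) :=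
    ia.sub ib
  rw [heatInt, heatInt, ← e1, ← e2, ← integral_sub ia ib, ← integral_const_mul,
    ← integral_const_mul, ← integral_add iab (i1.const_mul _), ← Real.norm_eq_abs]
  refine norm_integral_le_of_norm_le (i2.const_mul _) ?_
  filter_upwards [ae_restrict_mem measurableSet_Ioi] with t ht
  rw [mem_Ioi] at ht
  have h1 := abs_exp_neg_sub_one_add_le (mul_pos ha ht)
  have h2 := abs_exp_neg_sub_one_add_le (mul_pos hb ht)
  rw [Real.mul_rpow ha.le ht.le] at h1
  rw [Real.mul_rpow hb.le ht.le] at h2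
  have e : t ^ (-(m + 1 / 4)) = t ^ (7 / 4 : ℝ) * t ^ (-(m + 1 + 1)) := by
    rw [← Real.rpow_add ht]; congr 1; ring
  have e' : t ^ (-(m + 1)) = t * t ^ (-(m + 1 + 1)) := by
    nth_rewrite 2 [← Real.rpow_one t]
    rw [← Real.rpow_add ht]; congr 1; ring
  have key : Real.exp (-(a * t)) * (t ^ (-(m + 1 + 1)) * Real.exp (-(s / (4 * t)))) -
      Real.exp (-(b * t)) * (t ^ (-(m + 1 + 1)) * Real.exp (-(s / (4 * t)))) +
      (a - b) * (t ^ (-(m + 1)) * Real.exp (-(s / (4 * t)))) =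
      ((Real.exp (-(a * t)) - 1 + a * t) - (Real.exp (-(b * t)) - 1 + b * t)) *
        (t ^ (-(m + 1 + 1)) * Real.exp (-(s / (4 * t)))) := by
    rw [e']; ring
  rw [key, norm_mul, Real.norm_eq_abs, Real.norm_of_nonneg (by positivity), e]
  calc _ ≤ (a ^ (7 / 4 : ℝ) * t ^ (7 / 4 : ℝ) + b ^ (7 / 4 : ℝ) * t ^ (7 / 4 : ℝ)) *
        (t ^ (-(m + 1 + 1)) * Real.exp (-(s / (4 * t)))) := by
        gcongr
        exact (abs_sub _ _).trans (add_le_add h1 h2)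
    _ = _ := by ring

open Set in
-- Adding a primitive K s^r of the bound makes both f and -f nondecreasing. Monotonicity for f gives
-- the limit, and the one for -f supplies the lower bound that keeps it finite.
theorem exists_tendsto_of_abs_deriv_le {f f' : ℝ → ℝ} {C σ : ℝ} (hσ : σ < 1)
    (hf : ∀ s, 0 < s → HasDerivAt f (f' s) s) (hb : ∀ s, 0 < s → |f' s| ≤ C * s ^ (-σ)) :
    ∃ L, Tendsto f (𝓝[>] 0) (𝓝 L) := by
  set r := 1 - σ with hr
  have hr0 : 0 < r := by linarith
  set K := C / r with hK
  have hp : ∀ s : ℝ, 0 < s → HasDerivAt (fun s : ℝ => K * s ^ r) (C * s ^ (-σ)) s := by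
    intro s hs
    refine ((Real.hasDerivAt_rpow_const (Or.inl hs.ne')).const_mul K).congr_deriv ?_
    rw [hK, show r - 1 = -σ by rw [hr]; ring]
    field_simp
  have hmono : ∀ ε : ℝ, |ε| = 1 → MonotoneOn (fun s => ε * f s + K * s ^ r) (Ioi 0) := by
    intro ε hε
    have hd : ∀ s, 0 < s →
        HasDerivAt (fun s => ε * f s + K * s ^ r) (ε * f' s + C * s ^ (-σ)) s :=
      fun s hs => ((hf s hs).const_mul ε).add (hp s hs)
    refine monotoneOn_of_deriv_nonneg (convex_Ioi 0)
      (fun s hs => (hd s hs).continuousAt.continuousWithinAt)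
      (fun s hs => (hd s (by simpa using hs)).differentiableAt.differentiableWithinAt)
      fun s hs => ?_
    have hs' : 0 < s := by simpa using hs
    rw [(hd s hs').deriv]
    have h1 : |ε * f' s| ≤ C * s ^ (-σ) := by rw [abs_mul, hε, one_mul]; exact hb s hs'
    linarith [neg_abs_le (ε * f' s)]
  have h1 := hmono 1 (by simp)
  have h2 := hmono (-1) (by simp)
  have hC : 0 ≤ C := by
    have := (abs_nonneg _).trans (hb 1 one_pos)
    simpa using this
  have hK0 : 0 ≤ K := by positivity
  have hbdd : BddBelow ((fun s => 1 * f s + K * s ^ r) '' Ioo 0 1) := by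
    refine ⟨f 1 - K, ?_⟩
    rintro _ ⟨s, hs, rfl⟩
    have h3 := h2 (mem_Ioi.2 hs.1) (mem_Ioi.2 one_pos) hs.2.le
    simp only [Real.one_rpow] at h3
    have h4 : 0 ≤ K * s ^ r := mul_nonneg hK0 (Real.rpow_nonneg hs.1.le r)
    simp only
    linarith
  have h3 := MonotoneOn.tendsto_nhdsWithin_Ioo_right (nonempty_Ioo.2 one_pos)
    (h1.mono Ioo_subset_Ioi_self) hbdd
  have h4 : Tendsto (fun s : ℝ => K * s ^ r) (𝓝[>] 0) (𝓝 (K * 0 ^ r)) :=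
    ((Real.continuousAt_rpow_const 0 r (Or.inr hr0.le)).tendsto.mono_left
      nhdsWithin_le_nhds).const_mul K
  refine ⟨_, (h3.sub h4).congr fun s => ?_⟩
  ring

/-- The coefficient of the identity in the Kelvin matrix, with `s = |x|²`, `a = 1 / μ` and
`b = 1 / (λ + 2 μ)`. -/
def kelvinDiag (n : ℕ) (a b s : ℝ) : ℝ :=
  if n = 2 then -((a + b) / (8 * Real.pi)) * Real.log s else (a + b) / (8 * Real.pi) * (√s)⁻¹

/-- The coefficient of `x xᵀ` in the Kelvin matrix. -/
def kelvinDyad (n : ℕ) (a b s : ℝ) : ℝ :=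
  if n = 2 then (a - b) / (4 * Real.pi) / s else (a - b) / (8 * Real.pi) * (√s)⁻¹ / s

/-! ### The Kelvin matrix as the undamped limit of the heat integrals. -/

theorem kelvin_apply {n : ℕ} {lam mu : ℝ} (hmu : 0 < mu) (hlm : 0 < lam + mu) (x : Space n)
    (j l : Fin n) :
    kelvin n lam mu x j l =
      ((kelvinDiag n (1 / mu) (1 / (lam + 2 * mu)) (‖x‖ ^ 2) * (if j = l then 1 else 0)
        + kelvinDyad n (1 / mu) (1 / (lam + 2 * mu)) (‖x‖ ^ 2) * (x j * x l) : ℝ) : ℂ) := by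
  have hlm2 : 0 < lam + 2 * mu := by linarith
  have e1 : (lam + 3 * mu) / (mu * (lam + 2 * mu)) = 1 / mu + 1 / (lam + 2 * mu) := by
    rw [div_add_div _ _ hmu.ne' hlm2.ne']; congr 1; ring
  have e2 : (lam + mu) / (mu * (lam + 2 * mu)) = 1 / mu - 1 / (lam + 2 * mu) := by
    rw [div_sub_div _ _ hmu.ne' hlm2.ne']; congr 1; ring
  have e3 : (lam + 3 * mu) / (8 * Real.pi * mu * (lam + 2 * mu)) =
      (1 / mu + 1 / (lam + 2 * mu)) / (8 * Real.pi) := by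
    rw [← e1, div_div]; congr 1; ring
  have e4 : (lam + mu) / (8 * Real.pi * mu * (lam + 2 * mu)) =
      (1 / mu - 1 / (lam + 2 * mu)) / (8 * Real.pi) := by
    rw [← e2, div_div]; congr 1; ring
  rw [kelvin, Matrix.of_apply, kelvinDiag, kelvinDyad, e1, e2, e3, e4, Matrix.one_apply]
  congr 1
  split_ifs <;> simp only [Real.log_pow, Real.sqrt_sq (norm_nonneg x)] <;> push_cast <;>
    ring

theorem gamma_three_half : Real.Gamma (3 / 2) = √Real.pi / 2 := by
  rw [show (3 / 2 : ℝ) = 1 / 2 + 1 by norm_num, Real.Gamma_add_one (by norm_num),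
    Real.Gamma_one_half_eq]
  ring

theorem four_div_rpow_three_half {s : ℝ} (hs : 0 < s) :
    (4 / s) ^ (3 / 2 : ℝ) = 8 * (√s)⁻¹ / s := by
  rw [show (3 / 2 : ℝ) = 1 + 1 / 2 by norm_num, Real.rpow_add (by positivity), Real.rpow_one,
    ← Real.sqrt_eq_rpow, Real.sqrt_div (by norm_num), show (4 : ℝ) = 2 ^ 2 by norm_num,
    Real.sqrt_sq (by norm_num)]
  ring

theorem kelvinDyad_eq {n : ℕ} (hn : n = 2 ∨ n = 3) (a b : ℝ) {s : ℝ} (hs : 0 < s) :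
    kelvinDyad n a b s = (4 * Real.pi) ^ (-(n / 2 : ℝ)) / 4 *
      ((a - b) * (Real.Gamma (n / 2) * (4 / s) ^ (n / 2 : ℝ))) := by
  have hp : 0 < √Real.pi := Real.sqrt_pos.2 Real.pi_pos
  rcases hn with rfl | rfl
  · have e : (((2 : ℕ) : ℝ) / 2) = 1 := by norm_num
    rw [kelvinDyad, if_pos rfl, e, Real.Gamma_one, Real.rpow_one, Real.rpow_neg_one]
    field_simp
  · have e : (((3 : ℕ) : ℝ) / 2) = 3 / 2 := by norm_num
    rw [kelvinDyad, if_neg (by norm_num), e, gamma_three_half, four_pi_rpow_neg_three_half,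
      four_div_rpow_three_half hs]
    field_simp
    ring

/-- The scalar parts are compared through their derivatives, because for n = 2 the logarithm is not
an undamped heat integral, while its derivative is. -/
theorem hasDerivAt_kelvinDiag {n : ℕ} (hn : n = 2 ∨ n = 3) (a b : ℝ) {s : ℝ} (hs : 0 < s) :
    HasDerivAt (kelvinDiag n a b) (-((4 * Real.pi) ^ (-(n / 2 : ℝ)) / 4) *
      (1 / 2 * (a + b) * (Real.Gamma (n / 2) * (4 / s) ^ (n / 2 : ℝ)))) s := by
  have hp : 0 < √Real.pi := Real.sqrt_pos.2 Real.pi_pos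
  rcases hn with rfl | rfl
  · have e : (((2 : ℕ) : ℝ) / 2) = 1 := by norm_num
    have e' : kelvinDiag 2 a b = fun s => -((a + b) / (8 * Real.pi)) * Real.log s := by
      ext s; rw [kelvinDiag, if_pos rfl]
    rw [e', e, Real.Gamma_one, Real.rpow_one, Real.rpow_neg_one]
    refine ((Real.hasDerivAt_log hs.ne').const_mul _).congr_deriv ?_
    field_simp
    ring
  · have e : (((3 : ℕ) : ℝ) / 2) = 3 / 2 := by norm_num
    have e' : kelvinDiag 3 a b = fun s => (a + b) / (8 * Real.pi) * (√s)⁻¹ := by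
      ext s; rw [kelvinDiag, if_neg (by norm_num)]
    rw [e', e, gamma_three_half, four_pi_rpow_neg_three_half, four_div_rpow_three_half hs]
    have hs' : 0 < √s := Real.sqrt_pos.2 hs
    refine (((Real.hasDerivAt_sqrt hs.ne').inv hs'.ne').const_mul _).congr_deriv ?_
    rw [Real.sq_sqrt hs.le]
    field_simp
    ring

theorem hasDerivAt_greenDiag {n : ℕ} (hn : 1 < n) {a b s : ℝ} (ha : 0 < a) (hb : 0 < b)
    (hs : 0 < s) :
    HasDerivAt (greenDiag n a b) (-((4 * Real.pi) ^ (-(n / 2 : ℝ)) / 4) *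
      (a * heatInt a (n / 2 + 1) s + 1 / 2 *
        (heatInt a (n / 2 + 1 + 1) s - heatInt b (n / 2 + 1 + 1) s))) s := by
  have hn' : (1 : ℝ) < n := by exact_mod_cast hn
  have h1 := hasDerivAt_heatInt ha (m := n / 2) (by linarith) hs
  have h2 := hasDerivAt_heatInt ha (m := n / 2 + 1) (by linarith) hs
  have h3 := hasDerivAt_heatInt hb (m := n / 2 + 1) (by linarith) hs
  refine (((h1.const_mul a).add ((h2.sub h3).const_mul (1 / 2))).const_mul
    ((4 * Real.pi) ^ (-(n / 2 : ℝ)))).congr_deriv ?_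
  ring

theorem exists_tendsto_greenDiag_sub_kelvinDiag {n : ℕ} (hn : n = 2 ∨ n = 3) {a b : ℝ}
    (ha : 0 < a) (hb : 0 < b) :
    ∃ L, Tendsto (fun s => greenDiag n a b s - kelvinDiag n a b s) (𝓝[>] 0) (𝓝 L) := by
  have hn1 : 1 < n := by rcases hn with rfl | rfl <;> norm_num
  have hm : (3 / 4 : ℝ) < n / 2 ∧ (n / 2 : ℝ) - 3 / 4 < 1 := by
    rcases hn with rfl | rfl <;> norm_num
  set m : ℝ := n / 2 with hmdef
  set c := (4 * Real.pi) ^ (-m) with hc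
  have hc0 : 0 < c := by positivity
  refine exists_tendsto_of_abs_deriv_le (σ := m - 3 / 4) (C := c / 4 *
      ((a * a ^ (3 / 4 : ℝ) + (a ^ (7 / 4 : ℝ) + b ^ (7 / 4 : ℝ)) / 2) *
        (Real.Gamma (m - 3 / 4) * 4 ^ (m - 3 / 4)))) hm.2
    (fun s hs => (hasDerivAt_greenDiag hn1 ha hb hs).sub (hasDerivAt_kelvinDiag hn a b hs))
    fun s hs => ?_
  rw [← hmdef, ← hc]
  have h1 := abs_heatInt_sub_le ha hm.1 hs
  have h2 := abs_heatInt_sub_heatInt_add_le ha hb hm.1 hs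
  set G := Real.Gamma m * (4 / s) ^ m
  have e4 : (4 / s) ^ (m - 3 / 4) = 4 ^ (m - 3 / 4) * s ^ (-(m - 3 / 4)) := by
    rw [Real.div_rpow (by norm_num) hs.le, Real.rpow_neg hs.le, div_eq_mul_inv]
  rw [e4] at h1 h2
  set P := Real.Gamma (m - 3 / 4) * (4 ^ (m - 3 / 4) * s ^ (-(m - 3 / 4))) with hP
  -- The static terms match since (a + b) / 2 = a - (a - b) / 2; only the two Taylor remainders
  -- survive.
  have e : -(c / 4) * (a * heatInt a (m + 1) s +
        1 / 2 * (heatInt a (m + 1 + 1) s - heatInt b (m + 1 + 1) s)) -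
      -(c / 4) * (1 / 2 * (a + b) * G) = -(c / 4) * (a * (heatInt a (m + 1) s - G) +
        1 / 2 * (heatInt a (m + 1 + 1) s - heatInt b (m + 1 + 1) s + (a - b) * G)) := by ring
  rw [e, abs_mul, abs_neg, abs_of_pos (by positivity)]
  have h3 : |a * (heatInt a (m + 1) s - G) +
        1 / 2 * (heatInt a (m + 1 + 1) s - heatInt b (m + 1 + 1) s + (a - b) * G)| ≤
      a * (a ^ (3 / 4 : ℝ) * P) + 1 / 2 * ((a ^ (7 / 4 : ℝ) + b ^ (7 / 4 : ℝ)) * P) := by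
    refine (abs_add_le _ _).trans ?_
    rw [abs_mul, abs_mul, abs_of_pos ha, abs_of_pos (by norm_num : (0 : ℝ) < 1 / 2)]
    gcongr
  calc _ ≤ c / 4 * (a * (a ^ (3 / 4 : ℝ) * P) +
        1 / 2 * ((a ^ (7 / 4 : ℝ) + b ^ (7 / 4 : ℝ)) * P)) := by gcongr
    _ = _ := by rw [hP]; ring

/-- The factor s = |x|² stands for x_j x_l, which it dominates; it makes the remainder of order s^(1
- (m - 3/4)), a positive power. -/
theorem tendsto_mul_greenDyad_sub_kelvinDyad {n : ℕ} (hn : n = 2 ∨ n = 3) {a b : ℝ}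
    (ha : 0 < a) (hb : 0 < b) :
    Tendsto (fun s => s * (greenDyad n a b s - kelvinDyad n a b s)) (𝓝[>] 0) (𝓝 0) := by
  have hm : (3 / 4 : ℝ) < n / 2 ∧ 0 < 1 - ((n / 2 : ℝ) - 3 / 4) := by
    rcases hn with rfl | rfl <;> norm_num
  set m : ℝ := n / 2 with hmdef
  set c := (4 * Real.pi) ^ (-m) with hc
  have hc0 : 0 < c := by positivity
  set K := c / 4 * ((a ^ (7 / 4 : ℝ) + b ^ (7 / 4 : ℝ)) *
    (Real.Gamma (m - 3 / 4) * 4 ^ (m - 3 / 4))) with hK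
  have h0 : Tendsto (fun s : ℝ => K * s ^ (1 - (m - 3 / 4))) (𝓝[>] 0) (𝓝 0) := by
    have := ((Real.continuousAt_rpow_const 0 (1 - (m - 3 / 4)) (Or.inr hm.2.le)).tendsto.mono_left
      (nhdsWithin_le_nhds (s := Set.Ioi 0))).const_mul K
    rwa [Real.zero_rpow hm.2.ne', mul_zero] at this
  refine squeeze_zero_norm' ?_ h0
  filter_upwards [self_mem_nhdsWithin] with s hs
  rw [Set.mem_Ioi] at hs
  have h2 := abs_heatInt_sub_heatInt_add_le ha hb hm.1 hs
  have e4 : s * (4 / s) ^ (m - 3 / 4) = 4 ^ (m - 3 / 4) * s ^ (1 - (m - 3 / 4)) := by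
    rw [Real.div_rpow (by norm_num) hs.le, Real.rpow_sub hs 1, Real.rpow_one]
    ring
  have e : greenDyad n a b s - kelvinDyad n a b s = -(c / 4) *
      (heatInt a (m + 1 + 1) s - heatInt b (m + 1 + 1) s +
        (a - b) * (Real.Gamma m * (4 / s) ^ m)) := by
    rw [greenDyad, kelvinDyad_eq hn a b hs, ← hmdef, ← hc]; ring
  rw [e, Real.norm_eq_abs, abs_mul, abs_mul, abs_of_pos hs, abs_neg,
    abs_of_pos (by positivity : 0 < c / 4)]
  calc _ ≤ s * (c / 4 * ((a ^ (7 / 4 : ℝ) + b ^ (7 / 4 : ℝ)) *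
        (Real.Gamma (m - 3 / 4) * (4 / s) ^ (m - 3 / 4)))) := by gcongr
    _ = c / 4 * ((a ^ (7 / 4 : ℝ) + b ^ (7 / 4 : ℝ)) *
        (Real.Gamma (m - 3 / 4) * (s * (4 / s) ^ (m - 3 / 4)))) := by ring
    _ = _ := by rw [e4, hK]; ring

theorem tendsto_norm_sq_nhdsNE_zero {n : ℕ} :
    Tendsto (fun x : Space n => ‖x‖ ^ 2) (𝓝[≠] 0) (𝓝[>] 0) := by
  refine tendsto_nhdsWithin_iff.2 ⟨?_, ?_⟩
  · have h : Tendsto (fun x : Space n => ‖x‖ ^ 2) (𝓝 0) (𝓝 (‖(0 : Space n)‖ ^ 2)) :=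
      Continuous.tendsto (by fun_prop) 0
    rw [norm_zero, zero_pow two_ne_zero] at h
    exact h.mono_left nhdsWithin_le_nhds
  · filter_upwards [self_mem_nhdsWithin] with x hx
    have : 0 < ‖x‖ := norm_pos_iff.2 hx
    exact Set.mem_Ioi.2 (by positivity)

theorem exists_isChi_neg_one {n : ℕ} (hn : n = 2 ∨ n = 3) {lam mu : ℝ} (hmu : 0 < mu)
    (hlm : 0 < lam + mu) : ∃ χ, IsChi n lam mu (-1) χ := by
  have hlm2 : 0 < lam + 2 * mu := by linarith
  set a := 1 / mu with ha
  set b := 1 / (lam + 2 * mu) with hb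
  have ha0 : 0 < a := by positivity
  have hb0 : 0 < b := by positivity
  obtain ⟨L, hL⟩ := exists_tendsto_greenDiag_sub_kelvinDiag hn ha0 hb0
  refine ⟨L, tendsto_pi_nhds.2 fun j => tendsto_pi_nhds.2 fun l => ?_⟩
  have h1 := (hL.comp (tendsto_norm_sq_nhdsNE_zero (n := n))).mul_const
    (if j = l then (1 : ℝ) else 0)
  have h2 : Tendsto (fun x : Space n => (greenDyad n a b (‖x‖ ^ 2) - kelvinDyad n a b (‖x‖ ^ 2)) *
      (x j * x l)) (𝓝[≠] 0) (𝓝 0) := by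
    have h0 := ((tendsto_mul_greenDyad_sub_kelvinDyad hn ha0 hb0).comp
      (tendsto_norm_sq_nhdsNE_zero (n := n))).norm
    rw [norm_zero] at h0
    refine squeeze_zero_norm' (Eventually.of_forall fun x => ?_) h0
    rw [Function.comp_apply, norm_mul _ (x j * x l), norm_mul (‖x‖ ^ 2), mul_comm]
    have h : ‖x j * x l‖ ≤ ‖x‖ ^ 2 := by
      rw [norm_mul, sq, Real.norm_eq_abs, Real.norm_eq_abs]
      exact mul_le_mul (abs_coord_le x j) (abs_coord_le x l) (abs_nonneg _) (norm_nonneg _)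
    rw [Real.norm_of_nonneg (by positivity : 0 ≤ ‖x‖ ^ 2)]
    gcongr
  have h3 := (Complex.continuous_ofReal.tendsto _).comp (h1.add h2)
  have e : ((L * (if j = l then 1 else 0) + 0 : ℝ) : ℂ) =
      ((L : ℂ) • (1 : Matrix (Fin n) (Fin n) ℂ)) j l := by
    rw [Matrix.smul_apply, Matrix.one_apply]
    split_ifs <;> simp
  rw [e] at h3
  refine h3.congr' ?_
  filter_upwards [self_mem_nhdsWithin] with x hx
  rw [Matrix.sub_apply, lameGreen_neg_one hn hmu hlm hx, kelvin_apply hmu hlm]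
  simp only [Function.comp_apply, ← ha, ← hb]
  push_cast
  ring

theorem isChi_chi_neg_one {n : ℕ} (hn : n = 2 ∨ n = 3) {lam mu : ℝ} (hmu : 0 < mu)
    (hlm : 0 < lam + mu) : IsChi n lam mu (-1) (chi n lam mu (-1)) :=
  Classical.epsilon_spec (exists_isChi_neg_one hn hmu hlm)

section

/-! ### Singular and regular parts -/

theorem coeFn_sum_ae_eq {n : ℕ} {ι : Type*} (t : Finset ι) (f : ι → L2 n) :
    ((∑ i ∈ t, f i : L2 n) : Space n → Val n) =ᵐ[volume] fun x => ∑ i ∈ t, f i x := by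
  classical
  induction t using Finset.induction_on with
  | empty =>
    simp only [Finset.sum_empty]
    exact Lp.coeFn_zero _ _ _
  | insert a t ha ih =>
    simp only [Finset.sum_insert ha]
    filter_upwards [Lp.coeFn_add (f a) (∑ i ∈ t, f i), ih] with x h1 h2
    rw [h1, Pi.add_apply, h2]

theorem gField_ae_eq {n N : ℕ} (hn : n = 2 ∨ n = 3) {lam mu : ℝ} (hmu : 0 < mu)
    (hlm : 0 < lam + mu) (Y : Fin N → Space n) (X : Mat n N) :
    gField lam mu Y (-1) X =ᵐ[volume] fun x => WithLp.toLp 2 fun j =>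
      ∑ q, lameGreen n lam mu (-1) (x - Y q.2) j q.1 * X q := by
  have e : gField lam mu Y (-1) X =
      ∑ q, X q • gField lam mu Y (-1) (EuclideanSpace.single q 1) := by
    have h : X = ∑ q, X q • EuclideanSpace.single q (1 : ℂ) := by
      ext p
      simp [Pi.single_apply]
    conv_lhs => rw [h]
    rw [map_sum]
    simp only [map_smul]
  have := nontrivial_space (n := n) (by lia)
  have h1 : ∀ᵐ x : Space n, ∀ q : Fin n × Fin N, x ≠ Y q.2 :=
    ae_all_iff.2 fun q => Measure.ae_ne volume (Y q.2)
  have h2 : ∀ᵐ x : Space n, ∀ q : Fin n × Fin N,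
      (X q • gField lam mu Y (-1) (EuclideanSpace.single q 1) : L2 n) x =
        X q • gField lam mu Y (-1) (EuclideanSpace.single q 1) x :=
    ae_all_iff.2 fun q => Lp.coeFn_smul _ _
  have h3 := ae_all_iff.2 fun q : Fin n × Fin N => gField_single_ae_eq hn hmu hlm Y q
  rw [e]
  filter_upwards [coeFn_sum_ae_eq Finset.univ
    fun q => X q • gField lam mu Y (-1) (EuclideanSpace.single q 1), h1, h2, h3] with x h0 h1 h2 h3
  rw [h0]
  ext j
  rw [WithLp.ofLp_sum, Finset.sum_apply]
  refine Finset.sum_congr rfl fun q _ => ?_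
  rw [h2, h3, lameGreen_neg_one hn hmu hlm (sub_ne_zero.2 (h1 q)), mul_comm _ (X q)]
  rfl

theorem essNhds_le_nhdsNE {n : ℕ} (hn : 0 < n) (y : Space n) : essNhds y ≤ 𝓝[≠] y := by
  have := nontrivial_space hn
  exact inf_le_inf_left _ (le_principal_iff.2 (Measure.ae_ne volume y))

theorem tendsto_sub_essNhds {n : ℕ} (hn : 0 < n) (y : Space n) :
    Tendsto (fun x => x - y) (essNhds y) (𝓝[≠] 0) := by
  refine tendsto_nhdsWithin_iff.2 ⟨?_, ?_⟩
  · have h : Tendsto (fun x : Space n => x - y) (𝓝 y) (𝓝 (y - y)) :=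
      Continuous.tendsto (by fun_prop) y
    rw [sub_self] at h
    exact h.mono_left inf_le_left
  · filter_upwards [essNhds_le_nhdsNE hn y self_mem_nhdsWithin] with x hx
    exact sub_ne_zero.2 hx

/-- The function `u₀ + G_{-1} X` has the singular part `X` and the regular part
`γ u₀ + Ξ_{-1} X + χ_{-1} X`. -/
theorem tendsto_sub_kelvin {n N : ℕ} (hn : n = 2 ∨ n = 3) {lam mu : ℝ} (hmu : 0 < mu)
    (hlm : 0 < lam + mu) {Y : Fin N → Space n} (hY : Function.Injective Y) (u : H2 n)
    (X : Mat n N) (p : Fin n × Fin N) :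
    Tendsto (fun x => (u + gField lam mu Y (-1) X : L2 n) x p.1 -
        ∑ l, kelvin n lam mu (x - Y p.2) p.1 l * X (l, p.2)) (essNhds (Y p.2))
      (𝓝 ((gammaTrace Y u + (xi lam mu Y (-1) X + chi n lam mu (-1) • X)) p)) := by
  obtain ⟨v, hv, huv⟩ := exists_continuous_rep (by lia) u.2
  have hrep : (fun x => (u + gField lam mu Y (-1) X : L2 n) x p.1 -
        ∑ l, kelvin n lam mu (x - Y p.2) p.1 l * X (l, p.2)) =ᵐ[volume]
      fun x => v x p.1 + ∑ q : Fin n × Fin N,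
        (lameGreen n lam mu (-1) (x - Y q.2) p.1 q.1 * X q -
          if q.2 = p.2 then kelvin n lam mu (x - Y p.2) p.1 q.1 * X q else 0) := by
    filter_upwards [Lp.coeFn_add (u : L2 n) (gField lam mu Y (-1) X), huv,
      gField_ae_eq hn hmu hlm Y X] with x h1 h2 h3
    rw [h1, Pi.add_apply, h2, h3, Finset.sum_sub_distrib]
    have e : ∑ q : Fin n × Fin N, (if q.2 = p.2 then kelvin n lam mu (x - Y p.2) p.1 q.1 * X q
        else 0) = ∑ l, kelvin n lam mu (x - Y p.2) p.1 l * X (l, p.2) := by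
      simp [Fintype.sum_prod_type]
    rw [e, PiLp.add_apply, add_sub_assoc]
  refine Tendsto.congr' (hrep.symm.filter_mono inf_le_right) ?_
  -- The limit is taken term by term: sources at the same point give Γ_{-1} - Γ₀ → χ_{-1}, and the
  -- other columns are continuous there and assemble to Ξ_{-1}.
  have hlim : (gammaTrace Y u + (xi lam mu Y (-1) X + chi n lam mu (-1) • X)) p =
      v (Y p.2) p.1 + ∑ q : Fin n × Fin N, (if q.2 = p.2 then
        (chi n lam mu (-1) • (1 : Matrix (Fin n) (Fin n) ℂ)) p.1 q.1 * X q
        else lameGreen n lam mu (-1) (Y p.2 - Y q.2) p.1 q.1 * X q) := by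
    rw [PiLp.add_apply, gammaTrace_eq Y hv huv, PiLp.add_apply, xi, Matrix.ofLp_toEuclideanCLM,
      Matrix.mulVec, dotProduct, PiLp.smul_apply]
    have e : chi n lam mu (-1) • X p = ∑ q : Fin n × Fin N, (if q.2 = p.2 then
        (chi n lam mu (-1) • (1 : Matrix (Fin n) (Fin n) ℂ)) p.1 q.1 * X q else 0) := by
      simp [Fintype.sum_prod_type, Matrix.one_apply]
    rw [e, ← Finset.sum_add_distrib]
    congr 1
    refine Finset.sum_congr rfl fun q _ => ?_
    rw [Matrix.of_apply]
    split_ifs <;> simp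
  rw [hlim]
  refine Tendsto.add ?_ (tendsto_finsetSum _ fun q _ => ?_)
  · have h : ContinuousAt (fun x => v x p.1) (Y p.2) := by fun_prop
    exact h.tendsto.mono_left inf_le_left
  · have hsub := tendsto_sub_essNhds (n := n) (by lia) (Y p.2)
    split_ifs with h
    · have h1 := ((tendsto_pi_nhds.1 (tendsto_pi_nhds.1 (isChi_chi_neg_one hn hmu hlm) p.1)
        q.1).comp hsub).mul_const (X q)
      refine h1.congr fun x => ?_
      rw [h, Function.comp_apply, Matrix.sub_apply, sub_mul]
    · have hne : Y p.2 - Y q.2 ≠ 0 := sub_ne_zero.2 fun h' => h (hY h').symm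
      have h1 : ContinuousAt (fun x => lameGreen n lam mu (-1) (x - Y q.2) p.1 q.1) (Y p.2) :=
        (continuousAt_lameGreen_neg_one hn hmu hlm hne p.1 q.1).comp
          (f := fun x => x - Y q.2) (by fun_prop)
      simp only [sub_zero]
      exact (h1.tendsto.mono_left inf_le_left).mul_const _

/-! ### Inverting the Kelvin matrix near the origin. -/

theorem kelvinDyad_nonneg (n : ℕ) {a b s : ℝ} (hab : b ≤ a) (hs : 0 ≤ s) :
    0 ≤ kelvinDyad n a b s := by
  have : 0 ≤ a - b := sub_nonneg.2 hab
  rw [kelvinDyad]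
  split_ifs <;> positivity

theorem tendsto_kelvinDiag_atTop (n : ℕ) {a b : ℝ} (hab : 0 < a + b) :
    Tendsto (kelvinDiag n a b) (𝓝[>] 0) atTop := by
  have hc : 0 < (a + b) / (8 * Real.pi) := by positivity
  by_cases h : n = 2
  · have e : kelvinDiag n a b = fun s => (a + b) / (8 * Real.pi) * -Real.log s := by
      ext s; rw [kelvinDiag, if_pos h]; ring
    rw [e]
    exact (tendsto_neg_atBot_atTop.comp Real.tendsto_log_nhdsGT_zero).const_mul_atTop hc
  · have e : kelvinDiag n a b = fun s => (a + b) / (8 * Real.pi) * (√s)⁻¹ := by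
      ext s; rw [kelvinDiag, if_neg h]
    rw [e]
    refine (tendsto_inv_nhdsGT_zero.comp
      (tendsto_nhdsWithin_iff.2 ⟨?_, ?_⟩)).const_mul_atTop hc
    · have h1 := (Real.continuous_sqrt.tendsto 0).mono_left
        (nhdsWithin_le_nhds (s := Set.Ioi 0))
      rwa [Real.sqrt_zero] at h1
    · filter_upwards [self_mem_nhdsWithin] with s hs
      exact Real.sqrt_pos.2 hs

/-- The Sherman-Morrison formula for β I + α x xᵀ; the signs of α and β keep the denominator
positive. -/
theorem kelvin_mul_eq_one {n : ℕ} {lam mu : ℝ} (hmu : 0 < mu) (hlm : 0 < lam + mu) {x : Space n}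
    {β α : ℝ} (hβ : β = kelvinDiag n (1 / mu) (1 / (lam + 2 * mu)) (‖x‖ ^ 2))
    (hα : α = kelvinDyad n (1 / mu) (1 / (lam + 2 * mu)) (‖x‖ ^ 2)) (hβ0 : 0 < β) (hα0 : 0 ≤ α) :
    kelvin n lam mu x * Matrix.of (fun j l =>
      ((β⁻¹ * ((if j = l then 1 else 0) - α * (x j * x l) / (β + α * ‖x‖ ^ 2)) : ℝ) : ℂ)) = 1 := by
  have hd : 0 < β + α * ‖x‖ ^ 2 := by positivity
  have hs : ∑ i, x i * x i = ‖x‖ ^ 2 := by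
    rw [EuclideanSpace.norm_sq_eq]
    exact Finset.sum_congr rfl fun i _ => by rw [Real.norm_eq_abs, sq_abs, sq]
  ext j l
  rw [Matrix.mul_apply, Matrix.one_apply]
  have e : ∀ i, kelvin n lam mu x j i * Matrix.of (fun j l =>
      ((β⁻¹ * ((if j = l then 1 else 0) - α * (x j * x l) / (β + α * ‖x‖ ^ 2)) : ℝ) : ℂ)) i l =
      (((if j = i then (if i = l then 1 else 0) - α * (x i * x l) / (β + α * ‖x‖ ^ 2) else 0) +
        β⁻¹ * α * (if i = l then x j * x i else 0) -
        β⁻¹ * α * α * (x j * x l) / (β + α * ‖x‖ ^ 2) * (x i * x i) : ℝ) : ℂ) := by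
    intro i
    rw [kelvin_apply hmu hlm, Matrix.of_apply, ← hβ, ← hα, ← Complex.ofReal_mul]
    congr 1
    split_ifs <;> field_simp <;> ring
  simp only [e]
  rw [← Complex.ofReal_sum, Finset.sum_sub_distrib, Finset.sum_add_distrib, ← Finset.mul_sum,
    ← Finset.mul_sum, hs, Finset.sum_ite_eq, Finset.sum_ite_eq']
  simp only [Finset.mem_univ, if_true]
  have h : (if j = l then 1 else 0) - α * (x j * x l) / (β + α * ‖x‖ ^ 2) +
      β⁻¹ * α * (x j * x l) - β⁻¹ * α * α * (x j * x l) / (β + α * ‖x‖ ^ 2) * ‖x‖ ^ 2 =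
      if j = l then 1 else 0 := by
    field_simp
    ring
  rw [h]
  split_ifs <;> simp

/-- The scalar coefficient β tends to +∞ at 0, so it is eventually positive. The rank-one correction
in the inverse is bounded by 1, which gives the constant 2. -/
theorem eventually_kelvin_inv_mul {n : ℕ} {lam mu : ℝ} (hmu : 0 < mu) (hlm : 0 < lam + mu) :
    ∀ᶠ x in 𝓝[≠] (0 : Space n), (kelvin n lam mu x)⁻¹ * kelvin n lam mu x = 1 ∧
      ∀ j l, ‖(kelvin n lam mu x)⁻¹ j l‖ ≤
        2 * (kelvinDiag n (1 / mu) (1 / (lam + 2 * mu)) (‖x‖ ^ 2))⁻¹ := by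
  have hlm2 : 0 < lam + 2 * mu := by linarith
  have hab : 1 / (lam + 2 * mu) ≤ 1 / mu := one_div_le_one_div_of_le hmu (by linarith)
  have h := ((tendsto_kelvinDiag_atTop n (a := 1 / mu) (b := 1 / (lam + 2 * mu))
    (by positivity)).comp (tendsto_norm_sq_nhdsNE_zero (n := n))).eventually_gt_atTop 0
  filter_upwards [h] with x hx
  rw [Function.comp_apply] at hx
  obtain ⟨β, hβ⟩ : ∃ β, β = kelvinDiag n (1 / mu) (1 / (lam + 2 * mu)) (‖x‖ ^ 2) := ⟨_, rfl⟩
  obtain ⟨α, hα⟩ : ∃ α, α = kelvinDyad n (1 / mu) (1 / (lam + 2 * mu)) (‖x‖ ^ 2) := ⟨_, rfl⟩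
  have hα0 : 0 ≤ α := hα ▸ kelvinDyad_nonneg n hab (by positivity)
  rw [← hβ] at hx
  have hinv := Matrix.inv_eq_right_inv (kelvin_mul_eq_one hmu hlm hβ hα hx hα0)
  refine ⟨?_, fun j l => ?_⟩
  · rw [hinv]
    exact mul_eq_one_comm.1 (kelvin_mul_eq_one hmu hlm hβ hα hx hα0)
  · have hd : 0 < β + α * ‖x‖ ^ 2 := by positivity
    rw [hinv, Matrix.of_apply, Complex.norm_real, Real.norm_eq_abs, abs_mul, ← hβ,
      abs_of_pos (inv_pos.2 hx), mul_comm]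
    have h1 : |α * (x j * x l) / (β + α * ‖x‖ ^ 2)| ≤ 1 := by
      rw [abs_div, abs_of_pos hd, div_le_one hd, abs_mul, abs_of_nonneg hα0, abs_mul]
      have := mul_le_mul (abs_coord_le x j) (abs_coord_le x l) (abs_nonneg _) (norm_nonneg _)
      have := mul_le_mul_of_nonneg_left this hα0
      nlinarith
    have h2 : |(if j = l then (1 : ℝ) else 0)| ≤ 1 := by split_ifs <;> simp
    gcongr
    exact (abs_sub _ _).trans (by linarith)

variable {n N : ℕ} {lam mu : ℝ} {Y : Fin N → Space n}

theorem tendsto_kelvin_inv (hmu : 0 < mu) (hlm : 0 < lam + mu) (j l : Fin n) :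
    Tendsto (fun x => (kelvin n lam mu x)⁻¹ j l) (𝓝[≠] 0) (𝓝 0) := by
  have hlm2 : 0 < lam + 2 * mu := by linarith
  have h := ((tendsto_inv_atTop_zero.comp (tendsto_kelvinDiag_atTop n (a := 1 / mu)
    (b := 1 / (lam + 2 * mu)) (by positivity))).comp
    (tendsto_norm_sq_nhdsNE_zero (n := n))).const_mul 2
  rw [mul_zero] at h
  exact squeeze_zero_norm' ((eventually_kelvin_inv_mul hmu hlm).mono fun x hx => hx.2 j l) h

theorem tendsto_tauOneFun (hn : n = 2 ∨ n = 3) (hmu : 0 < mu) (hlm : 0 < lam + mu)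
    (hY : Function.Injective Y) (u : H2 n) (X : Mat n N) (p : Fin n × Fin N) :
    Tendsto (tauOneFun lam mu Y (u + gField lam mu Y (-1) X) p) (essNhds (Y p.2)) (𝓝 (X p)) := by
  have hsub := tendsto_sub_essNhds (n := n) (by lia) (Y p.2)
  -- Decompose Γ₀⁻¹u = Γ₀⁻¹(u - Γ₀X) + X. The bracket has a finite limit by `tendsto_sub_kelvin` and
  -- Γ₀⁻¹ tends to 0.
  have h : Tendsto (fun x => ∑ l, (kelvin n lam mu (x - Y p.2))⁻¹ p.1 l *
      ((u + gField lam mu Y (-1) X : L2 n) x l -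
        ∑ i, kelvin n lam mu (x - Y p.2) l i * X (i, p.2)) + X p) (essNhds (Y p.2))
      (𝓝 ((∑ l : Fin n, 0 * (gammaTrace Y u + (xi lam mu Y (-1) X + chi n lam mu (-1) • X))
        (l, p.2)) + X p)) :=
    (tendsto_finsetSum _ fun l _ => ((tendsto_kelvin_inv hmu hlm p.1 l).comp hsub).mul
      (tendsto_sub_kelvin hn hmu hlm hY u X (l, p.2))).add_const _
  simp only [zero_mul, Finset.sum_const_zero, zero_add] at h
  refine h.congr' ?_
  filter_upwards [hsub.eventually (eventually_kelvin_inv_mul hmu hlm)] with x hx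
  set M := kelvin n lam mu (x - Y p.2)
  have e : ∑ l, M⁻¹ p.1 l * ∑ i, M l i * X (i, p.2) = X p := by
    simp only [Finset.mul_sum]
    rw [Finset.sum_comm]
    have h1 : ∀ i, ∑ l, M⁻¹ p.1 l * (M l i * X (i, p.2)) =
        (1 : Matrix (Fin n) (Fin n) ℂ) p.1 i * X (i, p.2) := fun i => by
      rw [← hx.1, Matrix.mul_apply, Finset.sum_mul]
      exact Finset.sum_congr rfl fun l _ => (mul_assoc _ _ _).symm
    simp [h1, Matrix.one_apply]
  simp only [mul_sub, Finset.sum_sub_distrib]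
  rw [e, sub_add_cancel]
  rfl

theorem tauOne_eq (hn : n = 2 ∨ n = 3) (hmu : 0 < mu) (hlm : 0 < lam + mu)
    (hY : Function.Injective Y) (u : H2 n) (X : Mat n N) :
    tauOne lam mu Y (u + gField lam mu Y (-1) X) = X := by
  ext p
  exact (tendsto_tauOneFun hn hmu hlm hY u X p).limUnder_eq

theorem tendsto_tauTwoFun (hn : n = 2 ∨ n = 3) (hmu : 0 < mu) (hlm : 0 < lam + mu)
    (hY : Function.Injective Y) (u : H2 n) (X : Mat n N) (p : Fin n × Fin N) :
    Tendsto (tauTwoFun lam mu Y (u + gField lam mu Y (-1) X) p) (essNhds (Y p.2))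
      (𝓝 ((gammaTrace Y u + (xi lam mu Y (-1) X + chi n lam mu (-1) • X)) p)) := by
  unfold tauTwoFun
  rw [tauOne_eq hn hmu hlm hY]
  exact tendsto_sub_kelvin hn hmu hlm hY u X p

theorem tauTwo_eq (hn : n = 2 ∨ n = 3) (hmu : 0 < mu) (hlm : 0 < lam + mu)
    (hY : Function.Injective Y) (u : H2 n) (X : Mat n N) :
    tauTwo lam mu Y (u + gField lam mu Y (-1) X) =
      gammaTrace Y u + (xi lam mu Y (-1) X + chi n lam mu (-1) • X) := by
  ext p
  exact (tendsto_tauTwoFun hn hmu hlm hY u X p).limUnder_eq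

theorem bvDomain_eq_bcDomain (hn : n = 2 ∨ n = 3) (hn' : n < 4) (hmu : 0 < mu)
    (hlm : 0 < lam + mu) (hY : Function.Injective Y) (θ : Mat n N →L[ℂ] Mat n N) :
    (bvDomain hn' lam mu Y θ : Set (L2 n)) = bcDomain lam mu Y θ := by
  -- After inserting τ₁ = X and the formula for τ₂, the contributions Ξ_{-1}X + χ_{-1}X appear on
  -- both sides.
  have key : ∀ (u : H2 n) (X : Mat n N), tauTwo lam mu Y (u + gField lam mu Y (-1) X) =
      (xi lam mu Y (-1) + θ + chi n lam mu (-1) • ContinuousLinearMap.id ℂ (Mat n N))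
        (tauOne lam mu Y (u + gField lam mu Y (-1) X)) ↔ gammaTrace Y u = θ X := by
    intro u X
    rw [tauTwo_eq hn hmu hlm hY, tauOne_eq hn hmu hlm hY]
    simp only [_root_.add_apply, _root_.smul_apply, ContinuousLinearMap.id_apply]
    rw [add_comm (xi lam mu Y (-1) X) (θ X), add_assoc]
    exact add_left_inj _
  ext v
  constructor
  · rintro ⟨u, X, h, rfl⟩
    exact ⟨(mem_adjoint_domain_iff hn' hmu hlm Y hY _).2 ⟨u, X, rfl⟩, (key u X).2 h⟩
  · rintro ⟨h1, h2⟩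
    obtain ⟨u, X, rfl⟩ := (mem_adjoint_domain_iff hn' hmu hlm Y hY _).1 h1
    exact ⟨u, X, (key u X).1 h2, rfl⟩

end

end Lame

end

theorem proposition3p5 (n N : ℕ) (hn : n = 2 ∨ n = 3) (lam mu : ℝ) (hmu : 0 < mu)
    (hlam : 0 < n * lam + 2 * mu) (Y : Fin N → Lame.Space n) (hY : Function.Injective Y)
    (θ : Lame.Mat n N →L[ℂ] Lame.Mat n N) (hθ : IsSelfAdjoint θ) :
    -- the objects are well defined: the Weyl function for non-real `z`, the operator `L_{Λ(θ)}`,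
    -- the constant `χ_{-1}`, and the limits in the definition of `τ₁` and `τ₂`
    (∀ z : ℂ, z.im ≠ 0 → z ∈ Lame.zSet lam mu Y θ) ∧
    (∃! T : Lame.L2 n →ₗ.[ℂ] Lame.L2 n, Lame.IsPointPerturbation lam mu Y θ T) ∧
    Lame.IsChi n lam mu (-1) (Lame.chi n lam mu (-1)) ∧
    (∀ u ∈ (Lame.lameMin lam mu Y).adjoint.domain, ∀ p : Fin n × Fin N,
      Tendsto (Lame.tauOneFun lam mu Y u p) (Lame.essNhds (Y p.2))
        (𝓝 (Lame.tauOne lam mu Y u p)) ∧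
      Tendsto (Lame.tauTwoFun lam mu Y u p) (Lame.essNhds (Y p.2))
        (𝓝 (Lame.tauTwo lam mu Y u p))) ∧
    -- the domain of `L_{Λ(θ)}`
    (∀ T : Lame.L2 n →ₗ.[ℂ] Lame.L2 n, Lame.IsPointPerturbation lam mu Y θ T →
      (∀ z ∈ Lame.zSet lam mu Y θ, (T.domain : Set (Lame.L2 n)) = Lame.kreinDomain lam mu Y θ z) ∧
      (T.domain : Set (Lame.L2 n)) = Lame.bcDomain lam mu Y θ) := by
  -- For n = 2 this is half of the hypothesis; for n = 3, 3(λ + μ) = (3λ + 2μ) + μ. Only μ > 0 and λ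
  -- + μ > 0 are used from here on.
  have hlm : 0 < lam + mu := by
    rcases hn with rfl | rfl <;> push_cast at hlam <;> linarith
  have hn4 : n < 4 := by lia
  refine ⟨fun z hz => Lame.mem_zSet_of_im_ne_zero hn4 hmu hlm Y hY hθ hz,
    ⟨_, Lame.isPointPerturbation_bvOperator hn4 hmu hlm hY hθ, fun T hT =>
      hT.eq_bvOperator hn4 hmu hlm hY hθ⟩,
    Lame.isChi_chi_neg_one hn hmu hlm, fun u hu p => ?_, fun T hT =>
      ⟨fun z hz => hT.domain_eq_kreinDomain hn4 hmu hlm hz, ?_⟩⟩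
  · obtain ⟨u₀, X, rfl⟩ := (Lame.mem_adjoint_domain_iff hn4 hmu hlm Y hY u).1 hu
    rw [Lame.tauOne_eq hn hmu hlm hY, Lame.tauTwo_eq hn hmu hlm hY]
    exact ⟨Lame.tendsto_tauOneFun hn hmu hlm hY u₀ X p,
      Lame.tendsto_tauTwoFun hn hmu hlm hY u₀ X p⟩
  · rw [hT.eq_bvOperator hn4 hmu hlm hY hθ, ← Lame.bvDomain_eq_bcDomain hn hn4 hmu hlm hY θ]
    ext v
    exact Lame.mem_bvOperator_domain hn4 hmu hlm Y hY θ v
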